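/- **Setting.** Let $\mathfrak g$ be a complex Lie algebra, $U=U\mathfrak g$ with its standard Hopf structure $\Delta,\varepsilon,S$, $U[[h]]$ the formal power series, and tensor powers of $U[[h]]$ $h$-adically completed, $U[[h]]^{\otimes n}=(U^{\otimes n})[[h]]$. Let $\mathcal F=\mathcal F^{(1)}\otimes\mathcal F^{(2)}\in U[[h]]^{\otimes 2}$ be a twist: $(\varepsilon\otimes\mathrm{id})\mathcal F=1=(\mathrm{id}\otimes\varepsilon)\mathcal F$, $\mathcal F=1\otimes1+O(h)$, and $\Delta_h(x)=\mathcal F\Delta(x)\mathcal F^{-1}$ is coassociative. Write $U_h\mathfrak g$ for the resulting Hopf algebra $(U[[h]],\Delta_h,\varepsilon_h=\varepsilon,S_h)$, $S_h(x)=\gamma^{-1}S(x)\gamma$, $\gamma=S(\mathcal F^{-1(1)})\mathcal F^{-1(2)}$ (for $\mathfrak g$ simple finite-dimensional this covers the quantum group, identified with $U\mathfrak g[[h]]$ as an algebra by Drinfel'd's isomorphism $\varphi_h$). Put $\gamma'=S(\gamma^{-1})$ and let $$\phi=\mathcal F_{12,3}^{-1}\mathcal F_{12}^{-1}\mathcal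 F_{23}\mathcal F_{1,23}$$ be the coassociator, where $\mathcal F_{12,3}=(\Delta\otimes\mathrm{id})\mathcal F$ and so on. Let $\rho$ be an $N$-dimensional matrix representation of $\mathfrak g$ and $\rho^\vee=\rho^T\circ S$. Put $\rho_h=\rho$ and $\rho_h^\vee=\rho_h^T\circ S_h$ on $U_h\mathfrak g$. Let $\mathcal A_\pm$ be the Weyl ($+$) or Clifford ($-$) algebra on $a^+_i,a^i$, with $a^ia^j=\pm a^ja^i$, $a^+_ia^+_j=\pm a^+_ja^+_i$, $a^ia^+_j=\delta^i_j\pm a^+_ja^i$. Let $\sigma:U\to\mathcal A_\pm$ be the algebra map with $\sigma(x)=\rho(x)^i_j\,a^+_ia^j$ for $x\in\mathfrak g$, and $x\triangleright b=\sigma(x_{(1)})\,b\,\sigma(Sx_{(2)})$ the action of $U$ on $\mathcal A_\pm[[h]]$. Let $u,\hat u,v,\hat v\in\mathcal A_\pm[[h]]$ be invariant under $\triangleright$ and $=1+O(h)$. Define the dressed generators $\mathsf a^+_i=v\,a^+_i\,\hat v$, $\mathsf a^i=u\,a^i\,\hat u$, and the deformed generators $$A^+_i=\mathsf a^+_l\,\sigma(\mathcal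 F^{-1(2)})\,\rho(\mathcal F^{-1(1)})^l_i,\qquad A^i=\mathsf a^l\,\sigma(\mathcal F^{-1(2)})\,\rho(\gamma^{-1}S\mathcal F^{-1(1)})^i_l.\tag{1}$$ Fix $k,m\ge0$ and $b=k+m$. With collective indices $J=(j_1,\dots,j_k)$, $I=(i_1,\dots,i_m)$, a tensor $d=(d^J_I)$ with entries in $\mathbb C[[h]]$ is isotropic if $(\rho^{\otimes k}\otimes\rho^{\vee\otimes m})(\Delta^{(b-1)}(x))\,d=\varepsilon(x)\,d$ for all $x\in U[[h]]$; a tensor $D$ is $U_h\mathfrak g$-isotropic if $(\rho_h^{\otimes k}\otimes\rho_h^{\vee\otimes m})(\Delta_h^{(b-1)}(y))\,D=\varepsilon_h(y)\,D$ for all $y\in U_h\mathfrak g$. Put $\mathcal F_{12\dots b}=\mathcal F_{(b-1)b}\,\mathcal F_{b-2,(b-1)b}\cdots\mathcal F_{1,2\dots b}$. **Statement.** (i) The assignment $$d\mapsto D=\Big[(\rho^{\otimes k}\otimes\rho^{\vee\otimes m})\big((1^{\otimes k}\otimes(\gamma'^{-1})^{\otimes m})\,\mathcal F_{12\dots b}\big)\Big]d\tag{2}$$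 is a bijection from the isotropic tensors onto the $U_h\mathfrak g$-isotropic tensors. (ii) If $d$ is isotropic and $D$ corresponds to $d$ by (2), then $I_h=A^+_{j_1}\cdots A^+_{j_k}\,D^{j_1\dots j_k}_{i_1\dots i_m}\,A^{i_1}\cdots A^{i_m}$ is given by $$I_h=(\mathsf a^+\cdots\mathsf a^+)_M\,(\mathsf a\cdots\mathsf a)^L\Big[(\rho^{\otimes k}\otimes\rho^{\vee\otimes m}\otimes\sigma)\big(\phi^{-1}_{(b-1)b(b+1)}\,\phi^{-1}_{(b-2),(b-1)b,(b+1)}\cdots\phi^{-1}_{1,2\dots b,(b+1)}\big)\Big]^{ML}_{JI}d^J_I,\tag{3}$$ where $\phi_{1,2\dots n,n+1}=(\mathrm{id}\otimes\Delta^{(n-2)}\otimes\mathrm{id})\phi$ and so on (the product is $1$ for $b\le1$). So for given $d$ and dressed generators the right-hand side depends on the twist only through the coassociator. (iii) If instead $A^+_i=\sigma(\mathcal F^{(1)})\,\mathsf a^+_i\,\sigma(S\mathcal F^{(2)}\gamma)$ and $A^i=\sigma(\gamma'S\mathcal F^{-1(2)})\,\mathsf a^i\,\sigma(\mathcal F^{-1(1)})$,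 then (3) holds with $\mathsf a^+_i$, $\mathsf a^i$ on its right-hand side replaced by $$\mathsf a^+_l\big[(\rho\otimes\sigma)(T^{-1}(1\otimes z))\big]^l_i,\qquad \big[(\rho\otimes\sigma)(T'^{-1})\big]^n_l\,\mathsf a^l\,\big[(\rho^\vee\otimes\sigma)(T''^{-1}(S(z)\otimes1))\big]^n_i,$$ which again involve the twist only through $\phi$. Here, with $\phi=\phi^{(1)}\otimes\phi^{(2)}\otimes\phi^{(3)}$ and $\psi=\phi^{-1}$: $T=\phi^{(1)}\otimes\phi^{(2)}S(\phi^{(3)})$, $z=S(\phi^{(1)})\phi^{(2)}S(\phi^{(3)})$, $T'=\psi^{(1)}\otimes S(\psi^{(3)})\psi^{(2)}$, $T''=\psi^{(2)}S(\psi^{(1)})\otimes\psi^{(3)}$. (For $\phi=1$ these replacements are trivial.) -/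

import Mathlib

open scoped PowerSeries

attribute [local instance 100] LieRing.ofAssociativeRing

noncomputable section

namespace TwistedHeisenberg

/-! ### Formal power series in `h`

`B[[h]]` is `B⟦X⟧`; the `h`-adically completed tensor powers of `B[[h]]` are `(B ⊗ ⋯ ⊗ B)⟦X⟧`. -/

section Series

variable {B C : Type*} [Ring B] [Algebra ℂ B] [Ring C] [Algebra ℂ C]

/-- The inclusion `B → B[[h]]` as a `ℂ`-linear map. -/
def hConst (B : Type*) [Ring B] [Algebra ℂ B] : B →ₗ[ℂ] B⟦X⟧ :=
  (PowerSeries.monomial (R := B) 0).restrictScalars ℂ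

/-- The coefficientwise extension `B[[h]] → C[[h]]` of a linear map `B → C`. -/
def hMap (f : B →ₗ[ℂ] C) : B⟦X⟧ →ₗ[ℂ] C⟦X⟧ where
  toFun p := PowerSeries.mk fun n => f (PowerSeries.coeff n p)
  map_add' p q := by ext n; simp
  map_smul' c p := by ext n; simp

/-- The `ℂ[[h]]`-linear, `h`-adically continuous extension `B[[h]] → C[[h]]` of a linear map
`f : B → C[[h]]`, i.e. `∑ hⁿ bₙ ↦ ∑ hⁿ f(bₙ)`. -/
def hLift (f : B →ₗ[ℂ] C⟦X⟧) : B⟦X⟧ →ₗ[ℂ] C⟦X⟧ where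
  toFun p := PowerSeries.mk fun n =>
    ∑ ij ∈ Finset.HasAntidiagonal.antidiagonal n, PowerSeries.coeff ij.2 (f (PowerSeries.coeff ij.1 p))
  map_add' p q := by ext n; simp [Finset.sum_add_distrib]
  map_smul' c p := by ext n; simp [Finset.smul_sum]

/-- A scalar of `ℂ[[h]]` as a (central) element of `B[[h]]`. -/
def hScalar (B : Type*) [Ring B] [Algebra ℂ B] (c : ℂ⟦X⟧) : B⟦X⟧ :=
  PowerSeries.map (algebraMap ℂ B) c

end Series

/-! ### The Hopf algebra `U𝔤` and its tensor powers -/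

section Hopf

variable (𝔤 : Type*) [LieRing 𝔤] [LieAlgebra ℂ 𝔤]

/-- The universal enveloping algebra `U𝔤`. -/
abbrev U := UniversalEnvelopingAlgebra ℂ 𝔤

/-- The tensor power `U𝔤^{⊗ n}` (an algebra with the factorwise product). -/
abbrev UT (n : ℕ) := PiTensorProduct ℂ (fun _ : Fin n => U 𝔤)

/-- The counit `ε` of `U𝔤`. -/
def counit : U 𝔤 →ₐ[ℂ] ℂ := UniversalEnvelopingAlgebra.lift ℂ (0 : 𝔤 →ₗ⁅ℂ⁆ ℂ)

/-- The antipode `S` of `U𝔤` as an algebra map to the opposite algebra, `x ↦ -x` on `𝔤`. -/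
def antipodeOp : U 𝔤 →ₐ[ℂ] (U 𝔤)ᵐᵒᵖ :=
  UniversalEnvelopingAlgebra.lift ℂ
    { toFun := fun x => MulOpposite.op (-(UniversalEnvelopingAlgebra.ι ℂ x))
      map_add' := fun x y => by
        rw [← MulOpposite.op_add]; congr 1; rw [map_add]; abel
      map_smul' := fun c x => by
        simp
      map_lie' := fun {x y} => by
        simp only [LieHom.map_lie, LieRing.of_associative_ring_bracket, ← MulOpposite.op_mul,
          ← MulOpposite.op_sub]
        congr 1
        noncomm_ring }

/-- The antipode `S : U𝔤 → U𝔤` as a linear map. -/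
def antipode : U 𝔤 →ₗ[ℂ] U 𝔤 :=
  (MulOpposite.opLinearEquiv ℂ).symm.toLinearMap ∘ₗ (antipodeOp 𝔤).toLinearMap

variable {𝔤}

/-- The embedding `x ↦ 1 ⊗ ⋯ ⊗ x ⊗ ⋯ ⊗ 1` of `U𝔤` as the `i`-th tensor factor of `U𝔤^{⊗ n}`. -/
def leg {n : ℕ} (i : Fin n) : U 𝔤 →ₐ[ℂ] UT 𝔤 n :=
  PiTensorProduct.singleAlgHom (R := ℂ) (A := fun _ : Fin n => U 𝔤) i

theorem leg_commute {n : ℕ} {i j : Fin n} (hij : i ≠ j) (x y : U 𝔤) :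
    Commute (leg i x) (leg j y) := by
  unfold leg PiTensorProduct.singleAlgHom
  refine Commute.tprod ?_
  refine Pi.commute_iff.2 fun k => ?_
  change Commute (Pi.mulSingle (M := fun _ => U 𝔤) i x k) (Pi.mulSingle (M := fun _ => U 𝔤) j y k)
  by_cases hk : k = i
  · subst hk
    rw [Pi.mulSingle_eq_of_ne hij]
    exact Commute.one_right _
  · rw [Pi.mulSingle_eq_of_ne hk]
    exact Commute.one_left _

/-- The iterated coproduct of `U𝔤` with values in the tensor factors that belong to the set
`s`; it is the algebra map with `x ↦ ∑_{i ∈ s} x⁽ⁱ⁾` for `x ∈ 𝔤`. So `copOn {i}` is the embedding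
of the `i`-th factor, `copOn {i, j}` is the coproduct put into the factors `i` and `j`,
`copOn Finset.univ : U𝔤 → U𝔤^{⊗ n}` is `Δ^{(n-1)}`, and `copOn ∅` is the counit. -/
def copOn {n : ℕ} (s : Finset (Fin n)) : U 𝔤 →ₐ[ℂ] UT 𝔤 n :=
  UniversalEnvelopingAlgebra.lift ℂ
    { toFun := fun x => ∑ i ∈ s, leg i (UniversalEnvelopingAlgebra.ι ℂ x)
      map_add' := fun x y => by simp [Finset.sum_add_distrib]
      map_smul' := fun c x => by simp [Finset.smul_sum]
      map_lie' := fun {x y} => by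
        simp only [LieHom.map_lie, LieRing.of_associative_ring_bracket, map_sub, map_mul]
        rw [Finset.sum_mul_sum, Finset.sum_mul_sum]
        have key : ∀ a b : U 𝔤, ∑ i ∈ s, ∑ j ∈ s, (leg i a : UT 𝔤 n) * leg j b
            = ∑ i ∈ s, ((leg i a * leg i b) +
                ∑ j ∈ s.erase i, (leg i a : UT 𝔤 n) * leg j b) := by
          intro a b
          refine Finset.sum_congr rfl fun i hi => ?_
          rw [Finset.add_sum_erase s (fun j => (leg i a : UT 𝔤 n) * leg j b) hi]
        have h2 : ∀ a b : U 𝔤, ∑ i ∈ s, ∑ j ∈ s.erase i, (leg i a : UT 𝔤 n) * leg j b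
            = ∑ i ∈ s, ∑ j ∈ s.erase i, (leg i b : UT 𝔤 n) * leg j a := by
          intro a b
          rw [Finset.sum_comm' (t' := s) (s' := fun j => s.erase j)]
          · refine Finset.sum_congr rfl fun i _ => Finset.sum_congr rfl fun j hj => ?_
            exact leg_commute (Finset.ne_of_mem_erase hj) a b
          · intro i j
            simp only [Finset.mem_erase]
            tauto
        rw [key, key, Finset.sum_add_distrib, Finset.sum_add_distrib, h2]
        simp [Finset.sum_sub_distrib] }

/-- For linear maps `f₀, …, f_{n-1} : U𝔤 → B`, the linear map `U𝔤^{⊗ n} → B`,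
`x₀ ⊗ ⋯ ⊗ x_{n-1} ↦ f₀(x₀) ⋯ f_{n-1}(x_{n-1})` (product in this order). -/
def evalLegs {n : ℕ} {B : Type*} [Ring B] [Algebra ℂ B] (f : Fin n → (U 𝔤 →ₗ[ℂ] B)) :
    UT 𝔤 n →ₗ[ℂ] B :=
  PiTensorProduct.lift ((MultilinearMap.mkPiAlgebraFin ℂ n B).compLinearMap f)

/-- Leg notation: for `X ∈ U𝔤[[h]]^{⊗ m}` and disjoint sets `p 0, …, p (m-1)` of factors, `X`
with its `j`-th factor spread by the iterated coproduct over the factors in `p j`. For instance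
`X_{12,3} = legs ![{0, 1}, {2}] X`, `X_{23} = legs ![{1}, {2}] X`, `X_{21} = legs ![{1}, {0}] X`. -/
def legs {m n : ℕ} (p : Fin m → Finset (Fin n)) : (UT 𝔤 m)⟦X⟧ →ₗ[ℂ] (UT 𝔤 n)⟦X⟧ :=
  hMap (evalLegs fun j => (copOn (p j)).toLinearMap)

/-- The `i`-th factor embedding on `U𝔤[[h]]`. -/
def hLeg {n : ℕ} (i : Fin n) : (U 𝔤)⟦X⟧ →ₗ[ℂ] (UT 𝔤 n)⟦X⟧ := hMap (leg i).toLinearMap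

/-- The antipode on `U𝔤[[h]]`. -/
def hAntipode : (U 𝔤)⟦X⟧ →ₗ[ℂ] (U 𝔤)⟦X⟧ := hMap (antipode 𝔤)

/-! ### Twists, the twisted Hopf algebra and the coassociator -/

/-- The twisted coproduct `Δ_h(x) = 𝓕 Δ(x) 𝓕⁻¹` on `U𝔤[[h]]`. -/
def twCop (F : ((UT 𝔤 2)⟦X⟧)ˣ) (x : (U 𝔤)⟦X⟧) : (UT 𝔤 2)⟦X⟧ :=
  (F : (UT 𝔤 2)⟦X⟧) * hMap (copOn Finset.univ).toLinearMap x * (↑F⁻¹ : (UT 𝔤 2)⟦X⟧)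

/-- `𝓕` is a twist: `(ε ⊗ id)𝓕 = 1 = (id ⊗ ε)𝓕`, `𝓕 = 1 ⊗ 1 + O(h)`, and the twisted coproduct
is coassociative, so that `U_h𝔤 = (U𝔤[[h]], Δ_h, ε, S_h)` is a Hopf algebra. -/
structure IsTwist (F : ((UT 𝔤 2)⟦X⟧)ˣ) : Prop where
  counit_left : legs ![∅, {0}] (F : (UT 𝔤 2)⟦X⟧) = (1 : (UT 𝔤 1)⟦X⟧)
  counit_right : legs ![{0}, ∅] (F : (UT 𝔤 2)⟦X⟧) = (1 : (UT 𝔤 1)⟦X⟧)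
  const : PowerSeries.constantCoeff (F : (UT 𝔤 2)⟦X⟧) = 1
  /- `(Δ_h ⊗ id)(Δ_h x) = (id ⊗ Δ_h)(Δ_h x)` -/
  coassoc : ∀ x : (U 𝔤)⟦X⟧,
    legs ![{0}, {1}] (F : (UT 𝔤 2)⟦X⟧) * legs ![{0, 1}, {2}] (twCop F x)
        * legs ![{0}, {1}] (↑F⁻¹ : (UT 𝔤 2)⟦X⟧)
      = (legs ![{1}, {2}] (F : (UT 𝔤 2)⟦X⟧) * legs ![{0}, {1, 2}] (twCop F x)
        * legs ![{1}, {2}] (↑F⁻¹ : (UT 𝔤 2)⟦X⟧) : (UT 𝔤 3)⟦X⟧)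

/-- `γ = S𝓕^{-1(1)} · 𝓕^{-1(2)}`. -/
def gam (F : ((UT 𝔤 2)⟦X⟧)ˣ) : (U 𝔤)⟦X⟧ :=
  hMap (evalLegs ![antipode 𝔤, LinearMap.id]) (↑F⁻¹ : (UT 𝔤 2)⟦X⟧)

/-- `γ⁻¹`. -/
def gamInv (F : ((UT 𝔤 2)⟦X⟧)ˣ) : (U 𝔤)⟦X⟧ := Ring.inverse (gam F)

/-- `γ' = S(γ⁻¹)`. -/
def gam' (F : ((UT 𝔤 2)⟦X⟧)ˣ) : (U 𝔤)⟦X⟧ := hAntipode (gamInv F)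

/-- `γ'⁻¹ = Sγ`. -/
def gamInv' (F : ((UT 𝔤 2)⟦X⟧)ˣ) : (U 𝔤)⟦X⟧ := hAntipode (gam F)

/-- The twisted antipode `S_h(x) = γ⁻¹ S(x) γ`. -/
def twAntipode (F : ((UT 𝔤 2)⟦X⟧)ˣ) : U 𝔤 →ₗ[ℂ] (U 𝔤)⟦X⟧ :=
  LinearMap.mulRight ℂ (gam F) ∘ₗ LinearMap.mulLeft ℂ (gamInv F) ∘ₗ hConst (U 𝔤) ∘ₗ antipode 𝔤

/-- The iterated twisted coproduct `Δ_h^{(n-1)} : U_h𝔤 → U_h𝔤^{⊗ n}`, given by `ε` for `n = 0` and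
`Δ_h^{(n)} = (id ⊗ Δ_h^{(n-1)}) ∘ Δ_h`. -/
def twCopIter (F : ((UT 𝔤 2)⟦X⟧)ˣ) : (n : ℕ) → (U 𝔤 →ₗ[ℂ] (UT 𝔤 n)⟦X⟧)
  | 0 => hConst (UT 𝔤 0) ∘ₗ Algebra.linearMap ℂ (UT 𝔤 0) ∘ₗ (counit 𝔤).toLinearMap
  | n + 1 =>
    hLift (evalLegs ![hConst (UT 𝔤 (n + 1)) ∘ₗ (leg 0).toLinearMap,
        hMap (evalLegs fun j : Fin n => (leg j.succ).toLinearMap) ∘ₗ twCopIter F n])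
      ∘ₗ LinearMap.mulRight ℂ (↑F⁻¹ : (UT 𝔤 2)⟦X⟧)
      ∘ₗ LinearMap.mulLeft ℂ (F : (UT 𝔤 2)⟦X⟧)
      ∘ₗ hConst (UT 𝔤 2) ∘ₗ (copOn Finset.univ).toLinearMap

/-- The coassociator
`φ = (Δ ⊗ id)(𝓕⁻¹) (𝓕⁻¹ ⊗ 1) (1 ⊗ 𝓕) (id ⊗ Δ)(𝓕) = 𝓕_{12,3}⁻¹ 𝓕_{12}⁻¹ 𝓕_{23} 𝓕_{1,23}`. -/
def coassociator (F : ((UT 𝔤 2)⟦X⟧)ˣ) : (UT 𝔤 3)⟦X⟧ :=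
  legs ![{0, 1}, {2}] (↑F⁻¹ : (UT 𝔤 2)⟦X⟧) * legs ![{0}, {1}] (↑F⁻¹ : (UT 𝔤 2)⟦X⟧)
    * legs ![{1}, {2}] (F : (UT 𝔤 2)⟦X⟧) * legs ![{0}, {1, 2}] (F : (UT 𝔤 2)⟦X⟧)

/-- `𝓕_{12…b} = 𝓕_{(b-1)b} 𝓕_{b-2,(b-1)b} ⋯ 𝓕_{1,2…b}`. (The list starts with the factor
`𝓕_{b,∅}`, which is `(id ⊗ ε)𝓕 = 1` in the leg `b`.) -/
def twMulti (F : ((UT 𝔤 2)⟦X⟧)ˣ) (b : ℕ) : (UT 𝔤 b)⟦X⟧ :=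
  ((List.finRange b).reverse.map fun i =>
    legs ![{i}, Finset.Ioi i] (F : (UT 𝔤 2)⟦X⟧)).prod

/-- For `ψ ∈ U𝔤[[h]]^{⊗ 3}`, the product
`ψ_{(b-1)b(b+1)} ψ_{(b-2),(b-1)b,(b+1)} ⋯ ψ_{1,2…b,(b+1)} ∈ U𝔤[[h]]^{⊗ (b+1)}`. (The list starts
with the factor `ψ_{b,∅,b+1}`, which is `1` for `ψ = φ⁻¹`, as `(id ⊗ ε ⊗ id)φ = 1`.) -/
def coassocMulti (ψ : (UT 𝔤 3)⟦X⟧) (b : ℕ) : (UT 𝔤 (b + 1))⟦X⟧ :=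
  ((List.finRange b).reverse.map fun i =>
    legs ![{i.castSucc}, Finset.Ioo i.castSucc (Fin.last b), {Fin.last b}] ψ).prod

end Hopf

/-! ### The Heisenberg algebra -/

section Heisenberg

variable (ι : Type*) [DecidableEq ι]

/-- The defining relations; `s = 1` for the Weyl and `s = -1` for the Clifford algebra.
`Sum.inl i` stands for `a⁺_i` and `Sum.inr i` for `aⁱ`. -/
inductive HeisenbergRel (s : ℤˣ) :
    FreeAlgebra ℂ (ι ⊕ ι) → FreeAlgebra ℂ (ι ⊕ ι) → Prop
  | an_an (i j : ι) : HeisenbergRel s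
      (FreeAlgebra.ι ℂ (Sum.inr i) * FreeAlgebra.ι ℂ (Sum.inr j))
      (((s : ℤ) : ℂ) • (FreeAlgebra.ι ℂ (Sum.inr j) * FreeAlgebra.ι ℂ (Sum.inr i)))
  | cr_cr (i j : ι) : HeisenbergRel s
      (FreeAlgebra.ι ℂ (Sum.inl i) * FreeAlgebra.ι ℂ (Sum.inl j))
      (((s : ℤ) : ℂ) • (FreeAlgebra.ι ℂ (Sum.inl j) * FreeAlgebra.ι ℂ (Sum.inl i)))
  | an_cr (i j : ι) : HeisenbergRel s
      (FreeAlgebra.ι ℂ (Sum.inr i) * FreeAlgebra.ι ℂ (Sum.inl j))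
      ((if i = j then 1 else 0) +
        ((s : ℤ) : ℂ) • (FreeAlgebra.ι ℂ (Sum.inl j) * FreeAlgebra.ι ℂ (Sum.inr i)))

/-- The Weyl (`s = 1`) or Clifford (`s = -1`) algebra `𝓐_±`. -/
def Heis (s : ℤˣ) := RingQuot (HeisenbergRel ι s)

instance (s : ℤˣ) : Ring (Heis ι s) := inferInstanceAs (Ring (RingQuot (HeisenbergRel ι s)))

instance (s : ℤˣ) : Algebra ℂ (Heis ι s) :=
  inferInstanceAs (Algebra ℂ (RingQuot (HeisenbergRel ι s)))

/-- The quotient map from the free algebra. -/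
def heisMk (s : ℤˣ) : FreeAlgebra ℂ (ι ⊕ ι) →ₐ[ℂ] Heis ι s :=
  RingQuot.mkAlgHom ℂ (HeisenbergRel ι s)

variable {ι} in
theorem heisMk_rel {s : ℤˣ} {x y : FreeAlgebra ℂ (ι ⊕ ι)} (h : HeisenbergRel ι s x y) :
    heisMk ι s x = heisMk ι s y := RingQuot.mkAlgHom_rel ℂ h

variable {ι} {s : ℤˣ}

/-- The generator `a⁺_i`. -/
def cr (i : ι) : Heis ι s :=
  heisMk ι s (FreeAlgebra.ι ℂ (Sum.inl i))

/-- The generator `aⁱ`. -/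
def an (i : ι) : Heis ι s :=
  heisMk ι s (FreeAlgebra.ι ℂ (Sum.inr i))


theorem an_mul_cr (i j : ι) : (an i * cr j : Heis ι s)
    = (if i = j then 1 else 0) + ((s : ℤ) : ℂ) • (cr j * an i) := by
  have h := heisMk_rel (HeisenbergRel.an_cr (s := s) i j)
  rw [map_mul, map_add, map_smul, map_mul] at h
  refine h.trans ?_
  congr 1
  split_ifs <;> simp

theorem cr_mul_cr (i j : ι) :
    (cr i * cr j : Heis ι s) = ((s : ℤ) : ℂ) • (cr j * cr i) := by
  have h := heisMk_rel (HeisenbergRel.cr_cr (s := s) i j)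
  rwa [map_mul, map_smul, map_mul] at h

theorem an_mul_an (i j : ι) :
    (an i * an j : Heis ι s) = ((s : ℤ) : ℂ) • (an j * an i) := by
  have h := heisMk_rel (HeisenbergRel.an_an (s := s) i j)
  rwa [map_mul, map_smul, map_mul] at h

theorem sign_sq (s : ℤˣ) : ((s : ℤ) : ℂ) * ((s : ℤ) : ℂ) = 1 := by
  have : ((s : ℤ) * (s : ℤ)) = 1 := by
    rw [← Units.val_mul, Int.units_mul_self]; rfl
  exact_mod_cast congrArg (Int.cast : ℤ → ℂ) this

theorem pair_comm (i j k l : ι) : (cr i * an j * (cr k * an l) : Heis ι s)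
      - cr k * an l * (cr i * an j)
    = (if j = k then cr i * an l else 0) - (if l = i then cr k * an j else 0) := by
  have h1 : (cr i * an j * (cr k * an l) : Heis ι s)
      = (if j = k then cr i * an l else 0) + ((s : ℤ) : ℂ) • (cr i * cr k * an j * an l) := by
    rw [show (cr i * an j * (cr k * an l) : Heis ι s) = cr i * (an j * cr k) * an l by noncomm_ring,
      an_mul_cr]
    split_ifs <;> simp [mul_add, add_mul, mul_assoc]
  have h2 : (cr k * an l * (cr i * an j) : Heis ι s)
      = (if l = i then cr k * an j else 0) + ((s : ℤ) : ℂ) • (cr k * cr i * an l * an j) := by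
    rw [show (cr k * an l * (cr i * an j) : Heis ι s) = cr k * (an l * cr i) * an j by noncomm_ring,
      an_mul_cr]
    split_ifs <;> simp [mul_add, add_mul, mul_assoc]
  have h3 : (cr i * cr k * an j * an l : Heis ι s) = cr k * cr i * an l * an j := by
    rw [cr_mul_cr i k, mul_assoc, an_mul_an j l, smul_mul_smul_comm, sign_sq, one_smul]
    noncomm_ring
  rw [h1, h2, h3]
  abel

variable [Fintype ι]

/-- The Jordan–Schwinger element `∑ Mⁱ_j a⁺_i aʲ` of a matrix. -/
def jordan (M : Matrix ι ι ℂ) : Heis ι s := ∑ i, ∑ j, M i j • (cr i * an j)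

theorem jordan_mul (M N : Matrix ι ι ℂ) : (jordan M * jordan N : Heis ι s)
    = ∑ i, ∑ j, ∑ k, ∑ l, (M i j * N k l) • (cr i * an j * (cr k * an l)) := by
  simp only [jordan, Finset.sum_mul]
  simp only [Finset.mul_sum, smul_mul_smul_comm]

theorem jordan_lie (M N : Matrix ι ι ℂ) :
    (jordan (M * N - N * M) : Heis ι s) = jordan M * jordan N - jordan N * jordan M := by
  have h2 : (jordan N * jordan M : Heis ι s)
      = ∑ i, ∑ j, ∑ k, ∑ l, (M i j * N k l) • (cr k * an l * (cr i * an j)) := by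
    simp only [jordan, Finset.mul_sum]
    simp only [Finset.sum_mul, smul_mul_smul_comm, mul_comm]
  have h : (jordan M * jordan N - jordan N * jordan M : Heis ι s)
      = ∑ i, ∑ j, ∑ k, ∑ l, (M i j * N k l) •
        ((if j = k then cr i * an l else 0) - (if l = i then cr k * an j else 0)) := by
    rw [jordan_mul, h2]
    simp only [← pair_comm, smul_sub, Finset.sum_sub_distrib]
  rw [h]
  have e1 : (jordan (M * N - N * M) : Heis ι s)
      = ∑ i, ∑ l, ∑ j, (M i j * N j l) • (cr i * an l)
        - ∑ k, ∑ j, ∑ i, (N k i * M i j) • (cr k * an j) := by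
    simp only [jordan, Matrix.sub_apply, Matrix.mul_apply, sub_smul, Finset.sum_smul,
      Finset.sum_sub_distrib]
  rw [e1]
  simp only [smul_sub, Finset.sum_sub_distrib]
  congr 1
  · refine Finset.sum_congr rfl fun i _ => ?_
    rw [Finset.sum_comm]
    refine Finset.sum_congr rfl fun j _ => ?_
    rw [Finset.sum_comm]
    refine Finset.sum_congr rfl fun l _ => ?_
    simp
  · simp only [smul_ite, smul_zero, Finset.sum_ite_eq', Finset.mem_univ, if_true]
    rw [Finset.sum_comm' (t' := Finset.univ) (s' := fun _ => Finset.univ) (by simp)]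
    rw [Finset.sum_congr rfl fun j _ => Finset.sum_comm]
    rw [Finset.sum_comm]
    refine Finset.sum_congr rfl fun j _ => Finset.sum_congr rfl fun k _ =>
      Finset.sum_congr rfl fun l _ => ?_
    rw [mul_comm]

variable {𝔤 : Type*} [LieRing 𝔤] [LieAlgebra ℂ 𝔤] (ρ : 𝔤 →ₗ⁅ℂ⁆ Matrix ι ι ℂ)

/-- `σ : U𝔤 → 𝓐_±`, the algebra map with `σ(x) = ρ(x)ⁱ_j a⁺_i aʲ` for `x ∈ 𝔤`. -/
def sig (s : ℤˣ) : U 𝔤 →ₐ[ℂ] Heis ι s :=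
  UniversalEnvelopingAlgebra.lift ℂ
    { toFun := fun x => jordan (ρ x)
      map_add' := fun x y => by
        simp [jordan, add_smul, Finset.sum_add_distrib]
      map_smul' := fun c x => by
        simp [jordan, mul_smul, Finset.smul_sum]
      map_lie' := fun {x y} => by
        simp only [LieHom.map_lie, LieRing.of_associative_ring_bracket, jordan_lie] }

/-- The representation `ρ` of `U𝔤`. -/
def rep : U 𝔤 →ₗ[ℂ] Matrix ι ι ℂ := (UniversalEnvelopingAlgebra.lift ℂ ρ).toLinearMap

/-- The contragredient representation `ρ^∨ = ρᵀ ∘ S`. -/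
def repDual : U 𝔤 →ₗ[ℂ] Matrix ι ι ℂ :=
  (Matrix.transposeLinearEquiv ι ι ℂ ℂ).toLinearMap ∘ₗ rep ρ ∘ₗ antipode 𝔤

/-- `σ` on `U𝔤[[h]]`. -/
def hSig (s : ℤˣ) : (U 𝔤)⟦X⟧ →ₗ[ℂ] (Heis ι s)⟦X⟧ := hMap (sig ρ s).toLinearMap

/-- For `X = X⁽¹⁾ ⊗ X⁽²⁾ ∈ U𝔤[[h]]^{⊗ 2}` and `b ∈ 𝓐_±[[h]]`, the element
`σ(X⁽¹⁾) b σ(S X⁽²⁾)`. -/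
def sandwich (X : (UT 𝔤 2)⟦X⟧) (b : (Heis ι s)⟦X⟧) : (Heis ι s)⟦X⟧ :=
  hLift (evalLegs
    ![LinearMap.mulRight ℂ b ∘ₗ hConst (Heis ι s) ∘ₗ (sig ρ s).toLinearMap,
      hConst (Heis ι s) ∘ₗ (sig ρ s).toLinearMap ∘ₗ antipode 𝔤]) X

/-- The action `x ▷ b = σ(x₍₁₎) b σ(S x₍₂₎)` of `U𝔤` on `𝓐_±[[h]]`. -/
def act (x : U 𝔤) (b : (Heis ι s)⟦X⟧) : (Heis ι s)⟦X⟧ :=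
  sandwich ρ (hConst (UT 𝔤 2) (copOn Finset.univ x)) b

/-- `u ∈ 𝓐_±[[h]]` is `𝔤`-invariant, `x ▷ u = ε(x) u`, and `u = 1 + O(h)`. -/
structure IsInvariantUnit (u : (Heis ι s)⟦X⟧) : Prop where
  invariant : ∀ x : U 𝔤, act ρ x u = counit 𝔤 x • u
  const : PowerSeries.constantCoeff u = 1

/-- The dressed generators `𝖺⁺_i = v a⁺_i v̂`. -/
def dressCr (v v' : (Heis ι s)⟦X⟧) (i : ι) : (Heis ι s)⟦X⟧ := v * PowerSeries.C (cr i) * v'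

/-- The dressed generators `𝖺ⁱ = u aⁱ û`. -/
def dressAn (u u' : (Heis ι s)⟦X⟧) (i : ι) : (Heis ι s)⟦X⟧ := u * PowerSeries.C (an i) * u'

/-! ### Matrix elements -/

/-- `[(R_1 ⊗ ⋯ ⊗ R_n)(X)]^K_{K'}` for `X ∈ U𝔤^{⊗ n}` and matrix valued maps `R_i`. -/
def entry {n : ℕ} (R : Fin n → (U 𝔤 →ₗ[ℂ] Matrix ι ι ℂ)) (K K' : Fin n → ι) :
    UT 𝔤 n →ₗ[ℂ] ℂ :=
  evalLegs fun i => Matrix.entryLinearMap ℂ ℂ (K i) (K' i) ∘ₗ R i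

/-- `[(R_1 ⊗ ⋯ ⊗ R_n ⊗ σ)(X)]^K_{K'} ∈ 𝓐_±` for `X ∈ U𝔤^{⊗ (n+1)}`. -/
def entrySig (s : ℤˣ) {n : ℕ} (R : Fin n → (U 𝔤 →ₗ[ℂ] Matrix ι ι ℂ)) (K K' : Fin n → ι) :
    UT 𝔤 (n + 1) →ₗ[ℂ] Heis ι s :=
  evalLegs (Fin.snoc (α := fun _ => U 𝔤 →ₗ[ℂ] Heis ι s)
    (fun i => Algebra.linearMap ℂ (Heis ι s) ∘ₗ Matrix.entryLinearMap ℂ ℂ (K i) (K' i) ∘ₗ R i)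
    (sig ρ s).toLinearMap)

/-- `[(R ⊗ σ)(X)]^l_i ∈ 𝓐_±[[h]]` for `X ∈ U𝔤[[h]]^{⊗ 2}`. -/
def pairEntry (s : ℤˣ) (R : U 𝔤 →ₗ[ℂ] Matrix ι ι ℂ) (X : (UT 𝔤 2)⟦X⟧) (l i : ι) :
    (Heis ι s)⟦X⟧ :=
  hMap (entrySig ρ s ![R] ![l] ![i]) X

/-- The representations of the `k + h` factors: `ρ^{⊗ k} ⊗ ρ^∨^{⊗ h}`. -/
def mixedRep (k h : ℕ) : Fin (k + h) → (U 𝔤 →ₗ[ℂ] Matrix ι ι ℂ) :=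
  Fin.addCases (fun _ => rep ρ) (fun _ => repDual ρ)

/-! ### The deformed generators -/

/-- `A⁺_i = 𝖺⁺_l σ(𝓕^{-1(2)}) ρ(𝓕^{-1(1)})^l_i`. -/
def defCr (F : ((UT 𝔤 2)⟦X⟧)ˣ) (α : ι → (Heis ι s)⟦X⟧) (i : ι) : (Heis ι s)⟦X⟧ :=
  ∑ l, α l * pairEntry ρ s (rep ρ) (↑F⁻¹ : (UT 𝔤 2)⟦X⟧) l i

/-- `Aⁱ = 𝖺^l σ(𝓕^{-1(2)}) ρ(γ⁻¹ S𝓕^{-1(1)})ⁱ_l`. -/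
def defAn (F : ((UT 𝔤 2)⟦X⟧)ˣ) (α : ι → (Heis ι s)⟦X⟧) (i : ι) : (Heis ι s)⟦X⟧ :=
  ∑ l, α l * pairEntry ρ s (rep ρ)
    (hLeg 0 (gamInv F) *
      hMap (evalLegs ![(leg 0).toLinearMap ∘ₗ antipode 𝔤, (leg 1).toLinearMap])
        (↑F⁻¹ : (UT 𝔤 2)⟦X⟧)) i l

/-- `A⁺_i = σ(𝓕⁽¹⁾) 𝖺⁺_i σ(S𝓕⁽²⁾ γ)`. -/
def adjCr (F : ((UT 𝔤 2)⟦X⟧)ˣ) (α : ι → (Heis ι s)⟦X⟧) (i : ι) : (Heis ι s)⟦X⟧ :=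
  sandwich ρ (F : (UT 𝔤 2)⟦X⟧) (α i) * hSig ρ s (gam F)

/-- `Aⁱ = σ(γ' S𝓕^{-1(2)}) 𝖺ⁱ σ(𝓕^{-1(1)})`. -/
def adjAn (F : ((UT 𝔤 2)⟦X⟧)ˣ) (α : ι → (Heis ι s)⟦X⟧) (i : ι) : (Heis ι s)⟦X⟧ :=
  hSig ρ s (gam' F) *
    hLift (evalLegs
      ![LinearMap.mulRight ℂ (α i) ∘ₗ hConst (Heis ι s) ∘ₗ (sig ρ s).toLinearMap ∘ₗ antipode 𝔤,
        hConst (Heis ι s) ∘ₗ (sig ρ s).toLinearMap])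
      (legs ![{1}, {0}] (↑F⁻¹ : (UT 𝔤 2)⟦X⟧))

/-! ### Invariant tensors of the coassociator, and the corresponding redressing -/

/-- `z = S(φ⁽¹⁾) φ⁽²⁾ S(φ⁽³⁾)`. -/
def coassocZ (φ : (UT 𝔤 3)⟦X⟧) : (U 𝔤)⟦X⟧ :=
  hMap (evalLegs ![antipode 𝔤, LinearMap.id, antipode 𝔤]) φ

/-- `φ⁽¹⁾ ⊗ φ⁽²⁾ S(φ⁽³⁾)`. -/
def coassocA (φ : (UT 𝔤 3)⟦X⟧) : (UT 𝔤 2)⟦X⟧ :=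
  hMap (evalLegs ![(leg 0).toLinearMap, (leg 1).toLinearMap,
    (leg 1).toLinearMap ∘ₗ antipode 𝔤]) φ

/-- `ψ⁽¹⁾ ⊗ S(ψ⁽³⁾) ψ⁽²⁾`. -/
def coassocB (ψ : (UT 𝔤 3)⟦X⟧) : (UT 𝔤 2)⟦X⟧ :=
  hMap (evalLegs ![(leg 0).toLinearMap, (leg 1).toLinearMap ∘ₗ antipode 𝔤, (leg 1).toLinearMap])
    (legs ![{0}, {2}, {1}] ψ : (UT 𝔤 3)⟦X⟧)

/-- `ψ⁽²⁾ S(ψ⁽¹⁾) ⊗ ψ⁽³⁾`. -/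
def coassocC (ψ : (UT 𝔤 3)⟦X⟧) : (UT 𝔤 2)⟦X⟧ :=
  hMap (evalLegs ![(leg 0).toLinearMap, (leg 0).toLinearMap ∘ₗ antipode 𝔤, (leg 1).toLinearMap])
    (legs ![{1}, {0}, {2}] ψ : (UT 𝔤 3)⟦X⟧)

/-- `𝖺⁺_l [(ρ ⊗ σ)(T⁻¹ (1 ⊗ z))]^l_i` with `T = φ⁽¹⁾ ⊗ φ⁽²⁾ S(φ⁽³⁾)`. -/
def redressCr (φ : (UT 𝔤 3)⟦X⟧) (α : ι → (Heis ι s)⟦X⟧) (i : ι) : (Heis ι s)⟦X⟧ :=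
  ∑ l, α l * pairEntry ρ s (rep ρ) (Ring.inverse (coassocA φ) * hLeg 1 (coassocZ φ)) l i

/-- `[(ρ ⊗ σ)(T'⁻¹)]^m_l 𝖺^l [(ρ^∨ ⊗ σ)(T''⁻¹ (S(z) ⊗ 1))]^m_i` with, for `ψ = φ⁻¹`,
`T' = ψ⁽¹⁾ ⊗ S(ψ⁽³⁾) ψ⁽²⁾` and `T'' = ψ⁽²⁾ S(ψ⁽¹⁾) ⊗ ψ⁽³⁾`. -/
def redressAn (φ : (UT 𝔤 3)⟦X⟧) (α : ι → (Heis ι s)⟦X⟧) (i : ι) : (Heis ι s)⟦X⟧ :=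
  ∑ m, (∑ l, pairEntry ρ s (rep ρ) (Ring.inverse (coassocB (Ring.inverse φ))) m l * α l) *
    pairEntry ρ s (repDual ρ)
      (Ring.inverse (coassocC (Ring.inverse φ)) * hLeg 0 (hAntipode (coassocZ φ))) m i

/-! ### Isotropic tensors and invariants

A tensor `d^{j_1…j_k}_{i_1…i_h}` is a function of the collective index
`K = (j_1, …, j_k, i_1, …, i_h)`. -/

/-- `d` is a classical isotropic tensor:
`[(ρ^{⊗ k} ⊗ ρ^∨^{⊗ h})(Δ^{(k+h-1)}(x))] d = ε(x) d` for all `x ∈ U𝔤[[h]]`. -/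
def IsIsotropic (k h : ℕ) (d : (Fin (k + h) → ι) → ℂ⟦X⟧) : Prop :=
  ∀ (x : (U 𝔤)⟦X⟧) (K : Fin (k + h) → ι),
    ∑ K', hMap (entry (mixedRep ρ k h) K K')
        (hMap (copOn (Finset.univ : Finset (Fin (k + h)))).toLinearMap x) * d K'
      = hMap (counit 𝔤).toLinearMap x * d K

/-- Matrix elements of `ρ_h^{⊗ k} ⊗ ρ_h^∨^{⊗ h}` on `U_h𝔤^{⊗ (k+h)}`, where `ρ_h = ρ` on
`U_h𝔤 = U𝔤[[h]]` and `ρ_h^∨ = ρ_hᵀ ∘ S_h`. -/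
def twEntry (F : ((UT 𝔤 2)⟦X⟧)ˣ) (k h : ℕ) (K K' : Fin (k + h) → ι) :
    (UT 𝔤 (k + h))⟦X⟧ →ₗ[ℂ] ℂ⟦X⟧ :=
  hLift (evalLegs (Fin.addCases
    (fun j : Fin k => hConst ℂ ∘ₗ
      Matrix.entryLinearMap ℂ ℂ (K (Fin.castAdd h j)) (K' (Fin.castAdd h j)) ∘ₗ rep ρ)
    (fun j : Fin h => hMap
      (Matrix.entryLinearMap ℂ ℂ (K' (Fin.natAdd k j)) (K (Fin.natAdd k j)) ∘ₗ rep ρ)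
        ∘ₗ twAntipode F)))

/-- `D` is a `U_h𝔤`-isotropic tensor:
`[(ρ_h^{⊗ k} ⊗ ρ_h^∨^{⊗ h})(Δ_h^{(k+h-1)}(y))] D = ε_h(y) D` for all `y ∈ U_h𝔤`. -/
def IsTwIsotropic (F : ((UT 𝔤 2)⟦X⟧)ˣ) (k h : ℕ) (D : (Fin (k + h) → ι) → ℂ⟦X⟧) : Prop :=
  ∀ (y : (U 𝔤)⟦X⟧) (K : Fin (k + h) → ι),
    ∑ K', twEntry ρ F k h K K' (hLift (twCopIter F (k + h)) y) * D K'
      = hMap (counit 𝔤).toLinearMap y * D K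

/-- The `U_h𝔤`-isotropic tensor that corresponds to `d`:
`D = [(ρ^{⊗ k} ⊗ ρ^∨^{⊗ h})((1^{⊗ k} ⊗ (γ'⁻¹)^{⊗ h}) 𝓕_{12…(k+h)})] d`. -/
def twTensor (F : ((UT 𝔤 2)⟦X⟧)ˣ) (k h : ℕ) (d : (Fin (k + h) → ι) → ℂ⟦X⟧)
    (K : Fin (k + h) → ι) : ℂ⟦X⟧ :=
  ∑ K', hMap (entry (mixedRep ρ k h) K K')
    ((List.ofFn fun j : Fin h => hLeg (Fin.natAdd k j) (gamInv' F)).prod * twMulti F (k + h))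
      * d K'

/-- The normal ordered monomial `(b⁺_{j_1} ⋯ b⁺_{j_k}) c (b^{i_1} ⋯ b^{i_h})`. -/
def normalMonomial (k h : ℕ) (bp b : ι → (Heis ι s)⟦X⟧) (K : Fin (k + h) → ι)
    (c : (Heis ι s)⟦X⟧) : (Heis ι s)⟦X⟧ :=
  (List.ofFn fun j : Fin k => bp (K (Fin.castAdd h j))).prod * c *
    (List.ofFn fun j : Fin h => b (K (Fin.natAdd k j))).prod

/-- The invariant `I_h = A⁺_{j_1} ⋯ A⁺_{j_k} D^{j_1…j_k}_{i_1…i_h} A^{i_1} ⋯ A^{i_h}`. -/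
def defInvariant (k h : ℕ) (Ap A : ι → (Heis ι s)⟦X⟧) (D : (Fin (k + h) → ι) → ℂ⟦X⟧) :
    (Heis ι s)⟦X⟧ :=
  ∑ K, normalMonomial k h Ap A K (hScalar (Heis ι s) (D K))

/-- `(𝖺⁺⋯𝖺⁺)_M (𝖺⋯𝖺)^L [(ρ^{⊗ k} ⊗ ρ^∨^{⊗ h} ⊗ σ)(ψ_{(b-1)b(b+1)} ⋯ ψ_{1,2…b,(b+1)})]^{ML}_{JI} d^J_I`,
where `b = k + h`. -/
def dressedContraction (k h : ℕ) (ap a : ι → (Heis ι s)⟦X⟧) (ψ : (UT 𝔤 3)⟦X⟧)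
    (d : (Fin (k + h) → ι) → ℂ⟦X⟧) : (Heis ι s)⟦X⟧ :=
  ∑ K, ∑ K', normalMonomial k h ap a K 1 *
    hMap (entrySig ρ s (mixedRep ρ k h) K K') (coassocMulti ψ (k + h)) *
      hScalar (Heis ι s) (d K')

end Heisenberg

end TwistedHeisenberg

end

/-!
The theorem rests on one mechanism: covariance lets elements of `U𝔤^{⊗ 2}[[h]]` be moved past
words in `𝖺⁺`, `𝖺`, and moving them spreads their second factor by the coproduct.

A tuple `α` in `𝓐_±[[h]]` is *covariant* in a representation `R` if
`σ(x) α_i = α_j [(R ⊗ σ)(Δ x)]^j_i` (`IsCovariant`). The dressed creators are covariant in `ρ`, the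
dressed annihilators in `ρ^∨` (`dressCr_covariant`, `dressAn_covariant`), because `σ(x)` acts by
commutators on the generators and the dressing factors are invariant. A word in the deformed
generators, which have the form `A_i = α_l [(R ⊗ σ)(𝓕⁻¹ (m ⊗ 1))]^l_i`, then equals the word in the
`α`'s times a matrix element of a single element of `U𝔤^{⊗ (b+1)}[[h]]` (`letterProd_deformed`).
That element inverts `𝓕_{12…(b+1)}` up to the factors `m` (`twistCollect_spec`).

Correspondence of isotropic tensors: `Δ_h^{(b-1)}` is conjugate to `Δ^{(b-1)}` by `𝓕_{12…b}`
(`twCopIter_eq`), and `ρ_h^∨` is conjugate to `ρ^∨` by `γ'`. So `d ↦ D` is the action of an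
invertible element that intertwines the two actions (`bijOn_twTensor`).

Invariants: in `A⁺⋯A⁺ D A⋯A` the factors `γ'` cancel, and what is left acting on `d` is
`𝓕_{12…(b+1)}⁻¹ 𝓕_{12…b}`. As `d` is invariant and `(ε ⊗ id)𝓕 = 1`, a factor `𝓕_{1…b,b+1}` can be
inserted on the right, and `𝓕_{12…b} 𝓕_{1…b,b+1}` equals `𝓕_{12…(b+1)}` times the product of inverse
coassociators (`extend_twMulti_mul`). The proof of the latter uses that `φ` commutes with
`Δ^{(2)}(U𝔤)`, which is the coassociativity of `Δ_h` (`coassocUnit_commute`). The result,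
`defInvariant_eq`, holds for arbitrary covariant tuples.

Adjoint form of the generators: moving `σ(𝓕⁽¹⁾)` past `𝖺⁺_i` turns `σ(𝓕⁽¹⁾) 𝖺⁺_i σ(S𝓕⁽²⁾ γ)` into
`𝖺⁺_l [(ρ ⊗ σ)(𝓕⁽¹⁾₍₁₎ ⊗ 𝓕⁽¹⁾₍₂₎ S(𝓕⁽²⁾) γ)]^l_i`, and the contraction `φ⁽¹⁾ ⊗ φ⁽²⁾ S(φ⁽³⁾)` of
`𝓕_{12,3} φ = 𝓕_{12}⁻¹ 𝓕_{23} 𝓕_{1,23}` identifies the element in the bracket as `T⁻¹ (1 ⊗ z) 𝓕⁻¹`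
(`contractA_eq`). Here `z = γ 𝓕⁽¹⁾ S(𝓕⁽²⁾)` is central (`coassocZ_coassociator`,
`commute_coassocZ`). The annihilators are similar, with two contractions of `φ⁻¹` (`contractB_eq`,
`contractC_eq`). So the adjoint form of the generators is the original form built on redressed
tuples (`IsCovariant.adjCr_eq`, `IsCovariant.adjAn_eq`). These tuples are again covariant, as `T`,
`T'`, `T''` and `z` are invariant, and `defInvariant_eq` applies to them.

All identities between `h`-adic series are reduced to pure tensors: a map of series that is additive,
homogeneous and commutes with `h` is determined by its values on constant pure tensors
(`IsHLin.ext_tprod`).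
-/

noncomputable section

namespace TwistedHeisenberg

/-! ### Series in `h` and `h`-linear maps -/

section Series

variable {B C D : Type*} [Ring B] [Algebra ℂ B] [Ring C] [Algebra ℂ C] [Ring D] [Algebra ℂ D]

@[simp] theorem coeff_hMap (f : B →ₗ[ℂ] C) (p : B⟦X⟧) (n : ℕ) :
    PowerSeries.coeff n (hMap f p) = f (PowerSeries.coeff n p) := by
  simp [hMap]

theorem coeff_hLift (f : B →ₗ[ℂ] C⟦X⟧) (p : B⟦X⟧) (n : ℕ) :
    PowerSeries.coeff n (hLift f p) = ∑ ij ∈ Finset.HasAntidiagonal.antidiagonal n,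
      PowerSeries.coeff ij.2 (f (PowerSeries.coeff ij.1 p)) := by
  simp [hLift]

@[simp] theorem hConst_apply (b : B) : hConst B b = PowerSeries.C b := by
  simp [hConst]

@[simp] theorem hMap_C (f : B →ₗ[ℂ] C) (b : B) : hMap f (PowerSeries.C b) = PowerSeries.C (f b) := by
  ext n
  rw [coeff_hMap, PowerSeries.coeff_C, PowerSeries.coeff_C]
  split_ifs <;> simp

@[simp] theorem hLift_C (f : B →ₗ[ℂ] C⟦X⟧) (b : B) : hLift f (PowerSeries.C b) = f b := by
  ext n
  rw [coeff_hLift, Finset.sum_eq_single (0, n)]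
  · simp
  · rintro ⟨i, j⟩ hij hne
    have : i ≠ 0 := by
      rintro rfl
      apply hne
      simpa using hij
    simp [PowerSeries.coeff_C, this]
  · simp

theorem hMap_algHom (f : B →ₐ[ℂ] C) (p : B⟦X⟧) :
    hMap f.toLinearMap p = PowerSeries.map (f : B →+* C) p := by
  ext n; simp

theorem hMap_algHom_mul (f : B →ₐ[ℂ] C) (p q : B⟦X⟧) :
    hMap f.toLinearMap (p * q) = hMap f.toLinearMap p * hMap f.toLinearMap q := by
  simp [hMap_algHom]

@[simp] theorem hMap_one_algHom (f : B →ₐ[ℂ] C) : hMap f.toLinearMap (1 : B⟦X⟧) = 1 := by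
  simp [hMap_algHom]

theorem constantCoeff_hMap (f : B →ₗ[ℂ] C) (p : B⟦X⟧) :
    PowerSeries.constantCoeff (hMap f p) = f (PowerSeries.constantCoeff p) := by
  rw [← PowerSeries.coeff_zero_eq_constantCoeff_apply, coeff_hMap,
    PowerSeries.coeff_zero_eq_constantCoeff_apply]

theorem hMap_hMap (g : C →ₗ[ℂ] D) (f : B →ₗ[ℂ] C) (p : B⟦X⟧) :
    hMap g (hMap f p) = hMap (g ∘ₗ f) p := by
  ext n; simp

theorem C_smul (c : ℂ) (b : B) :
    PowerSeries.C (c • b) = c • (PowerSeries.C b : B⟦X⟧) := by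
  ext n; simp [PowerSeries.coeff_C]

omit [Algebra ℂ B] in
/-- A series with constant term `1` is invertible. -/
theorem isUnit_of_constantCoeff_eq_one {p : B⟦X⟧} (hp : PowerSeries.constantCoeff p = 1) :
    IsUnit p :=
  ⟨⟨p, PowerSeries.invOfUnit p 1, PowerSeries.mul_invOfUnit p 1 (by simpa using hp),
    PowerSeries.invOfUnit_mul p 1 (by simpa using hp)⟩, rfl⟩

/-- A map `B[[h]] → C[[h]]` that is additive, `ℂ`-homogeneous and commutes with multiplication by
`h`. Such a map is `h`-adically continuous, so it is determined by its values on constant series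
(`IsHLin.ext`). -/
@[fun_prop]
structure IsHLin (f : B⟦X⟧ → C⟦X⟧) : Prop where
  add : ∀ p q, f (p + q) = f p + f q
  smul : ∀ (c : ℂ) p, f (c • p) = c • f p
  X_mul : ∀ p, f (PowerSeries.X * p) = PowerSeries.X * f p

namespace IsHLin

@[fun_prop] theorem id : IsHLin fun p : B⟦X⟧ => p := ⟨fun _ _ => rfl, fun _ _ => rfl, fun _ => rfl⟩

@[fun_prop] theorem comp {g : C⟦X⟧ → D⟦X⟧} {f : B⟦X⟧ → C⟦X⟧} (hg : IsHLin g) (hf : IsHLin f) :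
    IsHLin fun p => g (f p) :=
  ⟨fun p q => by rw [hf.add, hg.add], fun c p => by rw [hf.smul, hg.smul],
    fun p => by rw [hf.X_mul, hg.X_mul]⟩

@[fun_prop] theorem const_mul (a : C⟦X⟧) {f : B⟦X⟧ → C⟦X⟧} (hf : IsHLin f) :
    IsHLin fun p => a * f p :=
  ⟨fun p q => by rw [hf.add, mul_add], fun c p => by rw [hf.smul, mul_smul_comm],
    fun p => by rw [hf.X_mul, ← mul_assoc, (PowerSeries.commute_X a).eq, mul_assoc]⟩

@[fun_prop] theorem mul_const (a : C⟦X⟧) {f : B⟦X⟧ → C⟦X⟧} (hf : IsHLin f) :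
    IsHLin fun p => f p * a :=
  ⟨fun p q => by rw [hf.add, add_mul], fun c p => by rw [hf.smul, smul_mul_assoc],
    fun p => by rw [hf.X_mul, mul_assoc]⟩

@[fun_prop] theorem sum {κ : Type*} (s : Finset κ) {f : κ → B⟦X⟧ → C⟦X⟧} (hf : ∀ i, IsHLin (f i)) :
    IsHLin fun p => ∑ i ∈ s, f i p :=
  ⟨fun p q => by simp only [(hf _).add, Finset.sum_add_distrib],
    fun c p => by simp only [(hf _).smul, Finset.smul_sum],
    fun p => by simp only [(hf _).X_mul, Finset.mul_sum]⟩

@[fun_prop] theorem hMap_comp (f : C →ₗ[ℂ] D) {g : B⟦X⟧ → C⟦X⟧} (hg : IsHLin g) :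
    IsHLin fun p => hMap f (g p) := by
  refine IsHLin.comp (g := hMap f) ⟨map_add _, map_smul _, fun p => ?_⟩ hg
  ext n
  cases n <;> simp [PowerSeries.coeff_succ_X_mul]

@[fun_prop] theorem hLift_comp (f : C →ₗ[ℂ] D⟦X⟧) {g : B⟦X⟧ → C⟦X⟧} (hg : IsHLin g) :
    IsHLin fun p => hLift f (g p) := by
  refine IsHLin.comp (g := hLift f) ⟨map_add _, map_smul _, fun p => ?_⟩ hg
  ext n
  cases n with
  | zero => simp [coeff_hLift]
  | succ n =>
    rw [coeff_hLift, Finset.Nat.antidiagonal_succ]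
    simp [PowerSeries.coeff_succ_X_mul, coeff_hLift]

theorem ext {f g : B⟦X⟧ → C⟦X⟧} (hf : IsHLin f) (hg : IsHLin g)
    (h : ∀ b, f (PowerSeries.C b) = g (PowerSeries.C b)) (p : B⟦X⟧) : f p = g p := by
  ext n
  induction n generalizing p with
  | zero =>
    rw [PowerSeries.eq_X_mul_shift_add_const p, hf.add, hg.add, h, hf.X_mul, hg.X_mul]
    simp
  | succ n ih =>
    rw [PowerSeries.eq_X_mul_shift_add_const p, hf.add, hg.add, h, hf.X_mul, hg.X_mul]
    simp [PowerSeries.coeff_succ_X_mul, ih]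

end IsHLin

end Series

/-! ### The Hopf algebra structure of `U𝔤` and leg maps -/

section Hopf

variable {𝔤 : Type*} [LieRing 𝔤] [LieAlgebra ℂ 𝔤] {B C : Type*} [Ring B] [Algebra ℂ B]
  [Ring C] [Algebra ℂ C]

/-- A subalgebra of `U𝔤` that contains `𝔤` is everything. Most identities below are linear and
multiplicative in an element of `U𝔤`, and are checked on generators by means of this principle. -/
theorem U_induction {P : U 𝔤 → Prop} (hι : ∀ x : 𝔤, P (UniversalEnvelopingAlgebra.ι ℂ x))
    (hC : ∀ c : ℂ, P (algebraMap ℂ (U 𝔤) c)) (hadd : ∀ x y, P x → P y → P (x + y))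
    (hmul : ∀ x y, P x → P y → P (x * y)) (x : U 𝔤) : P x := by
  let S : Subalgebra ℂ (U 𝔤) :=
    { carrier := {x | P x}, mul_mem' := fun {a b} => hmul a b, add_mem' := fun {a b} => hadd a b,
      algebraMap_mem' := hC }
  let f : 𝔤 →ₗ⁅ℂ⁆ S :=
    { toFun := fun x => ⟨UniversalEnvelopingAlgebra.ι ℂ x, hι x⟩
      map_add' := fun x y => by ext; simp
      map_smul' := fun c x => by ext; simp
      map_lie' := fun {x y} => by
        ext; simp [LieRing.of_associative_ring_bracket] }
  have h : S.val.comp (UniversalEnvelopingAlgebra.lift ℂ f) = AlgHom.id ℂ (U 𝔤) := by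
    ext x
    simp [f]
  have h2 := DFunLike.congr_fun h x
  simp only [AlgHom.comp_apply, AlgHom.id_apply] at h2
  rw [← h2]
  exact (UniversalEnvelopingAlgebra.lift ℂ f x).2

@[simp] theorem counit_ι (x : 𝔤) : counit 𝔤 (UniversalEnvelopingAlgebra.ι ℂ x) = 0 := by
  simp [counit]

@[simp] theorem copOn_ι {n : ℕ} (s : Finset (Fin n)) (x : 𝔤) :
    copOn s (UniversalEnvelopingAlgebra.ι ℂ x) =
      ∑ i ∈ s, leg i (UniversalEnvelopingAlgebra.ι ℂ x) := by
  simp [copOn]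

theorem antipode_eq (x : U 𝔤) : antipode 𝔤 x = MulOpposite.unop (antipodeOp 𝔤 x) := rfl

@[simp] theorem antipode_ι (x : 𝔤) : antipode 𝔤 (UniversalEnvelopingAlgebra.ι ℂ x) =
    -(UniversalEnvelopingAlgebra.ι ℂ x) := by
  simp [antipode_eq, antipodeOp]

@[simp] theorem antipode_one : antipode 𝔤 1 = 1 := by simp [antipode_eq]

@[simp] theorem antipode_mul (x y : U 𝔤) :
    antipode 𝔤 (x * y) = antipode 𝔤 y * antipode 𝔤 x := by simp [antipode_eq]

@[simp] theorem antipode_algebraMap (c : ℂ) :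
    antipode 𝔤 (algebraMap ℂ (U 𝔤) c) = algebraMap ℂ (U 𝔤) c := by
  rw [Algebra.algebraMap_eq_smul_one, map_smul, antipode_one]

@[simp] theorem antipode_antipode (x : U 𝔤) : antipode 𝔤 (antipode 𝔤 x) = x := by
  induction x using U_induction with
  | hι x => rw [antipode_ι, map_neg, antipode_ι, neg_neg]
  | hC c => simp
  | hadd x y hx hy => simp [hx, hy]
  | hmul x y hx hy => simp [hx, hy]

theorem copOn_singleton {n : ℕ} (i : Fin n) (x : U 𝔤) : copOn {i} x = leg i x := by
  have : (copOn {i} : U 𝔤 →ₐ[ℂ] UT 𝔤 n) = leg i := by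
    ext x
    simp only [LieHom.comp_apply, AlgHom.coe_toLieHom, copOn_ι, Finset.sum_singleton]
  rw [this]

theorem copOn_empty {n : ℕ} (x : U 𝔤) :
    (copOn ∅ x : UT 𝔤 n) = algebraMap ℂ (UT 𝔤 n) (counit 𝔤 x) := by
  have : (copOn ∅ : U 𝔤 →ₐ[ℂ] UT 𝔤 n) = (Algebra.ofId ℂ (UT 𝔤 n)).comp (counit 𝔤) := by
    ext x
    simp only [LieHom.comp_apply, AlgHom.coe_toLieHom, copOn_ι, Finset.sum_empty,
      AlgHom.comp_apply, counit_ι, map_zero]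
  rw [this]; rfl

theorem leg_eq_tprod {n : ℕ} (i : Fin n) (x : U 𝔤) :
    leg i x = PiTensorProduct.tprod ℂ (Pi.mulSingle (M := fun _ => U 𝔤) i x) := rfl

@[simp] theorem evalLegs_tprod {n : ℕ} (f : Fin n → (U 𝔤 →ₗ[ℂ] B)) (x : Fin n → U 𝔤) :
    evalLegs f (PiTensorProduct.tprod ℂ x) = (List.ofFn fun i => f i (x i)).prod := by
  simp [evalLegs, MultilinearMap.mkPiAlgebraFin_apply]

theorem UT_linear_ext {M : Type*} [AddCommMonoid M] [Module ℂ M] {n : ℕ} {f g : UT 𝔤 n → M}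
    (hf : IsLinearMap ℂ f) (hg : IsLinearMap ℂ g)
    (h : ∀ x : Fin n → U 𝔤, f (PiTensorProduct.tprod ℂ x) = g (PiTensorProduct.tprod ℂ x))
    (a : UT 𝔤 n) : f a = g a := by
  induction a using PiTensorProduct.induction_on with
  | smul_tprod r x => rw [hf.map_smul, hg.map_smul, h]
  | add x y hx hy => rw [hf.map_add, hg.map_add, hx, hy]

/-- An `h`-linear map on `U𝔤^{⊗ n}[[h]]` is determined by its values on constant pure tensors. -/
theorem IsHLin.ext_tprod {n : ℕ} {f g : (UT 𝔤 n)⟦X⟧ → C⟦X⟧} (hf : IsHLin f) (hg : IsHLin g)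
    (h : ∀ x : Fin n → U 𝔤, f (PowerSeries.C (PiTensorProduct.tprod ℂ x)) =
      g (PowerSeries.C (PiTensorProduct.tprod ℂ x))) (p : (UT 𝔤 n)⟦X⟧) : f p = g p := by
  refine IsHLin.ext hf hg (fun a => ?_) p
  refine UT_linear_ext (f := fun a => f (PowerSeries.C a)) (g := fun a => g (PowerSeries.C a))
    ⟨?_, ?_⟩ ⟨?_, ?_⟩ h a
  · intro x y; rw [map_add, hf.add]
  · intro c x; rw [C_smul, hf.smul]
  · intro x y; rw [map_add, hg.add]
  · intro c x; rw [C_smul, hg.smul]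

/-- `∏ᵢ fᵢ gᵢ = (∏ᵢ fᵢ) (∏ᵢ gᵢ)` for ordered products, if factors with different indices commute. -/
theorem prod_ofFn_mul {M : Type*} [Monoid M] {n : ℕ} (f g : Fin n → M)
    (h : ∀ i j, i ≠ j → Commute (f i) (g j)) :
    (List.ofFn fun i => f i * g i).prod = (List.ofFn f).prod * (List.ofFn g).prod := by
  induction n with
  | zero => simp
  | succ n ih =>
    simp only [List.ofFn_succ, List.prod_cons]
    rw [ih (fun i => f i.succ) (fun i => g i.succ) fun i j hij =>
      h _ _ fun e => hij (Fin.succ_injective _ e)]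
    have : Commute (List.ofFn fun i : Fin n => f i.succ).prod (g 0) := by
      refine Commute.list_prod_left _ _ fun y hy => ?_
      obtain ⟨i, rfl⟩ := List.mem_ofFn.1 hy
      exact h _ _ (Fin.succ_ne_zero i)
    rw [mul_assoc (f 0), mul_assoc (f 0), ← mul_assoc (g 0), ← this.eq, mul_assoc]

/-- Algebra maps `U𝔤 → B` with commuting images combine to an algebra map `U𝔤^{⊗ n} → B`. -/
def evalHom {n : ℕ} (f : Fin n → (U 𝔤 →ₐ[ℂ] B))
    (hf : ∀ i j, i ≠ j → ∀ x y, Commute (f i x) (f j y)) : UT 𝔤 n →ₐ[ℂ] B :=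
  PiTensorProduct.liftAlgHom
    ((MultilinearMap.mkPiAlgebraFin ℂ n B).compLinearMap fun i => (f i).toLinearMap)
    (by simp [MultilinearMap.mkPiAlgebraFin_apply])
    (fun x y => by
      simpa [MultilinearMap.mkPiAlgebraFin_apply] using
        prod_ofFn_mul (fun i => f i (x i)) (fun i => f i (y i)) fun i j hij => hf i j hij _ _)

theorem evalHom_leg {n : ℕ} (f : Fin n → (U 𝔤 →ₐ[ℂ] B))
    (hf : ∀ i j, i ≠ j → ∀ x y, Commute (f i x) (f j y)) (i : Fin n) (x : U 𝔤) :
    evalHom f hf (leg i x) = f i x := by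
  rw [leg_eq_tprod]
  refine (evalLegs_tprod _ _).trans ?_
  have : (fun j => (f j).toLinearMap (Pi.mulSingle (M := fun _ => U 𝔤) i x j))
      = Pi.mulSingle (M := fun _ => B) i (f i x) := by
    funext j
    by_cases h : j = i
    · subst h; simp
    · simp [h]
  rw [this]
  clear this hf
  induction n with
  | zero => exact i.elim0
  | succ m ih =>
    rw [List.ofFn_succ, List.prod_cons]
    refine Fin.cases ?_ (fun k => ?_) i
    · have : (fun j : Fin m => Pi.mulSingle (M := fun _ => B) 0 (f 0 x) j.succ)
          = fun _ => 1 := by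
        funext j; exact Pi.mulSingle_eq_of_ne (Fin.succ_ne_zero j) _
      rw [this]; simp
    · have h2 := ih (fun j => f j.succ) k
      have : (fun j : Fin m => Pi.mulSingle (M := fun _ => B) k.succ (f k.succ x) j.succ)
          = Pi.mulSingle (M := fun _ => B) k (f k.succ x) := by
        funext j
        simp [Pi.mulSingle_apply]
      rw [this, h2, Pi.mulSingle_eq_of_ne (Fin.succ_ne_zero k).symm, one_mul]

theorem map_evalLegs {n : ℕ} (g : B →ₐ[ℂ] C) (f : Fin n → (U 𝔤 →ₐ[ℂ] B)) (X : UT 𝔤 n) :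
    g (evalLegs (fun i => (f i).toLinearMap) X) =
      evalLegs (fun i => (g.comp (f i)).toLinearMap) X := by
  have : g.toLinearMap ∘ₗ evalLegs (fun i => (f i).toLinearMap) =
      evalLegs (fun i => (g.comp (f i)).toLinearMap) := by
    ext x
    simp [map_list_prod, List.map_ofFn, Function.comp_def]
  exact DFunLike.congr_fun this X

theorem commute_leg_copOn {n : ℕ} {i : Fin n} {s : Finset (Fin n)} (h : i ∉ s) (x y : U 𝔤) :
    Commute (leg i x) (copOn s y) := by
  induction y using U_induction with
  | hι y =>
    rw [copOn_ι]
    exact Commute.sum_right _ _ _ fun j hj => leg_commute (fun e => h (by rw [e]; exact hj)) _ _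
  | hC c => rw [AlgHom.commutes]; exact Algebra.commute_algebraMap_right _ _
  | hadd a b ha hb => rw [map_add]; exact ha.add_right hb
  | hmul a b ha hb => rw [map_mul]; exact ha.mul_right hb

theorem commute_copOn {n : ℕ} {s t : Finset (Fin n)} (h : Disjoint s t) (x y : U 𝔤) :
    Commute (copOn s x) (copOn t y) := by
  induction x using U_induction with
  | hι x =>
    rw [copOn_ι]
    exact Commute.sum_left _ _ _ fun j hj =>
      commute_leg_copOn (Finset.disjoint_left.1 h hj) _ _
  | hC c => rw [AlgHom.commutes]; exact Algebra.commute_algebraMap_left _ _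
  | hadd a b ha hb => rw [map_add]; exact ha.add_left hb
  | hmul a b ha hb => rw [map_mul]; exact ha.mul_left hb

/-- The leg map of a family of pairwise disjoint sets, as an algebra map. -/
def legsHom {m n : ℕ} (p : Fin m → Finset (Fin n)) (hp : ∀ i j, i ≠ j → Disjoint (p i) (p j)) :
    UT 𝔤 m →ₐ[ℂ] UT 𝔤 n :=
  evalHom (fun j => copOn (p j)) fun i j hij => commute_copOn (hp i j hij)

theorem legsHom_toLinearMap {m n : ℕ} (p : Fin m → Finset (Fin n))
    (hp : ∀ i j, i ≠ j → Disjoint (p i) (p j)) :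
    (legsHom (𝔤 := 𝔤) p hp).toLinearMap = evalLegs fun j => (copOn (p j)).toLinearMap := rfl

theorem legsHom_leg {m n : ℕ} (p : Fin m → Finset (Fin n))
    (hp : ∀ i j, i ≠ j → Disjoint (p i) (p j)) (i : Fin m) (x : U 𝔤) :
    legsHom p hp (leg i x) = copOn (p i) x :=
  evalHom_leg _ _ i x

/-- A pure tensor is the product of its factors. -/
theorem tprod_eq_prod_leg {n : ℕ} (x : Fin n → U 𝔤) :
    PiTensorProduct.tprod ℂ x = (List.ofFn fun j => leg j (x j)).prod := by
  have h : evalHom (B := UT 𝔤 n) (fun j => leg j) (fun i j hij => leg_commute hij) =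
      AlgHom.id ℂ (UT 𝔤 n) := by
    refine PiTensorProduct.algHom_ext fun i => ?_
    ext1
    refine LieHom.ext fun y => ?_
    exact evalHom_leg (B := UT 𝔤 n) (fun j => leg j) (fun i j hij => leg_commute hij) i _
  have h2 := DFunLike.congr_fun h (PiTensorProduct.tprod ℂ x)
  rw [AlgHom.id_apply] at h2
  rw [← h2]
  exact evalLegs_tprod _ x

theorem legsHom_copOn {m n : ℕ} (p : Fin m → Finset (Fin n))
    (hp : ∀ i j, i ≠ j → Disjoint (p i) (p j)) (s : Finset (Fin m)) (x : U 𝔤) :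
    legsHom p hp (copOn s x) = copOn (s.biUnion p) x := by
  have : (legsHom p hp).comp (copOn s) = (copOn (s.biUnion p) : U 𝔤 →ₐ[ℂ] UT 𝔤 n) := by
    ext x
    simp only [LieHom.comp_apply, AlgHom.coe_toLieHom, AlgHom.comp_apply, copOn_ι, map_sum,
      legsHom_leg]
    rw [Finset.sum_biUnion fun i _ j _ hij => hp i j hij]
  exact DFunLike.congr_fun this x

theorem legs_eq_map {m n : ℕ} (p : Fin m → Finset (Fin n))
    (hp : ∀ i j, i ≠ j → Disjoint (p i) (p j)) (X : (UT 𝔤 m)⟦X⟧) :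
    legs p X = PowerSeries.map (legsHom (𝔤 := 𝔤) p hp : UT 𝔤 m →+* UT 𝔤 n) X := by
  rw [legs, ← legsHom_toLinearMap p hp, hMap_algHom]

theorem legs_mul {m n : ℕ} (p : Fin m → Finset (Fin n))
    (hp : ∀ i j, i ≠ j → Disjoint (p i) (p j)) (X Y : (UT 𝔤 m)⟦X⟧) :
    legs p (X * Y) = legs p X * legs p Y := by
  simp only [legs_eq_map p hp, map_mul]

theorem legs_one {m n : ℕ} (p : Fin m → Finset (Fin n)) :
    legs p (1 : (UT 𝔤 m)⟦X⟧) = 1 := by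
  rw [← map_one PowerSeries.C, legs, hMap_C, PiTensorProduct.one_def, evalLegs_tprod]
  simp

/-- Leg maps compose by substituting sets of factors into one another; this is the source of all
rules such as `(Δ ⊗ id ⊗ id)(X_{1,23}) = X_{12,34}`. -/
theorem legs_legs {l m n : ℕ} (q : Fin m → Finset (Fin n))
    (hq : ∀ i j, i ≠ j → Disjoint (q i) (q j)) (p : Fin l → Finset (Fin m)) (X : (UT 𝔤 l)⟦X⟧) :
    legs q (legs p X) = legs (fun j => (p j).biUnion q) X := by
  rw [legs, legs, legs, hMap_hMap]
  congr 2
  ext x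
  have := map_evalLegs (legsHom q hq) (fun j => copOn (p j)) (PiTensorProduct.tprod ℂ x)
  simp only [LinearMap.compMultilinearMap_apply, LinearMap.comp_apply]
  refine this.trans ?_
  simp [legsHom_copOn]

theorem legs_hLeg {m n : ℕ} (p : Fin m → Finset (Fin n))
    (hp : ∀ i j, i ≠ j → Disjoint (p i) (p j)) (i : Fin m) (x : (U 𝔤)⟦X⟧) :
    legs p (hLeg i x) = hMap (copOn (p i)).toLinearMap x := by
  rw [legs, hLeg, hMap_hMap, ← legsHom_toLinearMap p hp]
  congr 2
  ext x
  simp only [LinearMap.comp_apply, AlgHom.toLinearMap_apply, legsHom_leg]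

theorem legs_hMap_copOn {m n : ℕ} (p : Fin m → Finset (Fin n))
    (hp : ∀ i j, i ≠ j → Disjoint (p i) (p j)) (s : Finset (Fin m)) (x : (U 𝔤)⟦X⟧) :
    legs p (hMap (copOn s).toLinearMap x) = hMap (copOn (s.biUnion p)).toLinearMap x := by
  rw [legs, hMap_hMap, ← legsHom_toLinearMap p hp]
  congr 2
  ext x
  simp only [LinearMap.comp_apply, AlgHom.toLinearMap_apply, legsHom_copOn]

theorem legs_C_copOn {m n : ℕ} (p : Fin m → Finset (Fin n))
    (hp : ∀ i j, i ≠ j → Disjoint (p i) (p j)) (s : Finset (Fin m)) (x : U 𝔤) :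
    legs p (PowerSeries.C (copOn s x)) = PowerSeries.C (copOn (s.biUnion p) x) := by
  have := legs_hMap_copOn p hp s (PowerSeries.C x)
  rwa [hMap_C, hMap_C] at this

@[fun_prop] theorem IsHLin.legs_comp {m n : ℕ} (p : Fin m → Finset (Fin n))
    {g : B⟦X⟧ → (UT 𝔤 m)⟦X⟧} (hg : IsHLin g) : IsHLin fun q => legs p (g q) := by
  unfold legs; fun_prop

@[fun_prop] theorem IsHLin.hLeg_comp {n : ℕ} (i : Fin n)
    {g : B⟦X⟧ → (U 𝔤)⟦X⟧} (hg : IsHLin g) : IsHLin fun q => hLeg i (g q) := by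
  unfold hLeg; fun_prop

theorem hLeg_mul {n : ℕ} (i : Fin n) (x y : (U 𝔤)⟦X⟧) : hLeg i (x * y) = hLeg i x * hLeg i y :=
  hMap_algHom_mul _ _ _

@[simp] theorem hLeg_one {n : ℕ} (i : Fin n) : hLeg i (1 : (U 𝔤)⟦X⟧) = 1 :=
  hMap_one_algHom _

@[simp] theorem hLeg_C {n : ℕ} (i : Fin n) (x : U 𝔤) :
    hLeg i (PowerSeries.C x) = PowerSeries.C (leg i x) := by
  rw [hLeg, hMap_C]; rfl

theorem legs_C_tprod {m n : ℕ} (p : Fin m → Finset (Fin n)) (x : Fin m → U 𝔤) :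
    legs p (PowerSeries.C (PiTensorProduct.tprod ℂ x)) =
      PowerSeries.C (List.ofFn fun j => copOn (p j) (x j)).prod := by
  rw [legs, hMap_C, evalLegs_tprod]; rfl

theorem commute_hLeg {n : ℕ} {i j : Fin n} (hij : i ≠ j) (x y : (U 𝔤)⟦X⟧) :
    Commute (hLeg i x) (hLeg j y) := by
  refine IsHLin.ext (f := fun x => hLeg i x * hLeg j y) (g := fun x => hLeg j y * hLeg i x)
    (by fun_prop) (by fun_prop) (fun x => ?_) x
  refine IsHLin.ext (f := fun y => hLeg i (PowerSeries.C x) * hLeg j y)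
    (g := fun y => hLeg j y * hLeg i (PowerSeries.C x))
    (by fun_prop) (by fun_prop) (fun y => ?_) y
  simp only [hLeg_C, ← map_mul]
  rw [(leg_commute hij x y).eq]

end Hopf

/-! ### Shifted legs and the coassociator -/

section Twist

variable {𝔤 : Type*} [LieRing 𝔤] [LieAlgebra ℂ 𝔤]

theorem disjoint_pair {n : ℕ} {s t : Finset (Fin n)} (h : Disjoint s t) (i j : Fin 2)
    (hij : i ≠ j) : Disjoint (![s, t] i) (![s, t] j) := by
  fin_cases i <;> fin_cases j <;> first | exact absurd rfl hij | exact h | exact h.symm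

theorem disjoint_triple {n : ℕ} {s t r : Finset (Fin n)} (h : Disjoint s t) (h' : Disjoint s r)
    (h'' : Disjoint t r) (i j : Fin 3) (hij : i ≠ j) :
    Disjoint (![s, t, r] i) (![s, t, r] j) := by
  fin_cases i <;> fin_cases j <;>
    first | exact absurd rfl hij | exact h | exact h.symm | exact h' | exact h'.symm
          | exact h'' | exact h''.symm

theorem disjoint_singletons {m n : ℕ} {f : Fin m → Fin n} (hf : Function.Injective f)
    (i j : Fin m) (hij : i ≠ j) : Disjoint ({f i} : Finset (Fin n)) {f j} :=
  Finset.disjoint_singleton.2 (hf.ne hij)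

/-- Shift by one factor, `X ↦ 1 ⊗ X`. -/
def shift {n : ℕ} : (UT 𝔤 n)⟦X⟧ →+* (UT 𝔤 (n + 1))⟦X⟧ :=
  PowerSeries.map (legsHom (fun j => {j.succ}) (disjoint_singletons (Fin.succ_injective n)) :
    UT 𝔤 n →ₐ[ℂ] UT 𝔤 (n + 1)).toRingHom

theorem shift_eq {n : ℕ} (X : (UT 𝔤 n)⟦X⟧) : shift X = legs (fun j => {j.succ}) X :=
  (legs_eq_map _ (disjoint_singletons (Fin.succ_injective n)) X).symm

/-- Extension by one factor, `X ↦ X ⊗ 1`. -/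
def extend {n : ℕ} : (UT 𝔤 n)⟦X⟧ →+* (UT 𝔤 (n + 1))⟦X⟧ :=
  PowerSeries.map (legsHom (fun j => {j.castSucc}) (disjoint_singletons (Fin.castSucc_injective n)) :
    UT 𝔤 n →ₐ[ℂ] UT 𝔤 (n + 1)).toRingHom

theorem extend_eq {n : ℕ} (X : (UT 𝔤 n)⟦X⟧) : extend X = legs (fun j => {j.castSucc}) X :=
  (legs_eq_map _ (disjoint_singletons (Fin.castSucc_injective n)) X).symm

theorem image_succ_eq {n : ℕ} (s : Finset (Fin n)) :
    (s.biUnion fun j => ({j.succ} : Finset (Fin (n + 1)))) = s.image Fin.succ :=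
  Finset.biUnion_singleton

theorem image_castSucc_eq {n : ℕ} (s : Finset (Fin n)) :
    (s.biUnion fun j => ({j.castSucc} : Finset (Fin (n + 1)))) = s.image Fin.castSucc :=
  Finset.biUnion_singleton

theorem shift_legs {m n : ℕ} (p : Fin m → Finset (Fin n)) (X : (UT 𝔤 m)⟦X⟧) :
    shift (legs p X) = legs (fun j => (p j).image Fin.succ) X := by
  rw [shift_eq, legs_legs _ (disjoint_singletons (Fin.succ_injective n))]
  simp only [image_succ_eq]

theorem extend_legs {m n : ℕ} (p : Fin m → Finset (Fin n)) (X : (UT 𝔤 m)⟦X⟧) :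
    extend (legs p X) = legs (fun j => (p j).image Fin.castSucc) X := by
  rw [extend_eq, legs_legs _ (disjoint_singletons (Fin.castSucc_injective n))]
  simp only [image_castSucc_eq]

theorem extend_shift {n : ℕ} (X : (UT 𝔤 n)⟦X⟧) : extend (shift X) = shift (extend X) := by
  rw [shift_eq, extend_legs, extend_eq X, shift_legs]
  congr 1

theorem shift_hLeg {n : ℕ} (i : Fin n) (x : (U 𝔤)⟦X⟧) : shift (hLeg i x) = hLeg i.succ x := by
  rw [shift_eq, legs_hLeg _ (disjoint_singletons (Fin.succ_injective n)), hLeg]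
  congr 2
  ext x
  exact copOn_singleton _ _

theorem extend_hLeg {n : ℕ} (i : Fin n) (x : (U 𝔤)⟦X⟧) :
    extend (hLeg i x) = hLeg i.castSucc x := by
  rw [extend_eq, legs_hLeg _ (disjoint_singletons (Fin.castSucc_injective n)), hLeg]
  congr 2
  ext x
  exact copOn_singleton _ _

theorem map_pair {n l : ℕ} (f : Fin n → Fin l) (s t : Finset (Fin n)) :
    (fun j => (![s, t] j).image f) = ![s.image f, t.image f] := by
  funext j; fin_cases j <;> rfl

theorem map_triple {n l : ℕ} (f : Fin n → Fin l) (s t r : Finset (Fin n)) :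
    (fun j => (![s, t, r] j).image f) = ![s.image f, t.image f, r.image f] := by
  funext j; fin_cases j <;> rfl

theorem image_succ_Ioi {n : ℕ} (i : Fin n) : (Finset.Ioi i).image Fin.succ = Finset.Ioi i.succ := by
  ext j
  refine Fin.cases ?_ (fun j => ?_) j <;> simp

theorem image_succ_univ (n : ℕ) :
    (Finset.univ : Finset (Fin n)).image Fin.succ = Finset.Ioi 0 := by
  ext j
  refine Fin.cases ?_ (fun j => ?_) j <;> simp

theorem image_castSucc_univ (n : ℕ) :
    (Finset.univ : Finset (Fin n)).image Fin.castSucc = Finset.Iio (Fin.last n) := by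
  ext j
  refine Fin.lastCases ?_ (fun j => ?_) j <;> simp [(Fin.castSucc_lt_last _).ne]

theorem image_castSucc_Ioi {n : ℕ} (i : Fin n) :
    (Finset.Ioi i).image Fin.castSucc = Finset.Ioo i.castSucc (Fin.last n) := by
  ext j
  refine Fin.lastCases ?_ (fun j => ?_) j <;> simp [Fin.castSucc_lt_last]

theorem image_succ_Ioo {n : ℕ} (i : Fin n) :
    (Finset.Ioo i.castSucc (Fin.last n)).image Fin.succ =
      Finset.Ioo i.succ.castSucc (Fin.last (n + 1)) := by
  ext j
  refine Fin.cases ?_ (fun j => ?_) j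
  · simp
  · simp [← Fin.succ_castSucc, ← Fin.succ_last, Fin.succ_lt_succ_iff, -Fin.castSucc_succ]

theorem image_succ_Iio (n : ℕ) :
    (Finset.Iio (Fin.last n)).image Fin.succ = Finset.Ioo 0 (Fin.last (n + 1)) := by
  ext j
  refine Fin.cases ?_ (fun j => ?_) j
  · simp
  · simp only [Finset.mem_image, Finset.mem_Iio, Finset.mem_Ioo, Fin.succ_pos, true_and,
      ← Fin.succ_last, Fin.succ_lt_succ_iff, Fin.succ_inj, exists_eq_right]

theorem Iio_union_last (n : ℕ) :
    (Finset.Iio (Fin.last n) ∪ {Fin.last n} : Finset (Fin (n + 1))) = Finset.univ := by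
  ext j
  simp only [Finset.mem_union, Finset.mem_Iio, Finset.mem_singleton, Finset.mem_univ, iff_true]
  exact lt_or_eq_of_le (Fin.le_last j)

theorem biUnion_univ_pair {n : ℕ} (s t : Finset (Fin n)) :
    (Finset.univ : Finset (Fin 2)).biUnion ![s, t] = s ∪ t := by
  ext j; simp [Fin.exists_fin_two]

theorem biUnion_univ_triple {n : ℕ} (s t r : Finset (Fin n)) :
    (Finset.univ : Finset (Fin 3)).biUnion ![s, t, r] = s ∪ t ∪ r := by
  ext j; simp [Fin.exists_fin_succ]

theorem singleton_union_Ioi (n : ℕ) : ({0} ∪ Finset.Ioi 0 : Finset (Fin (n + 1))) = Finset.univ := by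
  ext j
  refine Fin.cases ?_ (fun j => ?_) j <;> simp

theorem Ioo_union_last (n : ℕ) :
    (Finset.Ioo 0 (Fin.last (n + 1)) ∪ {Fin.last (n + 1)} : Finset (Fin (n + 2))) =
      Finset.Ioi 0 := by
  ext j
  simp only [Finset.mem_union, Finset.mem_Ioo, Finset.mem_singleton, Finset.mem_Ioi, Fin.lt_def,
    Fin.ext_iff, Fin.val_last, Fin.val_zero]
  omega

theorem singleton_union_Ioo (n : ℕ) :
    ({0} ∪ Finset.Ioo 0 (Fin.last (n + 1)) : Finset (Fin (n + 2))) =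
      Finset.Iio (Fin.last (n + 1)) := by
  ext j
  simp only [Finset.mem_union, Finset.mem_Ioo, Finset.mem_singleton, Finset.mem_Iio, Fin.lt_def,
    Fin.ext_iff, Fin.val_last, Fin.val_zero]
  omega

theorem disjoint_zero_Ioo_last (b : ℕ) (i j : Fin 3) (hij : i ≠ j) : Disjoint
    (![{(0 : Fin (b + 2))}, Finset.Ioo 0 (Fin.last (b + 1)), {Fin.last (b + 1)}] i)
    (![{(0 : Fin (b + 2))}, Finset.Ioo 0 (Fin.last (b + 1)), {Fin.last (b + 1)}] j) :=
  disjoint_triple (by simp) (by simp [Fin.ext_iff]) (by simp) i j hij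

section Legs3

variable {n : ℕ} {s t r : Finset (Fin n)}

theorem legs_legs_0_12 (h : Disjoint s t) (h' : Disjoint s r) (h'' : Disjoint t r)
    (Z : (UT 𝔤 2)⟦X⟧) :
    legs ![s, t, r] (legs ![{0}, {1, 2}] Z : (UT 𝔤 3)⟦X⟧) = legs ![s, t ∪ r] Z := by
  rw [legs_legs _ (disjoint_triple h h' h'')]
  refine congrArg (fun p => legs p Z) ?_
  funext j
  fin_cases j <;> simp

theorem legs_legs_01_2 (h : Disjoint s t) (h' : Disjoint s r) (h'' : Disjoint t r)
    (Z : (UT 𝔤 2)⟦X⟧) :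
    legs ![s, t, r] (legs ![{0, 1}, {2}] Z : (UT 𝔤 3)⟦X⟧) = legs ![s ∪ t, r] Z := by
  rw [legs_legs _ (disjoint_triple h h' h'')]
  refine congrArg (fun p => legs p Z) ?_
  funext j
  fin_cases j <;> simp

theorem legs_legs_0_1 (h : Disjoint s t) (h' : Disjoint s r) (h'' : Disjoint t r)
    (Z : (UT 𝔤 2)⟦X⟧) :
    legs ![s, t, r] (legs ![{0}, {1}] Z : (UT 𝔤 3)⟦X⟧) = legs ![s, t] Z := by
  rw [legs_legs _ (disjoint_triple h h' h'')]
  refine congrArg (fun p => legs p Z) ?_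
  funext j
  fin_cases j <;> simp

theorem legs_legs_1_2 (h : Disjoint s t) (h' : Disjoint s r) (h'' : Disjoint t r)
    (Z : (UT 𝔤 2)⟦X⟧) :
    legs ![s, t, r] (legs ![{1}, {2}] Z : (UT 𝔤 3)⟦X⟧) = legs ![t, r] Z := by
  rw [legs_legs _ (disjoint_triple h h' h'')]
  refine congrArg (fun p => legs p Z) ?_
  funext j
  fin_cases j <;> simp

end Legs3

theorem twMulti_zero (F : ((UT 𝔤 2)⟦X⟧)ˣ) : twMulti F 0 = 1 := by simp [twMulti]

/-- `𝓕_{12…(b+1)} = 𝓕_{2…(b+1)} 𝓕_{1,2…(b+1)}`. -/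
theorem twMulti_succ (F : ((UT 𝔤 2)⟦X⟧)ˣ) (b : ℕ) :
    twMulti F (b + 1) = shift (twMulti F b) * legs ![{0}, Finset.Ioi 0] (F : (UT 𝔤 2)⟦X⟧) := by
  have h : ∀ i : Fin b, legs ![{i.succ}, Finset.Ioi i.succ] (F : (UT 𝔤 2)⟦X⟧) =
      shift (legs ![{i}, Finset.Ioi i] (F : (UT 𝔤 2)⟦X⟧)) := by
    intro i
    rw [shift_legs, map_pair, image_succ_Ioi, Finset.image_singleton]
  rw [twMulti, List.finRange_succ, List.reverse_cons, List.map_append, List.prod_append, twMulti,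
    map_list_prod, ← List.map_reverse]
  simp [Function.comp_def, h]

theorem coassocMulti_zero (ψ : (UT 𝔤 3)⟦X⟧) : coassocMulti ψ 0 = 1 := by simp [coassocMulti]

/-- `coassocMulti ψ (b + 1) = (1 ⊗ coassocMulti ψ b) ψ_{1,2…(b+1),(b+2)}`. -/
theorem coassocMulti_succ (ψ : (UT 𝔤 3)⟦X⟧) (b : ℕ) :
    coassocMulti ψ (b + 1) = shift (coassocMulti ψ b) *
      legs ![{0}, Finset.Ioo 0 (Fin.last (b + 1)), {Fin.last (b + 1)}] ψ := by
  have h : ∀ i : Fin b, legs ![{i.succ.castSucc}, Finset.Ioo i.succ.castSucc (Fin.last (b + 1)),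
        {Fin.last (b + 1)}] ψ =
      shift (legs ![{i.castSucc}, Finset.Ioo i.castSucc (Fin.last b), {Fin.last b}] ψ) := by
    intro i
    rw [shift_legs, map_triple, image_succ_Ioo, Finset.image_singleton, Finset.image_singleton,
      Fin.succ_last, Fin.succ_castSucc]
  rw [coassocMulti, List.finRange_succ, List.reverse_cons, List.map_append, List.prod_append,
    coassocMulti, map_list_prod, ← List.map_reverse]
  simp only [List.map_map, Function.comp_def, h]
  simp

section Units

variable (F : ((UT 𝔤 2)⟦X⟧)ˣ)

/-- The leg image of an invertible element. -/
def legsUnit {n : ℕ} (s t : Finset (Fin n)) (h : Disjoint s t) : ((UT 𝔤 n)⟦X⟧)ˣ where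
  val := legs ![s, t] (F : (UT 𝔤 2)⟦X⟧)
  inv := legs ![s, t] (↑F⁻¹ : (UT 𝔤 2)⟦X⟧)
  val_inv := by rw [← legs_mul _ (disjoint_pair h), Units.mul_inv, legs_one]
  inv_val := by rw [← legs_mul _ (disjoint_pair h), Units.inv_mul, legs_one]

theorem legs_mul_legs_inv {n : ℕ} {s t : Finset (Fin n)} (h : Disjoint s t) :
    legs ![s, t] (F : (UT 𝔤 2)⟦X⟧) * legs ![s, t] (↑F⁻¹ : (UT 𝔤 2)⟦X⟧) = 1 :=
  (legsUnit F s t h).mul_inv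

/-- The coassociator as a unit. -/
def coassocUnit : ((UT 𝔤 3)⟦X⟧)ˣ :=
  (legsUnit F {0, 1} {2} (by decide))⁻¹ * (legsUnit F {0} {1} (by decide))⁻¹ *
    legsUnit F {1} {2} (by decide) * legsUnit F {0} {1, 2} (by decide)

theorem coe_coassocUnit : (coassocUnit F : (UT 𝔤 3)⟦X⟧) = coassociator F := rfl

theorem inverse_coassociator : Ring.inverse (coassociator F) = ↑(coassocUnit F)⁻¹ := by
  rw [← coe_coassocUnit, Ring.inverse_unit]

theorem coe_coassocUnit_inv : (↑(coassocUnit F)⁻¹ : (UT 𝔤 3)⟦X⟧) =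
    legs ![{0}, {1, 2}] (↑F⁻¹ : (UT 𝔤 2)⟦X⟧) * legs ![{1}, {2}] (↑F⁻¹ : (UT 𝔤 2)⟦X⟧) *
      legs ![{0}, {1}] (F : (UT 𝔤 2)⟦X⟧) * legs ![{0, 1}, {2}] (F : (UT 𝔤 2)⟦X⟧) := by
  simp only [coassocUnit, mul_inv_rev, inv_inv, Units.val_mul, mul_assoc]
  rfl

variable {F}

/-- If conjugation of `D` by `ab` agrees with conjugation by `cd`, then `D` commutes with
`(ab)⁻¹cd`. -/
theorem commute_of_conj_eq {M : Type*} [Monoid M] (a b c d : Mˣ) (D : M)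
    (h : ↑a * (↑b * D * ↑b⁻¹) * ↑a⁻¹ = (↑c * (↑d * D * ↑d⁻¹) * ↑c⁻¹ : M)) :
    Commute (↑(b⁻¹ * a⁻¹ * c * d) : M) D := by
  have h2 : (↑c * ↑d * D : M) = ↑a * (↑b * D * ↑b⁻¹) * ↑a⁻¹ * ↑c * ↑d := by
    rw [h]; simp [mul_assoc]
  have : (↑(b⁻¹ * a⁻¹ * c * d) * D : M) = ↑b⁻¹ * ↑a⁻¹ * (↑c * ↑d * D) := by
    simp [mul_assoc]
  rw [Commute, SemiconjBy, this, h2]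
  simp [mul_assoc]

/-- Coassociativity of the twisted coproduct says that the coassociator is `𝔤`-invariant. -/
theorem coassocUnit_commute (hF : IsTwist F) (x : U 𝔤) :
    Commute (coassocUnit F : (UT 𝔤 3)⟦X⟧) (PowerSeries.C (copOn Finset.univ x)) := by
  have h := hF.coassoc (PowerSeries.C x)
  refine commute_of_conj_eq (legsUnit F {0} {1} (by decide)) (legsUnit F {0, 1} {2} (by decide))
    (legsUnit F {1} {2} (by decide)) (legsUnit F {0} {1, 2} (by decide)) _ ?_
  have e1 : ((Finset.univ : Finset (Fin 2)).biUnion ![{0, 1}, {2}]) =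
    (Finset.univ : Finset (Fin 3)) := by decide
  have e2 : ((Finset.univ : Finset (Fin 2)).biUnion ![{0}, {1, 2}]) =
    (Finset.univ : Finset (Fin 3)) := by decide
  rw [twCop, legs_mul _ (disjoint_pair (by decide)), legs_mul _ (disjoint_pair (by decide)),
    legs_mul _ (disjoint_pair (by decide)), legs_mul _ (disjoint_pair (by decide)),
    legs_hMap_copOn _ (disjoint_pair (by decide)), legs_hMap_copOn _ (disjoint_pair (by decide)),
    e1, e2, hMap_C] at h
  exact h

/-- `x ⊗ 1` and `1 ⊗ P` commute. -/
theorem commute_hLeg_shift {b : ℕ} (x : (U 𝔤)⟦X⟧) (P : (UT 𝔤 b)⟦X⟧) :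
    Commute (hLeg 0 x) (shift P) := by
  rw [shift_eq]
  refine IsHLin.ext (f := fun x => hLeg 0 x * legs (fun j => {j.succ}) P)
    (g := fun x => legs (fun j => {j.succ}) P * hLeg 0 x) (by fun_prop) (by fun_prop)
    (fun x => ?_) x
  refine IsHLin.ext_tprod (f := fun P => _ * legs (fun j => {j.succ}) P)
    (g := fun P => legs (fun j => {j.succ}) P * _) (by fun_prop) (by fun_prop) (fun y => ?_) P
  rw [legs_C_tprod, hLeg_C, ← map_mul, ← map_mul]
  congr 1
  refine Commute.list_prod_right _ _ fun z hz => ?_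
  obtain ⟨i, rfl⟩ := List.mem_ofFn.1 hz
  exact commute_leg_copOn (by simp [(Fin.succ_ne_zero _).symm]) _ _

/-- In leg notation, `Z_{1,2…(b+1)}` for a pure tensor `Z = z₀ ⊗ z₁`. -/
theorem legs_zero_Ioi_C_tprod {n : ℕ} (z : Fin 2 → U 𝔤) :
    legs ![{0}, Finset.Ioi 0] (PowerSeries.C (PiTensorProduct.tprod ℂ z)) =
      (hLeg 0 (PowerSeries.C (z 0)) * shift (PowerSeries.C (copOn Finset.univ (z 1))) :
        (UT 𝔤 (n + 1))⟦X⟧) := by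
  rw [legs_C_tprod, shift_eq, legs_C_copOn _ (disjoint_singletons (Fin.succ_injective n)),
    image_succ_eq, image_succ_univ, hLeg_C, ← map_mul]
  simp [copOn_singleton, List.ofFn_succ]

/-- If `P` commutes with the coproducts, then `1 ⊗ P` commutes with every `Z_{1,2…(b+1)}`. -/
theorem commute_legs_shift {b : ℕ} {P : (UT 𝔤 b)⟦X⟧}
    (hP : ∀ y : U 𝔤, Commute P (PowerSeries.C (copOn Finset.univ y))) (Z : (UT 𝔤 2)⟦X⟧) :
    Commute (shift P) (legs ![{0}, Finset.Ioi 0] Z) := by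
  refine IsHLin.ext_tprod (f := fun Z => shift P * legs ![{0}, Finset.Ioi 0] Z)
    (g := fun Z => legs ![{0}, Finset.Ioi 0] Z * shift P) (by fun_prop) (by fun_prop)
    (fun x => ?_) Z
  rw [legs_zero_Ioi_C_tprod]
  exact ((commute_hLeg_shift _ P).symm.mul_right ((hP (x 1)).map shift)).eq

theorem coassocMulti_commute {ψ : (UT 𝔤 3)⟦X⟧}
    (hψ : ∀ y : U 𝔤, Commute ψ (PowerSeries.C (copOn Finset.univ y))) (b : ℕ) (y : U 𝔤) :
    Commute (coassocMulti ψ b) (PowerSeries.C (copOn Finset.univ y)) := by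
  induction b generalizing y with
  | zero => rw [coassocMulti_zero]; exact Commute.one_left _
  | succ b ih =>
    rw [coassocMulti_succ]
    refine Commute.mul_left ?_ ?_
    · have h := commute_legs_shift ih (PowerSeries.C (copOn Finset.univ y))
      rwa [legs_C_copOn _ (disjoint_pair (by simp)), biUnion_univ_pair, singleton_union_Ioi] at h
    · have hd := disjoint_zero_Ioo_last b
      have h : Commute (legs ![{0}, Finset.Ioo 0 (Fin.last (b + 1)), {Fin.last (b + 1)}] ψ)
          (legs ![{0}, Finset.Ioo 0 (Fin.last (b + 1)), {Fin.last (b + 1)}]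
            (PowerSeries.C (copOn Finset.univ y))) := by
        rw [Commute, SemiconjBy, ← legs_mul _ hd, ← legs_mul _ hd, (hψ y).eq]
      rwa [legs_C_copOn _ hd, biUnion_univ_triple, singleton_union_Ioo, Iio_union_last] at h

/-- `𝓕_{12…b} 𝓕_{1…b,b+1}` and `𝓕_{12…(b+1)}` differ by the product of inverse coassociators: both join
the factors `1, …, b + 1`, in different orders. -/
theorem extend_twMulti_mul (hF : IsTwist F) (b : ℕ) :
    extend (twMulti F b) * legs ![Finset.Iio (Fin.last b), {Fin.last b}] (F : (UT 𝔤 2)⟦X⟧) =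
      twMulti F (b + 1) * coassocMulti (↑(coassocUnit F)⁻¹) b := by
  induction b with
  | zero =>
    rw [twMulti_succ, twMulti_zero, map_one, map_one, one_mul, one_mul, coassocMulti_zero, mul_one]
    have h1 := hF.counit_left
    have h2 := hF.counit_right
    rw [show Finset.Iio (Fin.last 0) = ∅ by decide, show Finset.Ioi (0 : Fin (0 + 1)) = ∅ by decide]
    exact h1.trans h2.symm
  | succ b ih =>
    have ih' := congrArg shift ih
    rw [map_mul, map_mul, shift_legs, map_pair, image_succ_Iio, Finset.image_singleton,
      Fin.succ_last] at ih'
    have hψ : ∀ y : U 𝔤, Commute (↑(coassocUnit F)⁻¹ : (UT 𝔤 3)⟦X⟧)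
      (PowerSeries.C (copOn Finset.univ y)) := fun y => (coassocUnit_commute hF y).units_inv_left
    have hc := commute_legs_shift (coassocMulti_commute hψ b) (F : (UT 𝔤 2)⟦X⟧)
    have hd := disjoint_zero_Ioo_last b
    have hψ' : legs ![{0}, Finset.Ioo 0 (Fin.last (b + 1)), {Fin.last (b + 1)}]
        (↑(coassocUnit F)⁻¹ : (UT 𝔤 3)⟦X⟧) =
        legs ![{0}, Finset.Ioi 0] (↑F⁻¹ : (UT 𝔤 2)⟦X⟧) *
        legs ![Finset.Ioo 0 (Fin.last (b + 1)), {Fin.last (b + 1)}] (↑F⁻¹ : (UT 𝔤 2)⟦X⟧) *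
        legs ![{0}, Finset.Ioo 0 (Fin.last (b + 1))] (F : (UT 𝔤 2)⟦X⟧) *
        legs ![Finset.Iio (Fin.last (b + 1)), {Fin.last (b + 1)}] (F : (UT 𝔤 2)⟦X⟧) := by
      have h1 : Disjoint ({0} : Finset (Fin (b + 2))) (Finset.Ioo 0 (Fin.last (b + 1))) := by simp
      have h2 : Disjoint ({0} : Finset (Fin (b + 2))) {Fin.last (b + 1)} := by simp [Fin.ext_iff]
      have h3 : Disjoint (Finset.Ioo 0 (Fin.last (b + 1))) {Fin.last (b + 1)} := by simp
      rw [coe_coassocUnit_inv, legs_mul _ hd, legs_mul _ hd, legs_mul _ hd,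
        legs_legs_0_12 h1 h2 h3, legs_legs_1_2 h1 h2 h3, legs_legs_0_1 h1 h2 h3,
        legs_legs_01_2 h1 h2 h3, Ioo_union_last, singleton_union_Ioo]
    have hu := legs_mul_legs_inv F (by simp : Disjoint {0} (Finset.Ioi (0 : Fin (b + 2))))
    have hu' := legs_mul_legs_inv F
      (by simp : Disjoint (Finset.Ioo 0 (Fin.last (b + 1))) {Fin.last (b + 1)})
    -- The coassociators of the factors `2, …, b + 2` are invariant, so that `𝓕_{1,2…(b+2)}`
    -- moves through their product (`hc`) and cancels against the first factor of `hψ'`.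
    rw [twMulti_succ F (b + 1), coassocMulti_succ, hψ', mul_assoc (shift _),
      ← mul_assoc (legs ![{0}, Finset.Ioi 0] (F : (UT 𝔤 2)⟦X⟧)), ← hc.eq]
    simp only [mul_assoc]
    rw [← mul_assoc (legs ![{0}, Finset.Ioi 0] (F : (UT 𝔤 2)⟦X⟧)), hu, one_mul, ← mul_assoc, ← ih',
      mul_assoc, ← mul_assoc _ (legs _ (↑F⁻¹ : (UT 𝔤 2)⟦X⟧)), hu', one_mul, twMulti_succ, map_mul,
      extend_shift, extend_legs, map_pair, image_castSucc_Ioi, Finset.image_singleton, mul_assoc,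
      Fin.castSucc_zero]

end Units

end Twist

/-! ### Matrix elements -/

section Entries

variable {𝔤 : Type*} [LieRing 𝔤] [LieAlgebra ℂ 𝔤] {ι : Type*} [Fintype ι] [DecidableEq ι]
  {s : ℤˣ} (ρ : 𝔤 →ₗ⁅ℂ⁆ Matrix ι ι ℂ)

section Scalars

variable {B C : Type*} [Ring B] [Algebra ℂ B] [Ring C] [Algebra ℂ C]

theorem hScalar_mul (c d : ℂ⟦X⟧) : hScalar B (c * d) = hScalar B c * hScalar B d := by
  simp [hScalar]

theorem hScalar_sum {κ : Type*} (t : Finset κ) (c : κ → ℂ⟦X⟧) :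
    hScalar B (∑ i ∈ t, c i) = ∑ i ∈ t, hScalar B (c i) := by
  simp [hScalar]

@[simp] theorem hScalar_C (c : ℂ) : hScalar B (PowerSeries.C c) = PowerSeries.C (algebraMap ℂ B c) := by
  simp [hScalar]

@[simp] theorem hScalar_one : hScalar B 1 = 1 := by simp [hScalar]

theorem hScalar_eq_hMap (c : ℂ⟦X⟧) : hScalar B c = hMap (Algebra.linearMap ℂ B) c := by
  ext n; simp [hScalar]

@[fun_prop] theorem IsHLin.hScalar_comp {g : C⟦X⟧ → ℂ⟦X⟧} (hg : IsHLin g) :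
    IsHLin fun q => hScalar B (g q) := by
  simp only [hScalar_eq_hMap]; fun_prop

theorem hScalar_commute (c : ℂ⟦X⟧) (p : B⟦X⟧) : Commute (hScalar B c) p := by
  ext n
  rw [PowerSeries.coeff_mul, PowerSeries.coeff_mul, ← Finset.Nat.sum_antidiagonal_swap]
  refine Finset.sum_congr rfl fun ij _ => ?_
  simp only [hScalar, PowerSeries.coeff_map, Prod.fst_swap, Prod.snd_swap]
  exact Algebra.commutes _ _

theorem hMap_mul_sum {κ : Type*} (t : Finset κ)
    {f : B →ₗ[ℂ] C} {g h : κ → (B →ₗ[ℂ] C)} (H : ∀ a b, f (a * b) = ∑ i ∈ t, g i a * h i b)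
    (p q : B⟦X⟧) : hMap f (p * q) = ∑ i ∈ t, hMap (g i) p * hMap (h i) q := by
  ext n
  simp only [coeff_hMap, PowerSeries.coeff_mul, map_sum, H]
  rw [Finset.sum_comm]

end Scalars

/-- The representation `ρ` of `U𝔤` as an algebra map. -/
def repHom : U 𝔤 →ₐ[ℂ] Matrix ι ι ℂ := UniversalEnvelopingAlgebra.lift ℂ ρ

theorem rep_apply (x : U 𝔤) : rep ρ x = repHom ρ x := rfl

theorem repDual_apply (x : U 𝔤) (i j : ι) : repDual ρ x i j = rep ρ (antipode 𝔤 x) j i := rfl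

/-- The contragredient representation of `U𝔤` as an algebra map. -/
def repDualHom : U 𝔤 →ₐ[ℂ] Matrix ι ι ℂ :=
  AlgHom.ofLinearMap (repDual ρ) (by ext i j; simp [repDual_apply, rep_apply, Matrix.one_apply, eq_comm])
    (by
      intro x y
      ext i j
      simp [repDual_apply, rep_apply, Matrix.mul_apply, mul_comm])

theorem repDualHom_toLinearMap : (repDualHom ρ).toLinearMap = repDual ρ := rfl

theorem repHom_toLinearMap : (repHom ρ).toLinearMap = rep ρ := rfl

/-- The representations `ρ^{⊗ k} ⊗ ρ^∨^{⊗ h}` as algebra maps. -/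
def mixedHom (k h : ℕ) : Fin (k + h) → (U 𝔤 →ₐ[ℂ] Matrix ι ι ℂ) :=
  Fin.addCases (fun _ => repHom ρ) (fun _ => repDualHom ρ)

theorem mixedRep_eq (k h : ℕ) : mixedRep ρ k h = fun t => (mixedHom ρ k h t).toLinearMap := by
  funext t
  refine Fin.addCases (fun i => ?_) (fun i => ?_) t <;>
    simp [mixedRep, mixedHom, repHom_toLinearMap, repDualHom_toLinearMap]

section General

variable {n : ℕ} (R : Fin n → (U 𝔤 →ₐ[ℂ] Matrix ι ι ℂ))

/-- Matrix elements of a tensor product of representations. -/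
def tEntry (K K' : Fin n → ι) : UT 𝔤 n →ₗ[ℂ] ℂ := entry (fun t => (R t).toLinearMap) K K'

/-- Matrix elements of a tensor product of representations and of `σ` in the last factor. -/
def tEntrySig (s : ℤˣ) (K K' : Fin n → ι) : UT 𝔤 (n + 1) →ₗ[ℂ] Heis ι s :=
  entrySig ρ s (fun t => (R t).toLinearMap) K K'

@[simp] theorem tEntry_tprod (K K' : Fin n → ι) (x : Fin n → U 𝔤) :
    tEntry R K K' (PiTensorProduct.tprod ℂ x) = ∏ i, R i (x i) (K i) (K' i) := by
  rw [tEntry, entry, evalLegs_tprod, List.prod_ofFn]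
  rfl

@[simp] theorem tEntrySig_tprod (K K' : Fin n → ι) (x : Fin (n + 1) → U 𝔤) :
    tEntrySig ρ R s K K' (PiTensorProduct.tprod ℂ x) =
      algebraMap ℂ (Heis ι s) (∏ i, R i (x i.castSucc) (K i) (K' i)) * sig ρ s (x (Fin.last n)) := by
  rw [tEntrySig, entrySig, evalLegs_tprod, List.ofFn_succ']
  simp only [List.concat_eq_append, List.prod_append, List.prod_singleton, Fin.snoc_castSucc,
    Fin.snoc_last]
  rw [← List.prod_ofFn, map_list_prod, List.map_ofFn]
  rfl

theorem prod_mul_entries (x y : Fin n → U 𝔤) (K K' : Fin n → ι) :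
    ∏ i, R i (x i * y i) (K i) (K' i) =
      ∑ L : Fin n → ι, (∏ i, R i (x i) (K i) (L i)) * ∏ i, R i (y i) (L i) (K' i) := by
  simp only [map_mul, Matrix.mul_apply, ← Finset.prod_mul_distrib]
  rw [Finset.prod_univ_sum, Fintype.piFinset_univ]

theorem tEntry_mul (K K' : Fin n → ι) (a b : UT 𝔤 n) :
    tEntry R K K' (a * b) = ∑ L, tEntry R K L a * tEntry R L K' b := by
  refine UT_linear_ext (f := fun a => tEntry R K K' (a * b))
    (g := fun a => ∑ L, tEntry R K L a * tEntry R L K' b) ⟨?_, ?_⟩ ⟨?_, ?_⟩ (fun x => ?_) a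
  · intro x y; simp [add_mul]
  · intro c x; simp
  · intro x y; simp [add_mul, Finset.sum_add_distrib]
  · intro c x; simp [Finset.mul_sum, mul_assoc]
  refine UT_linear_ext (f := fun b => tEntry R K K' (_ * b))
    (g := fun b => ∑ L, tEntry R K L _ * tEntry R L K' b) ⟨?_, ?_⟩ ⟨?_, ?_⟩ (fun y => ?_) b
  · intro x y; simp [mul_add]
  · intro c x; simp
  · intro x y; simp [mul_add, Finset.sum_add_distrib]
  · intro c x; simp [Finset.mul_sum, mul_left_comm]
  simp only [PiTensorProduct.tprod_mul_tprod, tEntry_tprod, Pi.mul_apply, prod_mul_entries]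

theorem tEntrySig_mul (K K' : Fin n → ι) (a b : UT 𝔤 (n + 1)) :
    tEntrySig ρ R s K K' (a * b) = ∑ L, tEntrySig ρ R s K L a * tEntrySig ρ R s L K' b := by
  refine UT_linear_ext (f := fun a => tEntrySig ρ R s K K' (a * b))
    (g := fun a => ∑ L, tEntrySig ρ R s K L a * tEntrySig ρ R s L K' b)
    ⟨?_, ?_⟩ ⟨?_, ?_⟩ (fun x => ?_) a
  · intro x y; simp [add_mul]
  · intro c x; simp
  · intro x y; simp [add_mul, Finset.sum_add_distrib]
  · intro c x; simp [Finset.smul_sum]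
  refine UT_linear_ext (f := fun b => tEntrySig ρ R s K K' (_ * b))
    (g := fun b => ∑ L, tEntrySig ρ R s K L _ * tEntrySig ρ R s L K' b)
    ⟨?_, ?_⟩ ⟨?_, ?_⟩ (fun y => ?_) b
  · intro x y; simp [mul_add]
  · intro c x; simp
  · intro x y; simp [mul_add, Finset.sum_add_distrib]
  · intro c x; simp [Finset.smul_sum]
  simp only [PiTensorProduct.tprod_mul_tprod, tEntrySig_tprod, Pi.mul_apply, prod_mul_entries]
  simp only [map_sum, Finset.sum_mul, map_mul]
  refine Finset.sum_congr rfl fun L _ => ?_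
  rw [mul_assoc, mul_assoc, ← mul_assoc (sig ρ s _), ← Algebra.commutes, mul_assoc]

theorem hMap_tEntry_mul (K K' : Fin n → ι) (X Y : (UT 𝔤 n)⟦X⟧) :
    hMap (tEntry R K K') (X * Y) = ∑ L, hMap (tEntry R K L) X * hMap (tEntry R L K') Y :=
  hMap_mul_sum _ (g := fun L => tEntry R K L) (h := fun L => tEntry R L K') (tEntry_mul R K K') X Y

theorem hMap_tEntrySig_mul (K K' : Fin n → ι) (X Y : (UT 𝔤 (n + 1))⟦X⟧) :
    hMap (tEntrySig ρ R s K K') (X * Y) =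
      ∑ L, hMap (tEntrySig ρ R s K L) X * hMap (tEntrySig ρ R s L K') Y :=
  hMap_mul_sum _ (g := fun L => tEntrySig ρ R s K L) (h := fun L => tEntrySig ρ R s L K')
    (tEntrySig_mul ρ R K K') X Y

theorem hMap_tEntry_one (K K' : Fin n → ι) :
    hMap (tEntry R K K') 1 = if K = K' then 1 else 0 := by
  rw [← map_one PowerSeries.C, hMap_C, PiTensorProduct.one_def, tEntry_tprod]
  simp only [Pi.one_apply, map_one]
  split_ifs with h
  · subst h; simp
  · obtain ⟨i, hi⟩ := Function.ne_iff.1 h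
    rw [Finset.prod_eq_zero (Finset.mem_univ i)
      (show (1 : Matrix ι ι ℂ) (K i) (K' i) = 0 from Matrix.one_apply_ne hi), map_zero]

theorem extend_C_tprod (x : Fin n → U 𝔤) :
    extend (PowerSeries.C (PiTensorProduct.tprod ℂ x)) =
      PowerSeries.C (PiTensorProduct.tprod ℂ (Fin.snoc (α := fun _ => U 𝔤) x 1)) := by
  rw [extend_eq, legs_C_tprod, tprod_eq_prod_leg, List.ofFn_succ']
  simp [copOn_singleton]

theorem shift_C_tprod (x : Fin n → U 𝔤) :
    shift (PowerSeries.C (PiTensorProduct.tprod ℂ x)) =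
      PowerSeries.C (PiTensorProduct.tprod ℂ (Fin.cons (α := fun _ => U 𝔤) 1 x)) := by
  rw [shift_eq, legs_C_tprod, tprod_eq_prod_leg, List.ofFn_succ]
  simp [copOn_singleton]

theorem leg_zero_mul_tprod (x : U 𝔤) (y : Fin n → U 𝔤) :
    leg 0 x * PiTensorProduct.tprod ℂ (Fin.cons (α := fun _ => U 𝔤) 1 y) =
      PiTensorProduct.tprod ℂ (Fin.cons (α := fun _ => U 𝔤) x y) := by
  rw [tprod_eq_prod_leg, tprod_eq_prod_leg, List.ofFn_succ, List.ofFn_succ]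
  simp

@[fun_prop] theorem IsHLin.shift_comp {B : Type*} [Ring B] [Algebra ℂ B]
    {g : B⟦X⟧ → (UT 𝔤 n)⟦X⟧} (hg : IsHLin g) : IsHLin fun q => shift (g q) := by
  simp only [shift_eq]; fun_prop

@[fun_prop] theorem IsHLin.extend_comp {B : Type*} [Ring B] [Algebra ℂ B]
    {g : B⟦X⟧ → (UT 𝔤 n)⟦X⟧} (hg : IsHLin g) : IsHLin fun q => extend (g q) := by
  simp only [extend_eq]; fun_prop

theorem hMap_tEntrySig_extend (K K' : Fin n → ι) (X : (UT 𝔤 n)⟦X⟧) :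
    hMap (tEntrySig ρ R s K K') (extend X) = hScalar (Heis ι s) (hMap (tEntry R K K') X) := by
  refine IsHLin.ext_tprod (f := fun X => hMap (tEntrySig ρ R s K K') (extend X))
    (g := fun X => hScalar (Heis ι s) (hMap (tEntry R K K') X)) (by fun_prop) (by fun_prop)
    (fun x => ?_) X
  rw [extend_C_tprod, hMap_C, hMap_C, hScalar_C, tEntry_tprod, tEntrySig_tprod, Fin.snoc_last,
    map_one, mul_one]
  simp only [Fin.snoc_castSucc]

end General

section Succ

variable {n : ℕ} (R : Fin (n + 1) → (U 𝔤 →ₐ[ℂ] Matrix ι ι ℂ))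

/-- A matrix element of a representation, as a linear map. -/
def repEntry (R : U 𝔤 →ₐ[ℂ] Matrix ι ι ℂ) (l k : ι) : U 𝔤 →ₗ[ℂ] ℂ :=
  Matrix.entryLinearMap ℂ ℂ l k ∘ₗ R.toLinearMap

@[simp] theorem repEntry_apply (R : U 𝔤 →ₐ[ℂ] Matrix ι ι ℂ) (l k : ι) (x : U 𝔤) :
    repEntry R l k x = R x l k := rfl

theorem hMap_tEntry_cons (l k : ι) (L K : Fin n → ι) (x : (U 𝔤)⟦X⟧) (Y : (UT 𝔤 n)⟦X⟧) :
    hMap (tEntry R (Fin.cons l L) (Fin.cons k K)) (hLeg 0 x * shift Y) =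
      hMap (repEntry (R 0) l k) x * hMap (tEntry (fun i => R i.succ) L K) Y := by
  refine IsHLin.ext (f := fun x => hMap (tEntry R (Fin.cons l L) (Fin.cons k K)) (hLeg 0 x * shift Y))
    (g := fun x => hMap (repEntry (R 0) l k) x * hMap (tEntry (fun i => R i.succ) L K) Y)
    (by fun_prop) (by fun_prop) (fun x => ?_) x
  refine IsHLin.ext_tprod
    (f := fun Y => hMap (tEntry R (Fin.cons l L) (Fin.cons k K)) (hLeg 0 (PowerSeries.C x) * shift Y))
    (g := fun Y => hMap (repEntry (R 0) l k) (PowerSeries.C x) *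
      hMap (tEntry (fun i => R i.succ) L K) Y) (by fun_prop) (by fun_prop) (fun y => ?_) Y
  rw [shift_C_tprod, hLeg_C, ← map_mul, leg_zero_mul_tprod]
  simp [Fin.prod_univ_succ]

theorem hMap_tEntrySig_cons (l k : ι) (L K : Fin n → ι) (x : (U 𝔤)⟦X⟧) (Y : (UT 𝔤 (n + 1))⟦X⟧) :
    hMap (tEntrySig ρ R s (Fin.cons l L) (Fin.cons k K)) (hLeg 0 x * shift Y) =
      hScalar (Heis ι s) (hMap (repEntry (R 0) l k) x) *
        hMap (tEntrySig ρ (fun i => R i.succ) s L K) Y := by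
  refine IsHLin.ext
    (f := fun x => hMap (tEntrySig ρ R s (Fin.cons l L) (Fin.cons k K)) (hLeg 0 x * shift Y))
    (g := fun x => hScalar (Heis ι s) (hMap (repEntry (R 0) l k) x) *
      hMap (tEntrySig ρ (fun i => R i.succ) s L K) Y)
    (by fun_prop) (by fun_prop) (fun x => ?_) x
  refine IsHLin.ext_tprod
    (f := fun Y => hMap (tEntrySig ρ R s (Fin.cons l L) (Fin.cons k K))
      (hLeg 0 (PowerSeries.C x) * shift Y))
    (g := fun Y => hScalar (Heis ι s) (hMap (repEntry (R 0) l k) (PowerSeries.C x)) *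
      hMap (tEntrySig ρ (fun i => R i.succ) s L K) Y) (by fun_prop) (by fun_prop) (fun y => ?_) Y
  rw [shift_C_tprod, hLeg_C, ← map_mul, leg_zero_mul_tprod]
  simp [Fin.prod_univ_succ, ← Fin.succ_castSucc, ← Fin.succ_last, -Fin.castSucc_succ, mul_assoc]

end Succ

omit [DecidableEq ι] in
theorem sum_cons {M : Type*} [AddCommMonoid M] {n : ℕ} (f : (Fin (n + 1) → ι) → M) :
    ∑ K, f K = ∑ l : ι, ∑ L : Fin n → ι, f (Fin.cons l L) := by
  rw [← (Fin.consEquiv fun _ => ι).sum_comp, Fintype.sum_prod_type]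
  rfl

end Entries

/-! ### Covariant tuples and monomials in deformed generators -/

section Covariance

variable {𝔤 : Type*} [LieRing 𝔤] [LieAlgebra ℂ 𝔤] {ι : Type*} [Fintype ι] [DecidableEq ι]
  {s : ℤˣ} (ρ : 𝔤 →ₗ⁅ℂ⁆ Matrix ι ι ℂ)

section Pair

variable (R : U 𝔤 →ₐ[ℂ] Matrix ι ι ℂ)

theorem pairEntry_eq (X : (UT 𝔤 2)⟦X⟧) (l i : ι) :
    pairEntry ρ s R.toLinearMap X l i =
      hMap (tEntrySig ρ (fun _ : Fin 1 => R) s (fun _ => l) (fun _ => i)) X := by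
  rw [pairEntry, tEntrySig]
  congr 2

@[fun_prop] theorem IsHLin.pairEntry_comp {B : Type*} [Ring B] [Algebra ℂ B] (l i : ι)
    {g : B⟦X⟧ → (UT 𝔤 2)⟦X⟧} (hg : IsHLin g) :
    IsHLin fun q => pairEntry ρ s R.toLinearMap (g q) l i := by
  simp only [pairEntry_eq]; fun_prop

theorem pairEntry_mul (X Y : (UT 𝔤 2)⟦X⟧) (l i : ι) :
    pairEntry ρ s R.toLinearMap (X * Y) l i =
      ∑ m, pairEntry ρ s R.toLinearMap X l m * pairEntry ρ s R.toLinearMap Y m i := by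
  simp only [pairEntry_eq]
  rw [hMap_tEntrySig_mul, ← (Equiv.funUnique (Fin 1) ι).symm.sum_comp]
  rfl

theorem pairEntry_C_tprod (x : Fin 2 → U 𝔤) (l i : ι) :
    pairEntry ρ s R.toLinearMap (PowerSeries.C (PiTensorProduct.tprod ℂ x)) l i =
      PowerSeries.C (algebraMap ℂ (Heis ι s) (R (x 0) l i) * sig ρ s (x 1)) := by
  rw [pairEntry_eq, hMap_C, tEntrySig_tprod]
  simp [Fin.last]

theorem tprod_two (x : Fin 2 → U 𝔤) :
    PiTensorProduct.tprod ℂ x = leg 0 (x 0) * leg 1 (x 1) := by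
  rw [tprod_eq_prod_leg]; simp [List.ofFn_succ]

theorem leg_mul_leg (x y : U 𝔤) :
    (leg 0 x * leg 1 y : UT 𝔤 2) = PiTensorProduct.tprod ℂ ![x, y] := by
  rw [tprod_two]; rfl

theorem pairEntry_leg_leg (x y : U 𝔤) (l i : ι) :
    pairEntry ρ s R.toLinearMap (PowerSeries.C (leg 0 x * leg 1 y)) l i =
      PowerSeries.C (algebraMap ℂ (Heis ι s) (R x l i) * sig ρ s y) := by
  rw [leg_mul_leg, pairEntry_C_tprod]; rfl

theorem pairEntry_leg_one (y : U 𝔤) (l i : ι) :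
    pairEntry ρ s R.toLinearMap (PowerSeries.C (leg 1 y)) l i =
      if l = i then PowerSeries.C (sig ρ s y) else 0 := by
  have := pairEntry_leg_leg ρ (s := s) R 1 y l i
  rw [map_one, one_mul] at this
  rw [this, map_one, Matrix.one_apply]
  split_ifs <;> simp

theorem pairEntry_leg_zero (x : U 𝔤) (l i : ι) :
    pairEntry ρ s R.toLinearMap (PowerSeries.C (leg 0 x)) l i =
      PowerSeries.C (algebraMap ℂ (Heis ι s) (R x l i)) := by
  have := pairEntry_leg_leg ρ (s := s) R x 1 l i
  rwa [map_one, mul_one, map_one, mul_one] at this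

theorem pairEntry_one (l i : ι) :
    pairEntry ρ s R.toLinearMap 1 l i = if l = i then 1 else 0 := by
  have := pairEntry_leg_one ρ (s := s) R 1 l i
  simpa using this

theorem pairEntry_hLeg_one (y : (U 𝔤)⟦X⟧) (l i : ι) :
    pairEntry ρ s R.toLinearMap (hLeg 1 y) l i = if l = i then hSig ρ s y else 0 := by
  split_ifs with h
  · refine IsHLin.ext (f := fun y => pairEntry ρ s R.toLinearMap (hLeg 1 y) l i)
      (g := fun y => hSig ρ s y) (by fun_prop) (by unfold hSig; fun_prop) (fun y => ?_) y
    rw [hLeg_C, pairEntry_leg_one, if_pos h, hSig, hMap_C]; rfl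
  · refine IsHLin.ext (f := fun y => pairEntry ρ s R.toLinearMap (hLeg 1 y) l i)
      (g := fun y => 0 * hSig ρ s y) (by fun_prop) (by unfold hSig; fun_prop) (fun y => ?_) y |>.trans
        (zero_mul _)
    rw [hLeg_C, pairEntry_leg_one, if_neg h, zero_mul]

/-- A tuple `α` in `𝓐_±[[h]]` transforms under `𝔤` in the representation `R`:
`σ(x) α_i = α_j [(R ⊗ σ)(Δ x)]^j_i`. -/
def IsCovariant (α : ι → (Heis ι s)⟦X⟧) : Prop :=
  ∀ (x : U 𝔤) (i : ι), PowerSeries.C (sig ρ s x) * α i =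
    ∑ j, α j * pairEntry ρ s R.toLinearMap (PowerSeries.C (copOn Finset.univ x)) j i

variable {ρ R}

theorem copOn_two (x : 𝔤) : (copOn Finset.univ (UniversalEnvelopingAlgebra.ι ℂ x) : UT 𝔤 2) =
    leg 0 (UniversalEnvelopingAlgebra.ι ℂ x) + leg 1 (UniversalEnvelopingAlgebra.ι ℂ x) := by
  rw [copOn_ι, Fin.sum_univ_two]

theorem pairEntry_add (X Y : (UT 𝔤 2)⟦X⟧) (l i : ι) :
    pairEntry ρ s R.toLinearMap (X + Y) l i =
      pairEntry ρ s R.toLinearMap X l i + pairEntry ρ s R.toLinearMap Y l i := by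
  simp only [pairEntry_eq, map_add]

theorem sum_mul_pairEntry_copOn_ι (α : ι → (Heis ι s)⟦X⟧) (x : 𝔤) (i : ι) :
    ∑ j, α j * pairEntry ρ s R.toLinearMap
        (PowerSeries.C (copOn Finset.univ (UniversalEnvelopingAlgebra.ι ℂ x))) j i =
      (∑ j, R (UniversalEnvelopingAlgebra.ι ℂ x) j i • α j) +
        α i * PowerSeries.C (sig ρ s (UniversalEnvelopingAlgebra.ι ℂ x)) := by
  simp only [copOn_two, map_add, pairEntry_add, pairEntry_leg_zero, pairEntry_leg_one, mul_add,
    Finset.sum_add_distrib]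
  congr 1
  · refine Finset.sum_congr rfl fun j _ => ?_
    rw [Algebra.algebraMap_eq_smul_one, C_smul, map_one, mul_smul_comm, mul_one]
  · simp

theorem sum_pairEntry_copOn_ι_mul (α : ι → (Heis ι s)⟦X⟧) (x : 𝔤) (i : ι) :
    ∑ j, pairEntry ρ s R.toLinearMap
        (PowerSeries.C (copOn Finset.univ (UniversalEnvelopingAlgebra.ι ℂ x))) i j * α j =
      (∑ j, R (UniversalEnvelopingAlgebra.ι ℂ x) i j • α j) +
        PowerSeries.C (sig ρ s (UniversalEnvelopingAlgebra.ι ℂ x)) * α i := by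
  simp only [copOn_two, map_add, pairEntry_add, pairEntry_leg_zero, pairEntry_leg_one, add_mul,
    Finset.sum_add_distrib]
  congr 1
  · refine Finset.sum_congr rfl fun j _ => ?_
    rw [Algebra.algebraMap_eq_smul_one, C_smul, map_one, smul_mul_assoc, one_mul]
  · simp

/-- Covariance need only be checked on `𝔤`. -/
theorem IsCovariant.of_ι {α : ι → (Heis ι s)⟦X⟧}
    (h : ∀ (x : 𝔤) (i : ι), PowerSeries.C (sig ρ s (UniversalEnvelopingAlgebra.ι ℂ x)) * α i =
      (∑ j, R (UniversalEnvelopingAlgebra.ι ℂ x) j i • α j) +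
        α i * PowerSeries.C (sig ρ s (UniversalEnvelopingAlgebra.ι ℂ x))) :
    IsCovariant ρ R α := by
  intro x
  induction x using U_induction with
  | hι x => intro i; rw [sum_mul_pairEntry_copOn_ι, h]
  | hC c =>
    intro i
    rw [AlgHom.commutes, AlgHom.commutes, Algebra.algebraMap_eq_smul_one,
      Algebra.algebraMap_eq_smul_one, C_smul, C_smul, map_one, map_one]
    simp only [pairEntry_eq, map_smul]
    simp only [← pairEntry_eq, pairEntry_one]
    simp
  | hadd x y hx hy =>
    intro i
    simp only [map_add, add_mul, hx, hy, pairEntry_add, mul_add, Finset.sum_add_distrib]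
  | hmul x y hx hy =>
    intro i
    simp only [map_mul, pairEntry_mul]
    rw [mul_assoc, hy, Finset.mul_sum]
    simp only [← mul_assoc, hx, Finset.sum_mul, Finset.mul_sum]
    rw [Finset.sum_comm]

/-- The left-handed form `α_i σ(x) = [(R ⊗ σ)(Δ x)]^i_j α_j` of covariance need only be checked on
`𝔤`. -/
theorem left_covariant_of_ι {α : ι → (Heis ι s)⟦X⟧}
    (h : ∀ (x : 𝔤) (i : ι), α i * PowerSeries.C (sig ρ s (UniversalEnvelopingAlgebra.ι ℂ x)) =
      (∑ j, R (UniversalEnvelopingAlgebra.ι ℂ x) i j • α j) +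
        PowerSeries.C (sig ρ s (UniversalEnvelopingAlgebra.ι ℂ x)) * α i) (x : U 𝔤) (i : ι) :
    α i * PowerSeries.C (sig ρ s x) =
      ∑ j, pairEntry ρ s R.toLinearMap (PowerSeries.C (copOn Finset.univ x)) i j * α j := by
  induction x using U_induction generalizing i with
  | hι x => rw [sum_pairEntry_copOn_ι_mul, h]
  | hC c =>
    rw [AlgHom.commutes, AlgHom.commutes, Algebra.algebraMap_eq_smul_one,
      Algebra.algebraMap_eq_smul_one, C_smul, C_smul, map_one, map_one]
    simp only [pairEntry_eq, map_smul]
    simp only [← pairEntry_eq, pairEntry_one]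
    simp
  | hadd x y hx hy =>
    simp only [map_add, mul_add, hx, hy, pairEntry_add, add_mul, Finset.sum_add_distrib]
  | hmul x y hx hy =>
    simp only [map_mul, pairEntry_mul]
    rw [← mul_assoc, hx, Finset.sum_mul]
    simp only [mul_assoc, hy, Finset.sum_mul, Finset.mul_sum]
    rw [Finset.sum_comm]

theorem IsCovariant.ι_mul {α : ι → (Heis ι s)⟦X⟧} (h : IsCovariant ρ R α) (x : 𝔤) (i : ι) :
    PowerSeries.C (sig ρ s (UniversalEnvelopingAlgebra.ι ℂ x)) * α i =
      (∑ j, R (UniversalEnvelopingAlgebra.ι ℂ x) j i • α j) +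
        α i * PowerSeries.C (sig ρ s (UniversalEnvelopingAlgebra.ι ℂ x)) := by
  rw [h, sum_mul_pairEntry_copOn_ι]

/-- Contraction of a covariant tuple with an invariant element of `U𝔤^{⊗ 2}[[h]]`. -/
theorem IsCovariant.contract {α : ι → (Heis ι s)⟦X⟧} (h : IsCovariant ρ R α) {Y : (UT 𝔤 2)⟦X⟧}
    (hY : ∀ x : U 𝔤, Commute Y (PowerSeries.C (copOn Finset.univ x))) :
    IsCovariant ρ R fun i => ∑ l, α l * pairEntry ρ s R.toLinearMap Y l i := by
  intro x i
  rw [Finset.mul_sum]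
  simp only [← mul_assoc, h x, Finset.sum_mul]
  rw [Finset.sum_comm, Finset.sum_comm (s := (Finset.univ : Finset ι)) (t := Finset.univ)
    (f := fun j l => α l * pairEntry ρ s R.toLinearMap Y l j * _)]
  refine Finset.sum_congr rfl fun l _ => ?_
  simp only [mul_assoc, ← Finset.mul_sum]
  rw [← pairEntry_mul, ← pairEntry_mul, (hY x).eq]

end Pair

section Letters

/-- The ordered product of the letters `α⁽⁰⁾_{K 0} α⁽¹⁾_{K 1} ⋯`. -/
def letterProd {n : ℕ} (α : Fin n → ι → (Heis ι s)⟦X⟧) (K : Fin n → ι) : (Heis ι s)⟦X⟧ :=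
  (List.ofFn fun t => α t (K t)).prod

omit [Fintype ι] in
theorem letterProd_cons {n : ℕ} (α : Fin (n + 1) → ι → (Heis ι s)⟦X⟧) (l : ι) (L : Fin n → ι) :
    letterProd α (Fin.cons l L) = α 0 l * letterProd (fun i => α i.succ) L := by
  simp [letterProd, List.ofFn_succ]

variable {ρ}

/-- Moving `[(R ⊗ σ)(Z)]` to the right of a covariant monomial spreads the second factor of `Z`
by the coproduct. -/
theorem pairEntry_mul_letterProd {n : ℕ} (R : Fin (n + 1) → (U 𝔤 →ₐ[ℂ] Matrix ι ι ℂ))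
    {α : Fin n → ι → (Heis ι s)⟦X⟧}
    (h : ∀ (x : U 𝔤) (L : Fin n → ι), PowerSeries.C (sig ρ s x) * letterProd α L =
      ∑ L', letterProd α L' * hMap (tEntrySig ρ (fun i => R i.succ) s L' L)
        (PowerSeries.C (copOn Finset.univ x)))
    (Z : (UT 𝔤 2)⟦X⟧) (l k : ι) (L : Fin n → ι) :
    pairEntry ρ s (R 0).toLinearMap Z l k * letterProd α L =
      ∑ L', letterProd α L' * hMap (tEntrySig ρ R s (Fin.cons l L') (Fin.cons k L))
        (legs ![{0}, Finset.Ioi 0] Z) := by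
  refine IsHLin.ext_tprod (f := fun Z => pairEntry ρ s (R 0).toLinearMap Z l k * letterProd α L)
    (g := fun Z => ∑ L', letterProd α L' * hMap (tEntrySig ρ R s (Fin.cons l L') (Fin.cons k L))
        (legs ![{0}, Finset.Ioi 0] Z)) (by fun_prop) (by fun_prop) (fun z => ?_) Z
  rw [pairEntry_C_tprod, legs_zero_Ioi_C_tprod]
  simp only [hMap_tEntrySig_cons]
  rw [map_mul, ← hScalar_C, mul_assoc, h, Finset.mul_sum]
  refine Finset.sum_congr rfl fun L' _ => ?_
  rw [← mul_assoc, ← mul_assoc, (hScalar_commute _ _).eq, hMap_C (repEntry _ _ _)]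
  rfl

/-- A monomial in covariant letters is covariant. -/
theorem sig_mul_letterProd {n : ℕ} (R : Fin n → (U 𝔤 →ₐ[ℂ] Matrix ι ι ℂ))
    {α : Fin n → ι → (Heis ι s)⟦X⟧} (h : ∀ t, IsCovariant ρ (R t) (α t)) (x : U 𝔤)
    (L : Fin n → ι) :
    PowerSeries.C (sig ρ s x) * letterProd α L =
      ∑ L', letterProd α L' * hMap (tEntrySig ρ R s L' L) (PowerSeries.C (copOn Finset.univ x)) := by
  induction n generalizing x with
  | zero =>
    have : (Finset.univ : Finset (Fin (0 + 1))) = {0} := by decide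
    rw [this, copOn_singleton, leg_eq_tprod]
    simp [letterProd, -Fin.isValue, Fin.last]
  | succ n ih =>
    have ih' := ih (fun i => R i.succ) (fun t => h t.succ)
    rw [← Fin.cons_self_tail L, letterProd_cons, ← mul_assoc, h 0, Finset.sum_mul, sum_cons]
    refine Finset.sum_congr rfl fun l _ => ?_
    rw [mul_assoc, pairEntry_mul_letterProd R ih', Finset.mul_sum]
    refine Finset.sum_congr rfl fun L' _ => ?_
    rw [letterProd_cons, ← mul_assoc, legs_C_copOn _ (disjoint_pair (by simp)), biUnion_univ_pair,
      singleton_union_Ioi]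

/-- The element of `U𝔤^{⊗ (n+1)}[[h]]` that collects the twists of a product of `n` deformed
generators, where the `t`-th generator carries an extra factor `m t`. -/
def twistCollect (G : (UT 𝔤 2)⟦X⟧) : (n : ℕ) → (Fin n → (U 𝔤)⟦X⟧) → (UT 𝔤 (n + 1))⟦X⟧
  | 0, _ => 1
  | n + 1, m => legs ![{0}, Finset.Ioi 0] G * hLeg 0 (m 0) *
      shift (twistCollect G n fun i => m i.succ)

/-- A monomial in deformed generators is a contraction of the monomial in the undeformed ones. -/
theorem letterProd_deformed (G : (UT 𝔤 2)⟦X⟧) {n : ℕ} (R : Fin n → (U 𝔤 →ₐ[ℂ] Matrix ι ι ℂ))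
    {α : Fin n → ι → (Heis ι s)⟦X⟧} (h : ∀ t, IsCovariant ρ (R t) (α t))
    (m : Fin n → (U 𝔤)⟦X⟧) (K : Fin n → ι) :
    letterProd (fun t i => ∑ l, α t l * pairEntry ρ s (R t).toLinearMap (G * hLeg 0 (m t)) l i) K =
      ∑ L, letterProd α L * hMap (tEntrySig ρ R s L K) (twistCollect G n m) := by
  induction n with
  | zero =>
    have : twistCollect G 0 m = PowerSeries.C (PiTensorProduct.tprod ℂ 1) := by
      rw [twistCollect, ← PiTensorProduct.one_def, map_one]
    rw [this]
    simp [letterProd]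
  | succ n ih =>
    rw [← Fin.cons_self_tail K, letterProd_cons,
      ih (fun i => R i.succ) (fun t => h t.succ) (fun i => m i.succ), Finset.sum_mul, sum_cons]
    refine Finset.sum_congr rfl fun l _ => ?_
    rw [mul_assoc, Finset.mul_sum]
    have e : legs ![{0}, Finset.Ioi 0] (G * hLeg 0 (m 0)) =
        (legs ![{0}, Finset.Ioi 0] G * hLeg 0 (m 0) : (UT 𝔤 (n + 2))⟦X⟧) := by
      rw [legs_mul _ (disjoint_pair (by simp)), legs_hLeg _ (disjoint_pair (by simp)), hLeg]
      congr 3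
      ext x
      exact copOn_singleton _ _
    -- The second factor only involves the letters after the first one, so that its matrix
    -- elements are diagonal in the index of the first letter.
    have key : ∀ L'' : Fin n → ι,
        hMap (tEntrySig ρ R s (Fin.cons l L'') (Fin.cons (K 0) (Fin.tail K)))
          (twistCollect G (n + 1) m) =
        ∑ L', hMap (tEntrySig ρ R s (Fin.cons l L'') (Fin.cons (K 0) L'))
            (legs ![{0}, Finset.Ioi 0] (G * hLeg 0 (m 0))) *
          hMap (tEntrySig ρ (fun i => R i.succ) s L' (Fin.tail K))
            (twistCollect G n fun i => m i.succ) := by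
      intro L''
      rw [twistCollect, ← e, hMap_tEntrySig_mul, sum_cons, Finset.sum_eq_single (K 0)]
      · refine Finset.sum_congr rfl fun L' _ => ?_
        have := hMap_tEntrySig_cons ρ (s := s) R (K 0) (K 0) L' (Fin.tail K) 1
          (twistCollect G n fun i => m i.succ)
        rw [hLeg_one, one_mul] at this
        rw [this, ← map_one PowerSeries.C, hMap_C, repEntry_apply, map_one, Matrix.one_apply_eq]
        simp
      · intro l' _ hl'
        refine Finset.sum_eq_zero fun L' _ => ?_
        have := hMap_tEntrySig_cons ρ (s := s) R l' (K 0) L' (Fin.tail K) 1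
          (twistCollect G n fun i => m i.succ)
        rw [hLeg_one, one_mul] at this
        rw [this, ← map_one PowerSeries.C, hMap_C, repEntry_apply, map_one, Matrix.one_apply_ne hl',
          hScalar_C, map_zero, map_zero, zero_mul, mul_zero]
      · simp
    have p := pairEntry_mul_letterProd R (sig_mul_letterProd _ fun t => h t.succ)
      (G * hLeg 0 (m 0)) l (K 0)
    simp only [letterProd_cons, key, Finset.mul_sum]
    conv_rhs => rw [Finset.sum_comm]
    refine Finset.sum_congr rfl fun L' _ => ?_
    rw [← mul_assoc (pairEntry ρ s _ _ _ _), p, Finset.sum_mul, Finset.mul_sum]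
    simp only [mul_assoc]

end Letters

end Covariance

/-! ### Invariant tensors and the collection of twists -/

section Invariants

variable {𝔤 : Type*} [LieRing 𝔤] [LieAlgebra ℂ 𝔤] {ι : Type*} [Fintype ι] [DecidableEq ι]
  {s : ℤˣ} {ρ : 𝔤 →ₗ⁅ℂ⁆ Matrix ι ι ℂ} {n : ℕ}

/-- The action of `U𝔤^{⊗ n}[[h]]` on tensors with `n` indices. -/
def tAct (R : Fin n → (U 𝔤 →ₐ[ℂ] Matrix ι ι ℂ)) (X : (UT 𝔤 n)⟦X⟧) (d : (Fin n → ι) → ℂ⟦X⟧)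
    (K : Fin n → ι) : ℂ⟦X⟧ :=
  ∑ K', hMap (tEntry R K K') X * d K'

section Act

variable (R : Fin n → (U 𝔤 →ₐ[ℂ] Matrix ι ι ℂ))

theorem tAct_mul (X Y : (UT 𝔤 n)⟦X⟧) (d : (Fin n → ι) → ℂ⟦X⟧) :
    tAct R (X * Y) d = tAct R X (tAct R Y d) := by
  funext K
  simp only [tAct, hMap_tEntry_mul, Finset.sum_mul, Finset.mul_sum, mul_assoc]
  rw [Finset.sum_comm]

@[simp] theorem tAct_one (d : (Fin n → ι) → ℂ⟦X⟧) : tAct R 1 d = d := by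
  funext K
  simp [tAct, hMap_tEntry_one]

theorem tAct_mul_left (X : (UT 𝔤 n)⟦X⟧) (c : ℂ⟦X⟧) (d : (Fin n → ι) → ℂ⟦X⟧) :
    tAct R X (fun K => c * d K) = fun K => c * tAct R X d K := by
  funext K
  simp only [tAct, Finset.mul_sum, mul_left_comm]

/-- Invariance of a tensor under the iterated coproduct. -/
def TensorInvariant (d : (Fin n → ι) → ℂ⟦X⟧) : Prop :=
  ∀ x : (U 𝔤)⟦X⟧, tAct R (hMap (copOn Finset.univ).toLinearMap x) d =
    fun K => hMap (counit 𝔤).toLinearMap x * d K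

/-- Conjugation by an invertible `P` maps the tensors that are invariant under `Δ` bijectively to
the tensors that are invariant under `P Δ P⁻¹`. -/
theorem bijOn_tAct (P : ((UT 𝔤 n)⟦X⟧)ˣ) :
    Set.BijOn (tAct R P) {d | TensorInvariant R d}
      {D | ∀ x : (U 𝔤)⟦X⟧,
        tAct R ((P : (UT 𝔤 n)⟦X⟧) * hMap (copOn Finset.univ).toLinearMap x * (↑P⁻¹ : (UT 𝔤 n)⟦X⟧)) D =
        fun K => hMap (counit 𝔤).toLinearMap x * D K} := by
  have h1 : ∀ d, tAct R ↑P⁻¹ (tAct R P d) = d := fun d => by rw [← tAct_mul]; simp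
  have h2 : ∀ d, tAct R P (tAct R ↑P⁻¹ d) = d := fun d => by rw [← tAct_mul]; simp
  refine ⟨fun d hd x => ?_, fun d _ d' _ e => ?_, fun D hD => ⟨tAct R ↑P⁻¹ D, fun x => ?_, h2 D⟩⟩
  · rw [tAct_mul, h1, tAct_mul, hd x, tAct_mul_left]
  · rw [← h1 d, e, h1]
  · have := congrArg (tAct R ↑P⁻¹) (hD x)
    rw [tAct_mul, tAct_mul, h1, tAct_mul_left] at this
    exact this

end Act

section Contract

variable {R : Fin n → (U 𝔤 →ₐ[ℂ] Matrix ι ι ℂ)}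

/-- In `Z_{1…n,n+1}` the first factor acts trivially on an invariant tensor. -/
theorem sum_legs_Iio_last {d : (Fin n → ι) → ℂ⟦X⟧} (hd : TensorInvariant R d) (Z : (UT 𝔤 2)⟦X⟧)
    (L : Fin n → ι) :
    ∑ K, hMap (tEntrySig ρ R s L K) (legs ![Finset.Iio (Fin.last n), {Fin.last n}] Z) *
        hScalar (Heis ι s) (d K) =
      hSig ρ s (hMap (evalLegs ![Algebra.linearMap ℂ (U 𝔤) ∘ₗ (counit 𝔤).toLinearMap,
        LinearMap.id]) Z) * hScalar (Heis ι s) (d L) := by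
  refine IsHLin.ext_tprod
    (f := fun Z => ∑ K, hMap (tEntrySig ρ R s L K)
      (legs ![Finset.Iio (Fin.last n), {Fin.last n}] Z) * hScalar (Heis ι s) (d K))
    (g := fun Z => hSig ρ s (hMap (evalLegs ![Algebra.linearMap ℂ (U 𝔤) ∘ₗ (counit 𝔤).toLinearMap,
        LinearMap.id]) Z) * hScalar (Heis ι s) (d L)) (by fun_prop) (by unfold hSig; fun_prop)
    (fun z => ?_) Z
  have e : legs ![Finset.Iio (Fin.last n), {Fin.last n}] (PowerSeries.C (PiTensorProduct.tprod ℂ z))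
      = (hLeg (Fin.last n) (PowerSeries.C (z 1)) * extend (PowerSeries.C (copOn Finset.univ (z 0))) :
        (UT 𝔤 (n + 1))⟦X⟧) := by
    rw [legs_C_tprod, extend, PowerSeries.map_C, hLeg_C, ← map_mul]
    have := legsHom_copOn (𝔤 := 𝔤) _ (disjoint_singletons (Fin.castSucc_injective n))
      Finset.univ (z 0)
    rw [image_castSucc_eq, image_castSucc_univ] at this
    have h2 := commute_leg_copOn (i := Fin.last n) (s := Finset.Iio (Fin.last n)) (by simp)
      (z 1) (z 0)
    simp only [AlgHom.toRingHom_eq_coe, RingHom.coe_coe, this, h2.eq]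
    simp only [List.ofFn_succ, List.ofFn_zero, List.prod_cons, List.prod_nil, mul_one,
      Matrix.cons_val_zero, Matrix.cons_val_succ, copOn_singleton, Fin.succ_zero_eq_one]
  have hlast : ∀ K, hMap (tEntrySig ρ R s L K) (hLeg (Fin.last n) (PowerSeries.C (z 1))) =
      if L = K then PowerSeries.C (sig ρ s (z 1)) else 0 := by
    intro K
    rw [hLeg_C, hMap_C, leg_eq_tprod, tEntrySig_tprod, Pi.mulSingle_eq_same]
    have : ∀ i : Fin n, Pi.mulSingle (M := fun _ => U 𝔤) (Fin.last n) (z 1) i.castSucc = 1 :=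
      fun i => Pi.mulSingle_eq_of_ne (Fin.castSucc_lt_last i).ne _
    simp only [this]
    have h1 := hMap_tEntry_one R L K
    rw [← map_one PowerSeries.C, hMap_C, PiTensorProduct.one_def, tEntry_tprod] at h1
    simp only [Pi.one_apply] at h1
    have h2 := congrArg PowerSeries.constantCoeff h1
    rw [PowerSeries.constantCoeff_C] at h2
    rw [h2]
    split_ifs <;> simp
  rw [e]
  simp only [hMap_tEntrySig_mul, hlast, hMap_tEntrySig_extend, ite_mul, zero_mul,
    Finset.sum_ite_eq, Finset.mem_univ, if_true, mul_assoc, ← hScalar_mul]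
  rw [← Finset.mul_sum, ← hScalar_sum]
  have h := congrFun (hd (PowerSeries.C (z 0))) L
  rw [tAct, hMap_C] at h
  simp only [AlgHom.toLinearMap_apply] at h
  rw [h, hMap_C, hSig, hMap_C, hMap_C, hScalar_mul, ← mul_assoc, hScalar_C, ← map_mul, evalLegs_tprod]
  congr 2
  simp only [List.ofFn_succ, List.ofFn_zero, List.prod_cons, List.prod_nil, mul_one,
      Matrix.cons_val_zero, Matrix.cons_val_succ, Fin.succ_zero_eq_one]
  simp [Algebra.commutes]

/-- The normalization `(ε ⊗ id)Z = 1`, read in `U𝔤[[h]]` instead of its first tensor power. -/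
theorem counit_left_apply {Z : (UT 𝔤 2)⟦X⟧} (hZ : legs ![∅, {0}] Z = (1 : (UT 𝔤 1)⟦X⟧)) :
    hMap (evalLegs ![Algebra.linearMap ℂ (U 𝔤) ∘ₗ (counit 𝔤).toLinearMap,
        LinearMap.id]) Z = 1 := by
  have h := congrArg (hMap (evalLegs fun _ : Fin 1 => (LinearMap.id : U 𝔤 →ₗ[ℂ] U 𝔤))) hZ
  rw [← map_one PowerSeries.C, hMap_C, PiTensorProduct.one_def, evalLegs_tprod] at h
  simp only [Pi.one_apply, LinearMap.id_apply, List.ofFn_const, List.replicate_one,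
    List.prod_singleton, map_one] at h
  rw [← h]
  refine IsHLin.ext_tprod (f := fun F => hMap (evalLegs ![Algebra.linearMap ℂ (U 𝔤) ∘ₗ
      (counit 𝔤).toLinearMap, LinearMap.id]) F)
    (g := fun F => hMap (evalLegs fun _ : Fin 1 => (LinearMap.id : U 𝔤 →ₗ[ℂ] U 𝔤))
      (legs ![∅, {0}] F)) (by fun_prop) (by fun_prop) (fun x => ?_) _
  rw [legs_C_tprod, hMap_C, hMap_C, evalLegs_tprod]
  simp only [List.ofFn_succ, List.ofFn_zero, List.prod_cons, List.prod_nil, mul_one,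
      Matrix.cons_val_zero, Matrix.cons_val_succ, Fin.succ_zero_eq_one, copOn_empty,
      copOn_singleton, Algebra.algebraMap_eq_smul_one, smul_mul_assoc, one_mul, map_smul,
      leg_eq_tprod, evalLegs_tprod]
  simp [Algebra.smul_def]

/-- The collected twists are inverse to the iterated twist, up to the extra factors: the twists of
a product of deformed generators undo `𝓕_{12…(n+1)}`. -/
theorem twistCollect_spec (F : ((UT 𝔤 2)⟦X⟧)ˣ) (n : ℕ) (m : Fin n → (U 𝔤)⟦X⟧) (hF : IsTwist F) :
    twMulti F (n + 1) * twistCollect (↑F⁻¹ : (UT 𝔤 2)⟦X⟧) n m =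
      extend (List.ofFn fun t => hLeg t (m t)).prod := by
  induction n with
  | zero =>
    rw [twMulti_succ, twMulti_zero, twistCollect, show Finset.Ioi (0 : Fin (0 + 1)) = ∅ by decide]
    rw [map_one, one_mul, mul_one]
    exact hF.counit_right.trans (by simp)
  | succ n ih =>
    have hu := legs_mul_legs_inv F (by simp : Disjoint {0} (Finset.Ioi (0 : Fin (n + 2))))
    have hc := (commute_hLeg_shift (m 0) (twMulti F (n + 1))).symm
    rw [twMulti_succ, twistCollect, mul_assoc, mul_assoc, ← mul_assoc (legs _ _), hu, one_mul,
      ← mul_assoc, hc.eq, mul_assoc, ← map_mul, ih, List.ofFn_succ, List.prod_cons, map_mul,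
      extend_hLeg, ← extend_shift, map_list_prod shift, List.map_ofFn]
    simp only [Function.comp_def, shift_hLeg, Fin.castSucc_zero]

/-- The iterated twist as a unit. -/
def twMultiUnit (F : ((UT 𝔤 2)⟦X⟧)ˣ) : (b : ℕ) → ((UT 𝔤 b)⟦X⟧)ˣ
  | 0 => 1
  | b + 1 => Units.map (shift : (UT 𝔤 b)⟦X⟧ →+* _).toMonoidHom (twMultiUnit F b) *
      legsUnit F {0} (Finset.Ioi 0) (by simp)

theorem coe_twMultiUnit (F : ((UT 𝔤 2)⟦X⟧)ˣ) (b : ℕ) :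
    (twMultiUnit F b : (UT 𝔤 b)⟦X⟧) = twMulti F b := by
  induction b with
  | zero => rw [twMulti_zero]; rfl
  | succ b ih => rw [twMulti_succ, ← ih]; rfl

/-- The invariant built from the deformed generators, expressed through the coassociator. -/
theorem sum_letterProd_deformed {F : ((UT 𝔤 2)⟦X⟧)ˣ} (hF : IsTwist F)
    {α : Fin n → ι → (Heis ι s)⟦X⟧} (h : ∀ t, IsCovariant ρ (R t) (α t))
    (m : Fin n → (U 𝔤)⟦X⟧) {M : (UT 𝔤 n)⟦X⟧}
    (hM : (List.ofFn fun t => hLeg t (m t)).prod * M = 1)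
    {d : (Fin n → ι) → ℂ⟦X⟧} (hd : TensorInvariant R d) :
    ∑ K, letterProd (fun t i => ∑ l, α t l *
        pairEntry ρ s (R t).toLinearMap ((↑F⁻¹ : (UT 𝔤 2)⟦X⟧) * hLeg 0 (m t)) l i) K *
          hScalar (Heis ι s) (tAct R (M * twMulti F n) d K) =
      ∑ L, ∑ K, letterProd α L * hMap (tEntrySig ρ R s L K)
        (coassocMulti (↑(coassocUnit F)⁻¹) n) * hScalar (Heis ι s) (d K) := by
  -- The matrix that maps `d` to the twisted tensor is absorbed into the first `n` factors.
  have h1 : ∀ (X : (UT 𝔤 (n + 1))⟦X⟧) (Y : (UT 𝔤 n)⟦X⟧) L,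
      ∑ K, hMap (tEntrySig ρ R s L K) X * hScalar (Heis ι s) (tAct R Y d K) =
      ∑ K, hMap (tEntrySig ρ R s L K) (X * extend Y) * hScalar (Heis ι s) (d K) := by
    intro X Y L
    simp only [tAct, hScalar_sum, hScalar_mul, hMap_tEntrySig_mul, hMap_tEntrySig_extend,
      Finset.mul_sum, Finset.sum_mul, mul_assoc]
    rw [Finset.sum_comm]
  -- As `d` is invariant and `(ε ⊗ id)𝓕 = 1`, a right factor `𝓕_{1…n,n+1}` can be inserted.
  have h2 : ∀ (X : (UT 𝔤 (n + 1))⟦X⟧) L,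
      ∑ K, hMap (tEntrySig ρ R s L K) X * hScalar (Heis ι s) (d K) =
      ∑ K, hMap (tEntrySig ρ R s L K)
        (X * legs ![Finset.Iio (Fin.last n), {Fin.last n}] (F : (UT 𝔤 2)⟦X⟧)) *
          hScalar (Heis ι s) (d K) := by
    intro X L
    simp only [hMap_tEntrySig_mul, Finset.sum_mul, mul_assoc]
    rw [Finset.sum_comm]
    refine Finset.sum_congr rfl fun K _ => ?_
    rw [← Finset.mul_sum, sum_legs_Iio_last hd, counit_left_apply hF.counit_left]
    simp [hSig]
  have h3 : twistCollect (↑F⁻¹ : (UT 𝔤 2)⟦X⟧) n m * extend M * twMulti F (n + 1) = 1 := by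
    have := twistCollect_spec F n m hF
    have e : (twMultiUnit F (n + 1) : (UT 𝔤 (n + 1))⟦X⟧) *
        (twistCollect (↑F⁻¹ : (UT 𝔤 2)⟦X⟧) n m * extend M) = 1 := by
      rw [coe_twMultiUnit, ← mul_assoc, this, ← map_mul, hM, map_one]
    rw [← coe_twMultiUnit, Units.eq_inv_of_mul_eq_one_left e, Units.inv_mul]
  have h4 : twistCollect (↑F⁻¹ : (UT 𝔤 2)⟦X⟧) n m * extend (M * twMulti F n) *
      legs ![Finset.Iio (Fin.last n), {Fin.last n}] (F : (UT 𝔤 2)⟦X⟧) =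
      coassocMulti (↑(coassocUnit F)⁻¹) n := by
    rw [map_mul, mul_assoc, mul_assoc, extend_twMulti_mul hF, ← mul_assoc, ← mul_assoc, h3, one_mul]
  simp only [letterProd_deformed (↑F⁻¹) R h m, Finset.sum_mul]
  rw [Finset.sum_comm]
  refine Finset.sum_congr rfl fun L _ => ?_
  simp only [mul_assoc, ← Finset.mul_sum]
  rw [h1, h2, h4]

end Contract

end Invariants

/-! ### The antipode, isotropic tensors and invariants -/

section TwistedTensors

variable {𝔤 : Type*} [LieRing 𝔤] [LieAlgebra ℂ 𝔤]

theorem hAntipode_C (x : U 𝔤) : hAntipode (PowerSeries.C x) = PowerSeries.C (antipode 𝔤 x) :=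
  hMap_C _ _

@[fun_prop] theorem IsHLin.hAntipode_comp {B : Type*} [Ring B] [Algebra ℂ B]
    {g : B⟦X⟧ → (U 𝔤)⟦X⟧} (hg : IsHLin g) : IsHLin fun q => hAntipode (g q) := by
  unfold hAntipode; fun_prop

theorem hAntipode_mul (x y : (U 𝔤)⟦X⟧) : hAntipode (x * y) = hAntipode y * hAntipode x := by
  refine IsHLin.ext (f := fun x => hAntipode (x * y)) (g := fun x => hAntipode y * hAntipode x)
    (by fun_prop) (by fun_prop) (fun x => ?_) x
  refine IsHLin.ext (f := fun y => hAntipode (PowerSeries.C x * y))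
    (g := fun y => hAntipode y * hAntipode (PowerSeries.C x))
    (by fun_prop) (by fun_prop) (fun y => ?_) y
  simp only [← map_mul, hAntipode_C, antipode_mul]

theorem hAntipode_hAntipode (x : (U 𝔤)⟦X⟧) : hAntipode (hAntipode x) = x := by
  refine IsHLin.ext (f := fun x => hAntipode (hAntipode x)) (g := fun x => x)
    (by fun_prop) (by fun_prop) (fun x => ?_) x
  simp only [hAntipode_C, antipode_antipode]

@[simp] theorem hAntipode_one : hAntipode (1 : (U 𝔤)⟦X⟧) = 1 := by
  rw [← map_one PowerSeries.C, hAntipode_C, antipode_one]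

section Gamma

variable {F : ((UT 𝔤 2)⟦X⟧)ˣ}

theorem constantCoeff_inv (hF : IsTwist F) :
    PowerSeries.constantCoeff (↑F⁻¹ : (UT 𝔤 2)⟦X⟧) = 1 := by
  have := congrArg PowerSeries.constantCoeff F.mul_inv
  rwa [map_mul, hF.const, one_mul, map_one] at this

theorem isUnit_gam (hF : IsTwist F) : IsUnit (gam F) := by
  refine isUnit_of_constantCoeff_eq_one ?_
  rw [gam, constantCoeff_hMap, constantCoeff_inv hF, PiTensorProduct.one_def, evalLegs_tprod]
  simp [List.ofFn_succ]

theorem gam_mul_gamInv (hF : IsTwist F) : gam F * gamInv F = 1 :=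
  Ring.mul_inverse_cancel _ (isUnit_gam hF)

theorem gamInv_mul_gam (hF : IsTwist F) : gamInv F * gam F = 1 :=
  Ring.inverse_mul_cancel _ (isUnit_gam hF)

theorem gam'_mul_gamInv' (hF : IsTwist F) : gam' F * gamInv' F = 1 := by
  rw [gam', gamInv', ← hAntipode_mul, gam_mul_gamInv hF, hAntipode_one]

theorem gamInv'_mul_gam' (hF : IsTwist F) : gamInv' F * gam' F = 1 := by
  rw [gam', gamInv', ← hAntipode_mul, gamInv_mul_gam hF, hAntipode_one]

/-- The iterated twisted coproduct is conjugate to the iterated coproduct. -/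
theorem twCopIter_eq (F : ((UT 𝔤 2)⟦X⟧)ˣ) (n : ℕ) (x : U 𝔤) :
    twCopIter F n x = (twMultiUnit F n : (UT 𝔤 n)⟦X⟧) * PowerSeries.C (copOn Finset.univ x) *
      (↑(twMultiUnit F n)⁻¹ : (UT 𝔤 n)⟦X⟧) := by
  induction n generalizing x with
  | zero =>
    rw [show (Finset.univ : Finset (Fin 0)) = ∅ from rfl, copOn_empty]
    simp [twCopIter, twMultiUnit]
  | succ n ih =>
    have key : ∀ Z : (UT 𝔤 2)⟦X⟧,
        hLift (evalLegs ![hConst (UT 𝔤 (n + 1)) ∘ₗ (leg 0).toLinearMap,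
          hMap (evalLegs fun j : Fin n => (leg j.succ).toLinearMap) ∘ₗ twCopIter F n]) Z =
        shift (twMultiUnit F n : (UT 𝔤 n)⟦X⟧) * legs ![{0}, Finset.Ioi 0] Z *
          shift (↑(twMultiUnit F n)⁻¹ : (UT 𝔤 n)⟦X⟧) := by
      intro Z
      refine IsHLin.ext_tprod (f := fun Z => hLift (evalLegs ![hConst (UT 𝔤 (n + 1)) ∘ₗ
          (leg 0).toLinearMap, hMap (evalLegs fun j : Fin n => (leg j.succ).toLinearMap) ∘ₗ
            twCopIter F n]) Z)
        (g := fun Z => shift (twMultiUnit F n : (UT 𝔤 n)⟦X⟧) * legs ![{0}, Finset.Ioi 0] Z *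
          shift (↑(twMultiUnit F n)⁻¹ : (UT 𝔤 n)⟦X⟧)) (by fun_prop) (by fun_prop) (fun z => ?_) Z
      have hs : ∀ P : (UT 𝔤 n)⟦X⟧,
          hMap (evalLegs fun j : Fin n => (leg j.succ).toLinearMap) P = shift P := by
        intro P
        rw [shift_eq, legs]
        congr 3
        funext j
        ext x
        exact (copOn_singleton _ _).symm
      rw [legs_zero_Ioi_C_tprod, hLift_C, evalLegs_tprod]
      simp only [List.ofFn_succ, List.ofFn_zero, List.prod_cons, List.prod_nil, mul_one,
        Matrix.cons_val_zero, Matrix.cons_val_succ, Fin.succ_zero_eq_one, LinearMap.comp_apply,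
        hs, ih, hConst_apply, AlgHom.toLinearMap_apply]
      rw [map_mul, map_mul, ← mul_assoc (shift _) (hLeg _ _), ← (commute_hLeg_shift _ _).eq, hLeg_C]
      simp only [mul_assoc]
    rw [twCopIter]
    simp only [LinearMap.comp_apply, key, LinearMap.mulRight_apply, LinearMap.mulLeft_apply,
      hConst_apply, AlgHom.toLinearMap_apply]
    rw [legs_mul _ (disjoint_pair (by simp)), legs_mul _ (disjoint_pair (by simp)),
      legs_C_copOn _ (disjoint_pair (by simp)), biUnion_univ_pair, singleton_union_Ioi]
    simp only [twMultiUnit, mul_inv_rev, Units.val_mul, mul_assoc]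
    rfl

theorem hLift_twCopIter (F : ((UT 𝔤 2)⟦X⟧)ˣ) (n : ℕ) (y : (U 𝔤)⟦X⟧) :
    hLift (twCopIter F n) y = (twMultiUnit F n : (UT 𝔤 n)⟦X⟧) *
      hMap (copOn Finset.univ).toLinearMap y * (↑(twMultiUnit F n)⁻¹ : (UT 𝔤 n)⟦X⟧) := by
  refine IsHLin.ext (f := fun y => hLift (twCopIter F n) y) (g := fun y =>
    (twMultiUnit F n : (UT 𝔤 n)⟦X⟧) * hMap (copOn Finset.univ).toLinearMap y *
      (↑(twMultiUnit F n)⁻¹ : (UT 𝔤 n)⟦X⟧)) (by fun_prop) (by fun_prop) (fun x => ?_) y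
  rw [hLift_C, twCopIter_eq, hMap_C]
  rfl

end Gamma

variable {ι : Type*} [Fintype ι] [DecidableEq ι] {s : ℤˣ} (ρ : 𝔤 →ₗ⁅ℂ⁆ Matrix ι ι ℂ)

/-- Matrix elements of a product of elements in different factors. -/
theorem hMap_tEntry_prod_hLeg {n : ℕ} (R : Fin n → (U 𝔤 →ₐ[ℂ] Matrix ι ι ℂ)) (K K' : Fin n → ι)
    (a : Fin n → (U 𝔤)⟦X⟧) :
    hMap (tEntry R K K') (List.ofFn fun t => hLeg t (a t)).prod =
      ∏ t, hMap (repEntry (R t) (K t) (K' t)) (a t) := by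
  induction n with
  | zero =>
    rw [List.ofFn_zero, List.prod_nil, hMap_tEntry_one, if_pos (Subsingleton.elim _ _)]
    simp
  | succ n ih =>
    have := hMap_tEntry_cons R (K 0) (K' 0) (Fin.tail K) (Fin.tail K') (a 0)
      (List.ofFn fun t : Fin n => hLeg t (a t.succ)).prod
    rw [Fin.cons_self_tail, Fin.cons_self_tail, map_list_prod, List.map_ofFn, ih] at this
    simp only [Function.comp_def, shift_hLeg] at this
    rw [List.ofFn_succ, List.prod_cons, this, Fin.prod_univ_succ]
    rfl

/-- The families of elements `1, …, 1, g, …, g` with `k` entries `1` and `h` entries `g`. -/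
def mixedFamily (k h : ℕ) (g : (U 𝔤)⟦X⟧) : Fin (k + h) → (U 𝔤)⟦X⟧ :=
  Fin.addCases (fun _ => 1) (fun _ => g)

theorem ofFn_mixedFamily (k h : ℕ) (g : (U 𝔤)⟦X⟧) :
    (List.ofFn fun t => hLeg t (mixedFamily k h g t)).prod =
      (List.ofFn fun j : Fin h => hLeg (Fin.natAdd k j) g).prod := by
  have hc : ∀ i : Fin k, Fin.castLE (Nat.le_add_right k h) i = Fin.castAdd h i := fun _ => rfl
  rw [List.ofFn_add, List.prod_append]
  simp [mixedFamily, hc]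

theorem ofFn_mixedFamily_mul (k h : ℕ) {g g' : (U 𝔤)⟦X⟧} (hg : g * g' = 1) :
    (List.ofFn fun t => hLeg t (mixedFamily k h g t)).prod *
      (List.ofFn fun t => hLeg t (mixedFamily k h g' t)).prod = 1 := by
  rw [← prod_ofFn_mul _ _ fun i j hij => commute_hLeg hij _ _]
  have : ∀ t, hLeg t (mixedFamily k h g t) * hLeg t (mixedFamily k h g' t) = 1 := by
    intro t
    rw [← hLeg_mul]
    refine Fin.addCases (fun i => ?_) (fun i => ?_) t <;> simp [mixedFamily, hg]
  simp [this]

theorem hMap_repEntry_dual (i j : ι) (Z : (U 𝔤)⟦X⟧) :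
    hMap (repEntry (repDualHom ρ) i j) Z =
      hMap (Matrix.entryLinearMap ℂ ℂ j i ∘ₗ rep ρ) (hAntipode Z) := by
  rw [hAntipode, hMap_hMap]
  rfl

/-- The matrix elements of `ρ_h^{⊗ k} ⊗ ρ_h^∨^{⊗ h}` are conjugate to those of
`ρ^{⊗ k} ⊗ ρ^∨^{⊗ h}`. -/
theorem twEntry_eq {F : ((UT 𝔤 2)⟦X⟧)ˣ} (k h : ℕ) (K K' : Fin (k + h) → ι)
    (Y : (UT 𝔤 (k + h))⟦X⟧) :
    twEntry ρ F k h K K' Y = hMap (tEntry (mixedHom ρ k h) K K')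
      ((List.ofFn fun t => hLeg t (mixedFamily k h (gamInv' F) t)).prod * Y *
        (List.ofFn fun t => hLeg t (mixedFamily k h (gam' F) t)).prod) := by
  rw [twEntry]
  refine IsHLin.ext_tprod (f := fun Y => hLift _ Y) (g := fun Y => hMap _ (_ * Y * _))
    (by fun_prop) (by fun_prop) (fun y => ?_) Y
  have e : (List.ofFn fun t => hLeg t (mixedFamily k h (gamInv' F) t)).prod *
      PowerSeries.C (PiTensorProduct.tprod ℂ y) *
        (List.ofFn fun t => hLeg t (mixedFamily k h (gam' F) t)).prod =
      (List.ofFn fun t => hLeg t (mixedFamily k h (gamInv' F) t * PowerSeries.C (y t) *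
        mixedFamily k h (gam' F) t)).prod := by
    rw [tprod_eq_prod_leg, map_list_prod, List.map_ofFn]
    simp only [Function.comp_def, ← hLeg_C]
    rw [← prod_ofFn_mul _ _ fun i j hij => commute_hLeg hij _ _,
      ← prod_ofFn_mul]
    · simp only [hLeg_mul]
    · intro i j hij
      rw [← hLeg_mul]
      exact commute_hLeg hij _ _
  rw [e, hMap_tEntry_prod_hLeg, hLift_C, evalLegs_tprod, List.prod_ofFn]
  refine Finset.prod_congr rfl fun t _ => ?_
  refine Fin.addCases (fun i => ?_) (fun i => ?_) t
  · simp only [Fin.addCases_left, mixedFamily, mixedHom, one_mul, mul_one, hMap_C]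
    simp only [LinearMap.comp_apply, hConst_apply]
    rfl
  · simp only [Fin.addCases_right, mixedFamily, mixedHom, hMap_repEntry_dual, hAntipode_mul,
      gamInv', gam', hAntipode_hAntipode, hAntipode_C, twAntipode, LinearMap.comp_apply,
      LinearMap.mulRight_apply, LinearMap.mulLeft_apply, hConst_apply, mul_assoc]

theorem isIsotropic_iff (k h : ℕ) (d : (Fin (k + h) → ι) → ℂ⟦X⟧) :
    IsIsotropic ρ k h d ↔ TensorInvariant (mixedHom ρ k h) d := by
  rw [IsIsotropic, TensorInvariant]
  simp only [funext_iff, mixedRep_eq]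
  rfl

theorem twTensor_eq (F : ((UT 𝔤 2)⟦X⟧)ˣ) (k h : ℕ) (d : (Fin (k + h) → ι) → ℂ⟦X⟧) :
    twTensor ρ F k h d = tAct (mixedHom ρ k h)
      ((List.ofFn fun t => hLeg t (mixedFamily k h (gamInv' F) t)).prod * twMulti F (k + h)) d := by
  funext K
  rw [twTensor, tAct, ofFn_mixedFamily, mixedRep_eq]
  rfl

/-- The map `d ↦ D` is the action of an invertible element that conjugates the classical action of
`U𝔤` on tensors into the twisted one. -/
theorem bijOn_twTensor {F : ((UT 𝔤 2)⟦X⟧)ˣ} (hF : IsTwist F) (k h : ℕ) :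
    Set.BijOn (twTensor ρ F k h) {d | IsIsotropic ρ k h d} {D | IsTwIsotropic ρ F k h D} := by
  let N : ((UT 𝔤 (k + h))⟦X⟧)ˣ :=
    ⟨(List.ofFn fun t => hLeg t (mixedFamily k h (gamInv' F) t)).prod,
      (List.ofFn fun t => hLeg t (mixedFamily k h (gam' F) t)).prod,
      ofFn_mixedFamily_mul k h (gamInv'_mul_gam' hF), ofFn_mixedFamily_mul k h (gam'_mul_gamInv' hF)⟩
  have h1 : twTensor ρ F k h = tAct (mixedHom ρ k h) ↑(N * twMultiUnit F (k + h)) := by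
    funext d
    rw [twTensor_eq, Units.val_mul, coe_twMultiUnit]
  have h2 : {D | IsTwIsotropic ρ F k h D} = {D | ∀ x : (U 𝔤)⟦X⟧, tAct (mixedHom ρ k h)
      ((↑(N * twMultiUnit F (k + h)) : (UT 𝔤 (k + h))⟦X⟧) *
        hMap (copOn Finset.univ).toLinearMap x *
        (↑(N * twMultiUnit F (k + h))⁻¹ : (UT 𝔤 (k + h))⟦X⟧)) D =
          fun K => hMap (counit 𝔤).toLinearMap x * D K} := by
    ext D
    simp only [Set.mem_ofPred_eq, IsTwIsotropic, funext_iff, tAct, twEntry_eq, hLift_twCopIter,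
      mul_inv_rev, Units.val_mul, mul_assoc]
    rfl
  have h3 : {d | IsIsotropic ρ k h d} = {d | TensorInvariant (mixedHom ρ k h) d} := by
    ext d
    exact isIsotropic_iff ρ k h d
  rw [h1, h2, h3]
  exact bijOn_tAct _ _

/-- Matrix elements in `ρ` of `g S(G⁽¹⁾) ⊗ G⁽²⁾` are transposed matrix elements in `ρ^∨`, as `S² = 1`
on `U𝔤`. -/
theorem pairEntry_dual (g : (U 𝔤)⟦X⟧) (G : (UT 𝔤 2)⟦X⟧) (i l : ι) :
    pairEntry ρ s (repHom ρ).toLinearMap (hLeg 0 g *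
      hMap (evalLegs ![(leg 0).toLinearMap ∘ₗ antipode 𝔤, (leg 1).toLinearMap]) G) i l =
    pairEntry ρ s (repDualHom ρ).toLinearMap (G * hLeg 0 (hAntipode g)) l i := by
  refine IsHLin.ext (f := fun g => pairEntry ρ s (repHom ρ).toLinearMap (hLeg 0 g *
      hMap (evalLegs ![(leg 0).toLinearMap ∘ₗ antipode 𝔤, (leg 1).toLinearMap]) G) i l)
    (g := fun g => pairEntry ρ s (repDualHom ρ).toLinearMap (G * hLeg 0 (hAntipode g)) l i)
    (by fun_prop) (by fun_prop) (fun g => ?_) g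
  refine IsHLin.ext_tprod (f := fun G => pairEntry ρ s (repHom ρ).toLinearMap (hLeg 0 _ *
      hMap (evalLegs ![(leg 0).toLinearMap ∘ₗ antipode 𝔤, (leg 1).toLinearMap]) G) i l)
    (g := fun G => pairEntry ρ s (repDualHom ρ).toLinearMap (G * hLeg 0 (hAntipode _)) l i)
    (by fun_prop) (by fun_prop) (fun x => ?_) G
  have e1 : evalLegs ![(leg 0).toLinearMap ∘ₗ antipode 𝔤, (leg 1).toLinearMap]
      (PiTensorProduct.tprod ℂ x) = (leg 0 (antipode 𝔤 (x 0)) * leg 1 (x 1) : UT 𝔤 2) := by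
    rw [evalLegs_tprod]; simp [List.ofFn_succ]
  have e2 : (leg 0 (x 0) * leg 1 (x 1) * leg 0 (antipode 𝔤 g) : UT 𝔤 2) =
      leg 0 (x 0 * antipode 𝔤 g) * leg 1 (x 1) := by
    rw [map_mul, mul_assoc, mul_assoc, (leg_commute (by decide) (x 1) _).eq]
  rw [hMap_C, e1, hLeg_C, ← map_mul, ← mul_assoc, ← map_mul, pairEntry_leg_leg, hAntipode_C, hLeg_C,
    ← map_mul, tprod_two, e2, pairEntry_leg_leg]
  congr 3
  change _ = repDual ρ _ l i
  rw [repDual_apply, antipode_mul, antipode_antipode, rep_apply]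

theorem defCr_eq (F : ((UT 𝔤 2)⟦X⟧)ˣ) (α : ι → (Heis ι s)⟦X⟧) (i : ι) :
    defCr ρ F α i = ∑ l, α l * pairEntry ρ s (repHom ρ).toLinearMap
      ((↑F⁻¹ : (UT 𝔤 2)⟦X⟧) * hLeg 0 1) l i := by
  rw [hLeg_one, mul_one]; rfl

theorem defAn_eq (F : ((UT 𝔤 2)⟦X⟧)ˣ) (α : ι → (Heis ι s)⟦X⟧) (i : ι) :
    defAn ρ F α i = ∑ l, α l * pairEntry ρ s (repDualHom ρ).toLinearMap
      ((↑F⁻¹ : (UT 𝔤 2)⟦X⟧) * hLeg 0 (gam' F)) l i := by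
  rw [defAn]
  exact Finset.sum_congr rfl fun l _ => congrArg _ (pairEntry_dual ρ _ _ _ _)

omit [Fintype ι] in
theorem normalMonomial_hScalar (k h : ℕ) (bp b : ι → (Heis ι s)⟦X⟧) (K : Fin (k + h) → ι)
    (c : ℂ⟦X⟧) : normalMonomial k h bp b K (hScalar (Heis ι s) c) =
      letterProd (Fin.addCases (fun _ => bp) (fun _ => b)) K * hScalar (Heis ι s) c := by
  rw [normalMonomial, letterProd, List.ofFn_add, List.prod_append, mul_assoc,
    (hScalar_commute _ _).eq, mul_assoc]
  have hc : ∀ i : Fin k, Fin.castLE (Nat.le_add_right k h) i = Fin.castAdd h i := fun _ => rfl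
  simp [hc]

/-- The invariant built from the deformed generators depends on the twist only through the
coassociator, for all tuples that transform like `a⁺` and `a`. -/
theorem defInvariant_eq {F : ((UT 𝔤 2)⟦X⟧)ˣ} (hF : IsTwist F) (k h : ℕ)
    {ap a : ι → (Heis ι s)⟦X⟧} (hap : IsCovariant ρ (repHom ρ) ap)
    (ha : IsCovariant ρ (repDualHom ρ) a) {d : (Fin (k + h) → ι) → ℂ⟦X⟧}
    (hd : IsIsotropic ρ k h d) :
    defInvariant k h (defCr ρ F ap) (defAn ρ F a) (twTensor ρ F k h d) =
      dressedContraction ρ k h ap a (Ring.inverse (coassociator F)) d := by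
  have hcov : ∀ t, IsCovariant ρ (mixedHom ρ k h t)
      ((Fin.addCases (fun _ => ap) (fun _ => a) : Fin (k + h) → ι → (Heis ι s)⟦X⟧) t) := by
    intro t
    refine Fin.addCases (fun i => ?_) (fun i => ?_) t
    · simpa [mixedHom] using hap
    · simpa [mixedHom] using ha
  have hl : (Fin.addCases (fun _ => defCr ρ F ap) (fun _ => defAn ρ F a) :
      Fin (k + h) → ι → (Heis ι s)⟦X⟧) = fun t i =>
        ∑ l, (Fin.addCases (fun _ => ap) (fun _ => a) : Fin (k + h) → ι → (Heis ι s)⟦X⟧) t l *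
          pairEntry ρ s (mixedHom ρ k h t).toLinearMap
            ((↑F⁻¹ : (UT 𝔤 2)⟦X⟧) * hLeg 0 (mixedFamily k h (gam' F) t)) l i := by
    funext t i
    refine Fin.addCases (fun j => ?_) (fun j => ?_) t
    · simp only [Fin.addCases_left, mixedHom, mixedFamily, defCr_eq]
    · simp only [Fin.addCases_right, mixedHom, mixedFamily, defAn_eq]
  have hn : ∀ K : Fin (k + h) → ι, normalMonomial k h ap a K 1 =
      letterProd (Fin.addCases (fun _ => ap) (fun _ => a)) K := fun K => by
    have := normalMonomial_hScalar k h ap a K 1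
    rwa [hScalar_one, mul_one] at this
  rw [defInvariant, dressedContraction]
  simp only [normalMonomial_hScalar, hl, hn, twTensor_eq, inverse_coassociator, mixedRep_eq]
  exact sum_letterProd_deformed hF hcov _ (ofFn_mixedFamily_mul k h (gam'_mul_gamInv' hF))
    ((isIsotropic_iff ρ k h d).1 hd)

variable {ρ}

/-- Invariance under the adjoint action of a primitive element is commutation with it. -/
theorem IsInvariantUnit.commute_ι {u : (Heis ι s)⟦X⟧} (hu : IsInvariantUnit ρ u) (x : 𝔤) :
    Commute (PowerSeries.C (sig ρ s (UniversalEnvelopingAlgebra.ι ℂ x))) u := by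
  have h := hu.invariant (UniversalEnvelopingAlgebra.ι ℂ x)
  rw [act, counit_ι, zero_smul, sandwich, hConst_apply, hLift_C, copOn_two, map_add, leg_eq_tprod,
    leg_eq_tprod, evalLegs_tprod, evalLegs_tprod] at h
  simp only [List.ofFn_succ, List.ofFn_zero, List.prod_cons, List.prod_nil, mul_one,
    Matrix.cons_val_zero, Matrix.cons_val_succ, Fin.succ_zero_eq_one, LinearMap.comp_apply,
    Pi.mulSingle_eq_same, Pi.mulSingle_eq_of_ne (zero_ne_one' (Fin 2)),
    Pi.mulSingle_eq_of_ne (zero_ne_one' (Fin 2)).symm, LinearMap.mulRight_apply, hConst_apply,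
    AlgHom.toLinearMap_apply, antipode_one, antipode_ι, map_one, map_neg, one_mul, mul_neg] at h
  exact add_neg_eq_zero.1 h

theorem sig_ι (x : 𝔤) : sig ρ s (UniversalEnvelopingAlgebra.ι ℂ x) = jordan (ρ x) := by
  simp only [sig, UniversalEnvelopingAlgebra.lift_ι_apply]; rfl

theorem rep_ι (x : 𝔤) : repHom ρ (UniversalEnvelopingAlgebra.ι ℂ x) = ρ x := by
  rw [repHom, UniversalEnvelopingAlgebra.lift_ι_apply]

theorem repDual_ι (x : 𝔤) (i j : ι) :
    repDualHom ρ (UniversalEnvelopingAlgebra.ι ℂ x) i j = - ρ x j i := by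
  change repDual ρ _ i j = _
  rw [repDual_apply, antipode_ι, map_neg, rep_apply, rep_ι]; rfl

/-- `[jordan M, a⁺_i] = M^j_i a⁺_j`; the signs of the Weyl and Clifford relations cancel in pairs. -/
theorem jordan_mul_cr (M : Matrix ι ι ℂ) (i : ι) :
    (jordan M * cr i : Heis ι s) = ∑ j, M j i • cr j + cr i * jordan M := by
  have h : ∀ k l : ι, (cr k * an l * cr i : Heis ι s) =
      (if l = i then cr k else 0) + cr i * (cr k * an l) := by
    intro k l
    rw [mul_assoc, an_mul_cr, mul_add, mul_smul_comm, ← mul_assoc, cr_mul_cr k i, smul_mul_assoc,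
      smul_smul, sign_sq, one_smul, mul_assoc]
    split_ifs <;> simp
  simp only [jordan, Finset.sum_mul, Finset.mul_sum, smul_mul_assoc, mul_smul_comm, h, smul_add,
    Finset.sum_add_distrib]
  simp

/-- `[jordan M, a^i] = -M^i_j a^j`. -/
theorem jordan_mul_an (M : Matrix ι ι ℂ) (i : ι) :
    (jordan M * an i : Heis ι s) = ∑ j, (-M i j) • an j + an i * jordan M := by
  have h : ∀ k l : ι, (an i * (cr k * an l) : Heis ι s) =
      (if i = k then an l else 0) + cr k * an l * an i := by
    intro k l
    rw [← mul_assoc, an_mul_cr, add_mul, smul_mul_assoc, mul_assoc, an_mul_an i l, mul_smul_comm,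
      smul_smul, sign_sq, one_smul, mul_assoc]
    split_ifs <;> simp
  simp only [jordan, Finset.sum_mul, Finset.mul_sum, smul_mul_assoc, mul_smul_comm, h, smul_add,
    Finset.sum_add_distrib]
  simp

theorem dressCr_covariant {v v' : (Heis ι s)⟦X⟧} (hv : IsInvariantUnit ρ v)
    (hv' : IsInvariantUnit ρ v') : IsCovariant ρ (repHom ρ) (dressCr v v') := by
  refine IsCovariant.of_ι fun x i => ?_
  have h := congrArg (PowerSeries.C (R := Heis ι s)) (jordan_mul_cr (s := s) (ρ x) i)
  rw [← sig_ι, map_add, map_mul, map_mul, map_sum] at h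
  simp only [C_smul] at h
  rw [dressCr, ← mul_assoc, ← mul_assoc, (hv.commute_ι x).eq, mul_assoc v, h, mul_assoc _ v',
    ← (hv'.commute_ι x).eq]
  simp only [dressCr, rep_ι, mul_add, add_mul, Finset.mul_sum, Finset.sum_mul, mul_smul_comm,
    smul_mul_assoc, mul_assoc]

theorem dressAn_covariant {u u' : (Heis ι s)⟦X⟧} (hu : IsInvariantUnit ρ u)
    (hu' : IsInvariantUnit ρ u') : IsCovariant ρ (repDualHom ρ) (dressAn u u') := by
  refine IsCovariant.of_ι fun x i => ?_
  have h := congrArg (PowerSeries.C (R := Heis ι s)) (jordan_mul_an (s := s) (ρ x) i)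
  rw [← sig_ι, map_add, map_mul, map_mul, map_sum] at h
  simp only [C_smul] at h
  rw [dressAn, ← mul_assoc, ← mul_assoc, (hu.commute_ι x).eq, mul_assoc u, h, mul_assoc _ u',
    ← (hu'.commute_ι x).eq]
  simp only [dressAn, repDual_ι, mul_add, add_mul, Finset.mul_sum, Finset.sum_mul, mul_smul_comm,
    smul_mul_assoc, mul_assoc]

end TwistedTensors

/-! ### Contractions of the coassociator -/

section Contractions

variable {𝔤 : Type*} [LieRing 𝔤] [LieAlgebra ℂ 𝔤]

theorem leg_mul_tprod {n : ℕ} (i : Fin n) (y : U 𝔤) (x : Fin n → U 𝔤) :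
    leg i y * PiTensorProduct.tprod ℂ x =
      PiTensorProduct.tprod ℂ (Function.update x i (y * x i)) := by
  rw [leg_eq_tprod, PiTensorProduct.tprod_mul_tprod]
  congr 1
  funext j
  by_cases h : j = i
  · subst h; simp
  · simp [h]

theorem tprod_mul_leg {n : ℕ} (i : Fin n) (y : U 𝔤) (x : Fin n → U 𝔤) :
    PiTensorProduct.tprod ℂ x * leg i y =
      PiTensorProduct.tprod ℂ (Function.update x i (x i * y)) := by
  rw [leg_eq_tprod, PiTensorProduct.tprod_mul_tprod]
  congr 1
  funext j
  by_cases h : j = i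
  · subst h; simp
  · simp [h]

theorem legs_two_C_tprod {n : ℕ} (s t : Finset (Fin n)) (x : Fin 2 → U 𝔤) :
    legs ![s, t] (PowerSeries.C (PiTensorProduct.tprod ℂ x)) =
      PowerSeries.C (copOn s (x 0)) * PowerSeries.C (copOn t (x 1)) := by
  rw [legs_C_tprod, ← map_mul]
  simp [List.ofFn_succ]

/-- Commutation with the coproducts of `𝔤` implies commutation with all coproducts. -/
theorem commute_copOn_of_ι {n : ℕ} {s : Finset (Fin n)} {P : (UT 𝔤 n)⟦X⟧}
    (h : ∀ x : 𝔤, Commute P (PowerSeries.C (copOn s (UniversalEnvelopingAlgebra.ι ℂ x))))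
    (y : U 𝔤) : Commute P (PowerSeries.C (copOn s y)) := by
  induction y using U_induction with
  | hι x => exact h x
  | hC c =>
    rw [AlgHom.commutes, ← hScalar_C]
    exact (hScalar_commute _ _).symm
  | hadd x y hx hy => rw [map_add, map_add]; exact hx.add_right hy
  | hmul x y hx hy => rw [map_mul, map_mul]; exact hx.mul_right hy

/-- An `h`-linear map that kills right multiplication by the coproducts of `𝔤` turns right
multiplication by coproducts into the counit. -/
theorem IsHLin.mul_copOn {n : ℕ} {B : Type*} [Ring B] [Algebra ℂ B] {s : Finset (Fin n)}
    {f : (UT 𝔤 n)⟦X⟧ → B⟦X⟧} (hf : IsHLin f)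
    (h : ∀ (P : (UT 𝔤 n)⟦X⟧) (x : 𝔤),
      f (P * PowerSeries.C (copOn s (UniversalEnvelopingAlgebra.ι ℂ x))) = 0)
    (P : (UT 𝔤 n)⟦X⟧) (y : U 𝔤) :
    f (P * PowerSeries.C (copOn s y)) = counit 𝔤 y • f P := by
  induction y using U_induction generalizing P with
  | hι x => rw [h, counit_ι, zero_smul]
  | hC c =>
    rw [AlgHom.commutes, AlgHom.commutes, Algebra.algebraMap_eq_smul_one, C_smul, map_one,
      mul_smul_comm, mul_one, hf.smul]
    rfl
  | hadd x y hx hy => rw [map_add, map_add, map_add, mul_add, hf.add, hx, hy, add_smul]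
  | hmul x y hx hy => rw [map_mul, map_mul, map_mul, ← mul_assoc, hy, hx, smul_smul, mul_comm]

theorem IsHLin.copOn_mul {n : ℕ} {B : Type*} [Ring B] [Algebra ℂ B] {s : Finset (Fin n)}
    {f : (UT 𝔤 n)⟦X⟧ → B⟦X⟧} (hf : IsHLin f)
    (h : ∀ (P : (UT 𝔤 n)⟦X⟧) (x : 𝔤),
      f (PowerSeries.C (copOn s (UniversalEnvelopingAlgebra.ι ℂ x)) * P) = 0)
    (P : (UT 𝔤 n)⟦X⟧) (y : U 𝔤) :
    f (PowerSeries.C (copOn s y) * P) = counit 𝔤 y • f P := by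
  induction y using U_induction generalizing P with
  | hι x => rw [h, counit_ι, zero_smul]
  | hC c =>
    rw [AlgHom.commutes, AlgHom.commutes, Algebra.algebraMap_eq_smul_one, C_smul, map_one,
      smul_mul_assoc, one_mul, hf.smul]
    rfl
  | hadd x y hx hy => rw [map_add, map_add, map_add, add_mul, hf.add, hx, hy, add_smul]
  | hmul x y hx hy => rw [map_mul, map_mul, map_mul, mul_assoc, hx, hy, smul_smul]

theorem C_copOn_zero_one (y : U 𝔤) :
    (PowerSeries.C (copOn {0, 1} y) : (UT 𝔤 3)⟦X⟧) =
      legs ![{0}, {1}] (PowerSeries.C (copOn Finset.univ y)) := by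
  rw [legs_C_copOn _ (disjoint_pair (by decide)), biUnion_univ_pair]; rfl

theorem C_copOn_one_two (y : U 𝔤) :
    (PowerSeries.C (copOn {1, 2} y) : (UT 𝔤 3)⟦X⟧) =
      legs ![{1}, {2}] (PowerSeries.C (copOn Finset.univ y)) := by
  rw [legs_C_copOn _ (disjoint_pair (by decide)), biUnion_univ_pair]; rfl

theorem C_copOn_three (x : 𝔤) :
    (PowerSeries.C (copOn Finset.univ (UniversalEnvelopingAlgebra.ι ℂ x)) : (UT 𝔤 3)⟦X⟧) =
      PowerSeries.C (leg 0 (UniversalEnvelopingAlgebra.ι ℂ x)) +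
      PowerSeries.C (leg 1 (UniversalEnvelopingAlgebra.ι ℂ x)) +
      PowerSeries.C (leg 2 (UniversalEnvelopingAlgebra.ι ℂ x)) := by
  rw [copOn_ι, Fin.sum_univ_three, map_add, map_add]

/-! #### The contraction `φ⁽¹⁾ ⊗ φ⁽²⁾ S(φ⁽³⁾)` -/

section CoassocA

@[fun_prop] theorem IsHLin.coassocA_comp {B : Type*} [Ring B] [Algebra ℂ B]
    {g : B⟦X⟧ → (UT 𝔤 3)⟦X⟧} (hg : IsHLin g) : IsHLin fun q => coassocA (g q) := by
  unfold coassocA; fun_prop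

theorem coassocA_C_tprod (x : Fin 3 → U 𝔤) :
    coassocA (PowerSeries.C (PiTensorProduct.tprod ℂ x)) =
      PowerSeries.C (leg 0 (x 0) * leg 1 (x 1 * antipode 𝔤 (x 2))) := by
  rw [coassocA, hMap_C, evalLegs_tprod]
  simp [List.ofFn_succ]

theorem coassocA_leg_zero_mul (y : U 𝔤) (P : (UT 𝔤 3)⟦X⟧) :
    coassocA (PowerSeries.C (leg 0 y) * P) = PowerSeries.C (leg 0 y) * coassocA P := by
  refine IsHLin.ext_tprod (f := fun P => coassocA (PowerSeries.C (leg 0 y) * P))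
    (g := fun P => PowerSeries.C (leg 0 y) * coassocA P) (by fun_prop) (by fun_prop)
    (fun x => ?_) P
  rw [← map_mul, leg_mul_tprod, coassocA_C_tprod, coassocA_C_tprod, ← map_mul, ← mul_assoc,
    ← map_mul]
  simp

theorem coassocA_leg_one_mul (y : U 𝔤) (P : (UT 𝔤 3)⟦X⟧) :
    coassocA (PowerSeries.C (leg 1 y) * P) = PowerSeries.C (leg 1 y) * coassocA P := by
  refine IsHLin.ext_tprod (f := fun P => coassocA (PowerSeries.C (leg 1 y) * P))
    (g := fun P => PowerSeries.C (leg 1 y) * coassocA P) (by fun_prop) (by fun_prop)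
    (fun x => ?_) P
  rw [← map_mul, leg_mul_tprod, coassocA_C_tprod, coassocA_C_tprod, ← map_mul, ← mul_assoc,
    (leg_commute (by decide) _ _ : Commute (leg 1 y : UT 𝔤 2) _).eq, mul_assoc, ← map_mul]
  simp [mul_assoc]

theorem coassocA_leg_two_mul (y : U 𝔤) (P : (UT 𝔤 3)⟦X⟧) :
    coassocA (PowerSeries.C (leg 2 y) * P) =
      coassocA P * PowerSeries.C (leg 1 (antipode 𝔤 y)) := by
  refine IsHLin.ext_tprod (f := fun P => coassocA (PowerSeries.C (leg 2 y) * P))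
    (g := fun P => coassocA P * PowerSeries.C (leg 1 (antipode 𝔤 y))) (by fun_prop) (by fun_prop)
    (fun x => ?_) P
  rw [← map_mul, leg_mul_tprod, coassocA_C_tprod, coassocA_C_tprod, ← map_mul, mul_assoc,
    ← map_mul]
  simp [mul_assoc]

theorem coassocA_mul_leg_zero (y : U 𝔤) (P : (UT 𝔤 3)⟦X⟧) :
    coassocA (P * PowerSeries.C (leg 0 y)) = coassocA P * PowerSeries.C (leg 0 y) := by
  refine IsHLin.ext_tprod (f := fun P => coassocA (P * PowerSeries.C (leg 0 y)))
    (g := fun P => coassocA P * PowerSeries.C (leg 0 y)) (by fun_prop) (by fun_prop)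
    (fun x => ?_) P
  rw [← map_mul, tprod_mul_leg, coassocA_C_tprod, coassocA_C_tprod, ← map_mul, mul_assoc,
    (leg_commute (by decide) _ _ : Commute (leg 1 _ : UT 𝔤 2) (leg 0 y)).eq, ← mul_assoc, ← map_mul]
  simp

theorem coassocA_mul_primitive (P : (UT 𝔤 3)⟦X⟧) (x : 𝔤) :
    coassocA (P * (PowerSeries.C (leg 1 (UniversalEnvelopingAlgebra.ι ℂ x)) +
      PowerSeries.C (leg 2 (UniversalEnvelopingAlgebra.ι ℂ x)))) = 0 := by
  refine (IsHLin.ext_tprod (f := fun P => coassocA (P * (PowerSeries.C (leg 1 _) +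
      PowerSeries.C (leg 2 _)))) (g := fun P => 0 * coassocA P) (by fun_prop) (by fun_prop)
    (fun y => ?_) P).trans (zero_mul _)
  rw [← map_add, ← map_mul, mul_add, tprod_mul_leg, tprod_mul_leg, zero_mul, map_add,
    (by fun_prop : IsHLin fun P : (UT 𝔤 3)⟦X⟧ => coassocA P).add, coassocA_C_tprod, coassocA_C_tprod,
    ← map_add]
  simp only [ne_eq, Fin.reduceEq, not_false_eq_true, Function.update_of_ne, Function.update_self,
    antipode_mul, antipode_ι, ← mul_add, ← map_add]
  simp [mul_assoc]

/-- `x₍₁₎ S(x₍₂₎) = ε(x)` in the factors `2, 3` that `coassocA` contracts. -/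
theorem coassocA_mul_copOn (P : (UT 𝔤 3)⟦X⟧) (y : U 𝔤) :
    coassocA (P * PowerSeries.C (copOn {1, 2} y)) = counit 𝔤 y • coassocA P := by
  refine IsHLin.mul_copOn (f := fun P => coassocA P) (by fun_prop) (fun P x => ?_) P y
  have := coassocA_mul_primitive P x
  rw [copOn_ι, Finset.sum_pair (by decide), map_add, this]

theorem coassocA_legs_mul (Z : (UT 𝔤 2)⟦X⟧) (P : (UT 𝔤 3)⟦X⟧) :
    coassocA (legs ![{0}, {1}] Z * P) = Z * coassocA P := by
  refine IsHLin.ext_tprod (f := fun Z => coassocA (legs ![{0}, {1}] Z * P))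
    (g := fun Z => Z * coassocA P) (by fun_prop) (by fun_prop) (fun x => ?_) Z
  rw [legs_two_C_tprod, copOn_singleton, copOn_singleton, mul_assoc, coassocA_leg_zero_mul,
    coassocA_leg_one_mul, tprod_two, map_mul, mul_assoc]

theorem coassocA_mul_legs (Z : (UT 𝔤 2)⟦X⟧) (P : (UT 𝔤 3)⟦X⟧) :
    coassocA (P * legs ![{0}, {1, 2}] Z) = coassocA P * legs ![{0}, ∅] Z := by
  refine IsHLin.ext_tprod (f := fun Z => coassocA (P * legs ![{0}, {1, 2}] Z))
    (g := fun Z => coassocA P * legs ![{0}, ∅] Z) (by fun_prop) (by fun_prop) (fun x => ?_) Z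
  rw [legs_two_C_tprod, legs_two_C_tprod, copOn_singleton, ← mul_assoc, coassocA_mul_copOn,
    coassocA_mul_leg_zero, copOn_empty, copOn_singleton, Algebra.algebraMap_eq_smul_one, C_smul,
    map_one, mul_smul_comm, mul_one, mul_smul_comm]

/-- The contraction `coassocA` of an invariant element is invariant. -/
theorem coassocA_commute {φ : (UT 𝔤 3)⟦X⟧}
    (hφ : ∀ y : U 𝔤, Commute φ (PowerSeries.C (copOn Finset.univ y))) (y : U 𝔤) :
    Commute (coassocA φ) (PowerSeries.C (copOn Finset.univ y)) := by
  refine commute_copOn_of_ι (fun x => ?_) y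
  have h := congrArg coassocA (hφ (UniversalEnvelopingAlgebra.ι ℂ x)).eq
  have hadd := (by fun_prop : IsHLin fun P : (UT 𝔤 3)⟦X⟧ => coassocA P).add
  rw [C_copOn_three, add_mul, add_mul, hadd, hadd, coassocA_leg_zero_mul, coassocA_leg_one_mul,
    coassocA_leg_two_mul, add_assoc, mul_add, hadd, coassocA_mul_primitive, coassocA_mul_leg_zero,
    antipode_ι, map_neg, map_neg, mul_neg, add_zero] at h
  rw [Commute, SemiconjBy, copOn_two, map_add, mul_add, add_mul, h]
  abel

theorem coassocA_legs_one_two (Z : (UT 𝔤 2)⟦X⟧) :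
    coassocA (legs ![{1}, {2}] Z) =
      hLeg 1 (hMap (evalLegs ![LinearMap.id, antipode 𝔤]) Z) := by
  refine IsHLin.ext_tprod (f := fun Z => coassocA (legs ![{1}, {2}] Z))
    (g := fun Z => hLeg 1 (hMap (evalLegs ![LinearMap.id, antipode 𝔤]) Z))
    (by fun_prop) (by fun_prop) (fun x => ?_) Z
  have h : (leg 1 (x 0) * leg 2 (x 1) : UT 𝔤 3) = PiTensorProduct.tprod ℂ ![1, x 0, x 1] := by
    rw [tprod_eq_prod_leg]; simp [List.ofFn_succ]
  rw [legs_two_C_tprod, copOn_singleton, copOn_singleton, ← map_mul, h, coassocA_C_tprod, hMap_C,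
    hLeg_C, evalLegs_tprod]
  simp [List.ofFn_succ]

/-- The contraction `Z⁽¹⁾₍₁₎ ⊗ Z⁽¹⁾₍₂₎ S(Z⁽²⁾)` of `Z_{12,3}`. -/
def contractA (Z : (UT 𝔤 2)⟦X⟧) : (UT 𝔤 2)⟦X⟧ :=
  hMap (evalLegs ![(copOn Finset.univ).toLinearMap, (leg 1).toLinearMap ∘ₗ antipode 𝔤]) Z

@[fun_prop] theorem IsHLin.contractA_comp {B : Type*} [Ring B] [Algebra ℂ B]
    {g : B⟦X⟧ → (UT 𝔤 2)⟦X⟧} (hg : IsHLin g) : IsHLin fun q => contractA (g q) := by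
  unfold contractA; fun_prop

theorem contractA_C_tprod (x : Fin 2 → U 𝔤) :
    contractA (PowerSeries.C (PiTensorProduct.tprod ℂ x)) =
      PowerSeries.C (copOn Finset.univ (x 0)) * PowerSeries.C (leg 1 (antipode 𝔤 (x 1))) := by
  rw [contractA, hMap_C, evalLegs_tprod, ← map_mul]
  simp [List.ofFn_succ]

theorem coassocA_C_legs_mul (x : Fin 2 → U 𝔤) (P : (UT 𝔤 3)⟦X⟧) :
    coassocA (legs ![{0, 1}, {2}] (PowerSeries.C (PiTensorProduct.tprod ℂ x)) * P) =
      PowerSeries.C (copOn Finset.univ (x 0)) * coassocA P *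
        PowerSeries.C (leg 1 (antipode 𝔤 (x 1))) := by
  rw [legs_two_C_tprod, C_copOn_zero_one, copOn_singleton, mul_assoc, coassocA_legs_mul,
    coassocA_leg_two_mul, mul_assoc]

/-- As `coassocA φ` is invariant, it moves past `Δ(Z⁽¹⁾)`. -/
theorem coassocA_mul_contractA {φ : (UT 𝔤 3)⟦X⟧}
    (hφ : ∀ y : U 𝔤, Commute φ (PowerSeries.C (copOn Finset.univ y))) (Z : (UT 𝔤 2)⟦X⟧) :
    coassocA φ * contractA Z = coassocA (legs ![{0, 1}, {2}] Z * φ) := by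
  refine IsHLin.ext_tprod (f := fun Z => coassocA φ * contractA Z)
    (g := fun Z => coassocA (legs ![{0, 1}, {2}] Z * φ)) (by fun_prop) (by fun_prop)
    (fun x => ?_) Z
  rw [coassocA_C_legs_mul, contractA_C_tprod, ← mul_assoc, (coassocA_commute hφ _).eq]

end CoassocA

/-! #### The contraction `ψ⁽¹⁾ ⊗ S(ψ⁽³⁾) ψ⁽²⁾` -/

section CoassocB

@[fun_prop] theorem IsHLin.coassocB_comp {B : Type*} [Ring B] [Algebra ℂ B]
    {g : B⟦X⟧ → (UT 𝔤 3)⟦X⟧} (hg : IsHLin g) : IsHLin fun q => coassocB (g q) := by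
  unfold coassocB; fun_prop

theorem coassocB_C_tprod (x : Fin 3 → U 𝔤) :
    coassocB (PowerSeries.C (PiTensorProduct.tprod ℂ x)) =
      PowerSeries.C (leg 0 (x 0) * leg 1 (antipode 𝔤 (x 2) * x 1)) := by
  have h : (List.ofFn fun j => copOn ((![{0}, {2}, {1}] : Fin 3 → Finset (Fin 3)) j) (x j)).prod =
      PiTensorProduct.tprod ℂ ![x 0, x 2, x 1] := by
    rw [tprod_eq_prod_leg]
    simp [List.ofFn_succ, copOn_singleton,
      (leg_commute (by decide) _ _ : Commute (leg 2 (x 1) : UT 𝔤 3) (leg 1 (x 2))).eq]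
  rw [coassocB, legs_C_tprod, h, hMap_C, evalLegs_tprod]
  simp [List.ofFn_succ]

theorem coassocB_leg_zero_mul (y : U 𝔤) (P : (UT 𝔤 3)⟦X⟧) :
    coassocB (PowerSeries.C (leg 0 y) * P) = PowerSeries.C (leg 0 y) * coassocB P := by
  refine IsHLin.ext_tprod (f := fun P => coassocB (PowerSeries.C (leg 0 y) * P))
    (g := fun P => PowerSeries.C (leg 0 y) * coassocB P) (by fun_prop) (by fun_prop)
    (fun x => ?_) P
  rw [← map_mul, leg_mul_tprod, coassocB_C_tprod, coassocB_C_tprod, ← map_mul, ← mul_assoc,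
    ← map_mul]
  simp

theorem coassocB_mul_leg_zero (y : U 𝔤) (P : (UT 𝔤 3)⟦X⟧) :
    coassocB (P * PowerSeries.C (leg 0 y)) = coassocB P * PowerSeries.C (leg 0 y) := by
  refine IsHLin.ext_tprod (f := fun P => coassocB (P * PowerSeries.C (leg 0 y)))
    (g := fun P => coassocB P * PowerSeries.C (leg 0 y)) (by fun_prop) (by fun_prop)
    (fun x => ?_) P
  rw [← map_mul, tprod_mul_leg, coassocB_C_tprod, coassocB_C_tprod, ← map_mul, mul_assoc,
    (leg_commute (by decide) _ _ : Commute (leg 1 _ : UT 𝔤 2) (leg 0 y)).eq, ← mul_assoc, ← map_mul]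
  simp

theorem coassocB_mul_leg_one (y : U 𝔤) (P : (UT 𝔤 3)⟦X⟧) :
    coassocB (P * PowerSeries.C (leg 1 y)) = coassocB P * PowerSeries.C (leg 1 y) := by
  refine IsHLin.ext_tprod (f := fun P => coassocB (P * PowerSeries.C (leg 1 y)))
    (g := fun P => coassocB P * PowerSeries.C (leg 1 y)) (by fun_prop) (by fun_prop)
    (fun x => ?_) P
  rw [← map_mul, tprod_mul_leg, coassocB_C_tprod, coassocB_C_tprod, ← map_mul, mul_assoc,
    ← map_mul]
  simp [mul_assoc]

theorem coassocB_mul_leg_two (y : U 𝔤) (P : (UT 𝔤 3)⟦X⟧) :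
    coassocB (P * PowerSeries.C (leg 2 y)) =
      PowerSeries.C (leg 1 (antipode 𝔤 y)) * coassocB P := by
  refine IsHLin.ext_tprod (f := fun P => coassocB (P * PowerSeries.C (leg 2 y)))
    (g := fun P => PowerSeries.C (leg 1 (antipode 𝔤 y)) * coassocB P) (by fun_prop) (by fun_prop)
    (fun x => ?_) P
  rw [← map_mul, tprod_mul_leg, coassocB_C_tprod, coassocB_C_tprod, ← map_mul, ← mul_assoc,
    (leg_commute (by decide) _ _ : Commute (leg 1 (antipode 𝔤 y) : UT 𝔤 2) (leg 0 _)).eq, mul_assoc,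
    ← map_mul]
  simp [mul_assoc]

theorem coassocB_primitive_mul (P : (UT 𝔤 3)⟦X⟧) (x : 𝔤) :
    coassocB ((PowerSeries.C (leg 1 (UniversalEnvelopingAlgebra.ι ℂ x)) +
      PowerSeries.C (leg 2 (UniversalEnvelopingAlgebra.ι ℂ x))) * P) = 0 := by
  refine (IsHLin.ext_tprod (f := fun P => coassocB ((PowerSeries.C (leg 1 _) +
      PowerSeries.C (leg 2 _)) * P)) (g := fun P => 0 * coassocB P) (by fun_prop) (by fun_prop)
    (fun y => ?_) P).trans (zero_mul _)
  rw [← map_add, ← map_mul, add_mul, leg_mul_tprod, leg_mul_tprod, zero_mul, map_add,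
    (by fun_prop : IsHLin fun P : (UT 𝔤 3)⟦X⟧ => coassocB P).add, coassocB_C_tprod, coassocB_C_tprod,
    ← map_add]
  simp only [ne_eq, Fin.reduceEq, not_false_eq_true, Function.update_of_ne, Function.update_self,
    antipode_mul, antipode_ι, ← mul_add, ← map_add]
  simp [mul_assoc]

theorem coassocB_copOn_mul (P : (UT 𝔤 3)⟦X⟧) (y : U 𝔤) :
    coassocB (PowerSeries.C (copOn {1, 2} y) * P) = counit 𝔤 y • coassocB P := by
  refine IsHLin.copOn_mul (f := fun P => coassocB P) (by fun_prop) (fun P x => ?_) P y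
  have := coassocB_primitive_mul P x
  rw [copOn_ι, Finset.sum_pair (by decide), map_add, this]

theorem coassocB_mul_legs (Z : (UT 𝔤 2)⟦X⟧) (P : (UT 𝔤 3)⟦X⟧) :
    coassocB (P * legs ![{0}, {1}] Z) = coassocB P * Z := by
  refine IsHLin.ext_tprod (f := fun Z => coassocB (P * legs ![{0}, {1}] Z))
    (g := fun Z => coassocB P * Z) (by fun_prop) (by fun_prop) (fun x => ?_) Z
  rw [legs_two_C_tprod, copOn_singleton, copOn_singleton, ← mul_assoc, coassocB_mul_leg_one,
    coassocB_mul_leg_zero, tprod_two, map_mul, mul_assoc]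

theorem coassocB_legs_mul (Z : (UT 𝔤 2)⟦X⟧) (P : (UT 𝔤 3)⟦X⟧) :
    coassocB (legs ![{0}, {1, 2}] Z * P) = legs ![{0}, ∅] Z * coassocB P := by
  refine IsHLin.ext_tprod (f := fun Z => coassocB (legs ![{0}, {1, 2}] Z * P))
    (g := fun Z => legs ![{0}, ∅] Z * coassocB P) (by fun_prop) (by fun_prop) (fun x => ?_) Z
  rw [legs_two_C_tprod, legs_two_C_tprod, copOn_singleton, mul_assoc, coassocB_leg_zero_mul,
    coassocB_copOn_mul, copOn_empty, copOn_singleton, Algebra.algebraMap_eq_smul_one, C_smul,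
    map_one, mul_smul_comm, mul_smul_comm, mul_one, smul_mul_assoc]

/-- The contraction `coassocB` of an invariant element is invariant. -/
theorem coassocB_commute {ψ : (UT 𝔤 3)⟦X⟧}
    (hψ : ∀ y : U 𝔤, Commute ψ (PowerSeries.C (copOn Finset.univ y))) (y : U 𝔤) :
    Commute (coassocB ψ) (PowerSeries.C (copOn Finset.univ y)) := by
  refine commute_copOn_of_ι (fun x => ?_) y
  have h := congrArg coassocB (hψ (UniversalEnvelopingAlgebra.ι ℂ x)).eq
  have hadd := (by fun_prop : IsHLin fun P : (UT 𝔤 3)⟦X⟧ => coassocB P).add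
  rw [C_copOn_three, mul_add, mul_add, hadd, hadd, coassocB_mul_leg_zero, coassocB_mul_leg_one,
    coassocB_mul_leg_two, add_assoc (PowerSeries.C _), add_mul, hadd, coassocB_primitive_mul,
    coassocB_leg_zero_mul, antipode_ι, map_neg, map_neg, neg_mul, add_zero] at h
  rw [Commute, SemiconjBy, copOn_two, map_add, mul_add, add_mul, ← h]
  abel

theorem coassocB_legs_one_two (Z : (UT 𝔤 2)⟦X⟧) :
    coassocB (legs ![{1}, {2}] Z) =
      hLeg 1 (hAntipode (hMap (evalLegs ![antipode 𝔤, LinearMap.id]) Z)) := by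
  refine IsHLin.ext_tprod (f := fun Z => coassocB (legs ![{1}, {2}] Z))
    (g := fun Z => hLeg 1 (hAntipode (hMap (evalLegs ![antipode 𝔤, LinearMap.id]) Z)))
    (by fun_prop) (by fun_prop) (fun x => ?_) Z
  have h : (leg 1 (x 0) * leg 2 (x 1) : UT 𝔤 3) = PiTensorProduct.tprod ℂ ![1, x 0, x 1] := by
    rw [tprod_eq_prod_leg]; simp [List.ofFn_succ]
  rw [legs_two_C_tprod, copOn_singleton, copOn_singleton, ← map_mul, h, coassocB_C_tprod, hMap_C,
    hAntipode_C, hLeg_C, evalLegs_tprod]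
  simp [List.ofFn_succ]

/-- The contraction `Z⁽¹⁾₍₁₎ ⊗ S(Z⁽²⁾) Z⁽¹⁾₍₂₎` of `Z_{12,3}`. -/
def contractB (Z : (UT 𝔤 2)⟦X⟧) : (UT 𝔤 2)⟦X⟧ :=
  hMap (evalLegs ![(leg 1).toLinearMap ∘ₗ antipode 𝔤, (copOn Finset.univ).toLinearMap])
    (legs ![{1}, {0}] Z)

@[fun_prop] theorem IsHLin.contractB_comp {B : Type*} [Ring B] [Algebra ℂ B]
    {g : B⟦X⟧ → (UT 𝔤 2)⟦X⟧} (hg : IsHLin g) : IsHLin fun q => contractB (g q) := by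
  unfold contractB; fun_prop

theorem legs_swap_C_tprod (x : Fin 2 → U 𝔤) :
    legs ![{1}, {0}] (PowerSeries.C (PiTensorProduct.tprod ℂ x)) =
      (PowerSeries.C (PiTensorProduct.tprod ℂ ![x 1, x 0]) : (UT 𝔤 2)⟦X⟧) := by
  rw [legs_two_C_tprod, copOn_singleton, copOn_singleton, ← map_mul,
    (leg_commute (by decide) _ _ : Commute (leg 1 (x 0) : UT 𝔤 2) (leg 0 _)).eq, tprod_two]
  simp

theorem contractB_C_tprod (x : Fin 2 → U 𝔤) :
    contractB (PowerSeries.C (PiTensorProduct.tprod ℂ x)) =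
      PowerSeries.C (leg 1 (antipode 𝔤 (x 1))) * PowerSeries.C (copOn Finset.univ (x 0)) := by
  rw [contractB, legs_swap_C_tprod, hMap_C, evalLegs_tprod, ← map_mul]
  simp [List.ofFn_succ]

/-- As `coassocB ψ` is invariant, it moves past `Δ(Z⁽¹⁾)`. -/
theorem contractB_mul_coassocB {ψ : (UT 𝔤 3)⟦X⟧}
    (hψ : ∀ y : U 𝔤, Commute ψ (PowerSeries.C (copOn Finset.univ y))) (Z : (UT 𝔤 2)⟦X⟧) :
    contractB Z * coassocB ψ = coassocB (ψ * legs ![{0, 1}, {2}] Z) := by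
  refine IsHLin.ext_tprod (f := fun Z => contractB Z * coassocB ψ)
    (g := fun Z => coassocB (ψ * legs ![{0, 1}, {2}] Z)) (by fun_prop) (by fun_prop)
    (fun x => ?_) Z
  rw [contractB_C_tprod, legs_two_C_tprod, C_copOn_zero_one, copOn_singleton, ← mul_assoc,
    coassocB_mul_leg_two, coassocB_mul_legs, mul_assoc, (coassocB_commute hψ _).eq]

end CoassocB

/-! #### The contraction `ψ⁽²⁾ S(ψ⁽¹⁾) ⊗ ψ⁽³⁾` -/

section CoassocC

@[fun_prop] theorem IsHLin.coassocC_comp {B : Type*} [Ring B] [Algebra ℂ B]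
    {g : B⟦X⟧ → (UT 𝔤 3)⟦X⟧} (hg : IsHLin g) : IsHLin fun q => coassocC (g q) := by
  unfold coassocC; fun_prop

theorem coassocC_C_tprod (x : Fin 3 → U 𝔤) :
    coassocC (PowerSeries.C (PiTensorProduct.tprod ℂ x)) =
      PowerSeries.C (leg 0 (x 1 * antipode 𝔤 (x 0)) * leg 1 (x 2)) := by
  have h : (List.ofFn fun j => copOn ((![{1}, {0}, {2}] : Fin 3 → Finset (Fin 3)) j) (x j)).prod =
      PiTensorProduct.tprod ℂ ![x 1, x 0, x 2] := by
    rw [tprod_eq_prod_leg]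
    simp [List.ofFn_succ, copOn_singleton, ← mul_assoc,
      (leg_commute (by decide) _ _ : Commute (leg 1 (x 0) : UT 𝔤 3) (leg 0 (x 1))).eq]
  rw [coassocC, legs_C_tprod, h, hMap_C, evalLegs_tprod]
  simp [List.ofFn_succ, mul_assoc]

theorem coassocC_leg_one_mul (y : U 𝔤) (P : (UT 𝔤 3)⟦X⟧) :
    coassocC (PowerSeries.C (leg 1 y) * P) = PowerSeries.C (leg 0 y) * coassocC P := by
  refine IsHLin.ext_tprod (f := fun P => coassocC (PowerSeries.C (leg 1 y) * P))
    (g := fun P => PowerSeries.C (leg 0 y) * coassocC P) (by fun_prop) (by fun_prop)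
    (fun x => ?_) P
  rw [← map_mul, leg_mul_tprod, coassocC_C_tprod, coassocC_C_tprod, ← map_mul, ← mul_assoc,
    ← map_mul]
  simp [mul_assoc]

theorem coassocC_leg_two_mul (y : U 𝔤) (P : (UT 𝔤 3)⟦X⟧) :
    coassocC (PowerSeries.C (leg 2 y) * P) = PowerSeries.C (leg 1 y) * coassocC P := by
  refine IsHLin.ext_tprod (f := fun P => coassocC (PowerSeries.C (leg 2 y) * P))
    (g := fun P => PowerSeries.C (leg 1 y) * coassocC P) (by fun_prop) (by fun_prop)
    (fun x => ?_) P
  rw [← map_mul, leg_mul_tprod, coassocC_C_tprod, coassocC_C_tprod, ← map_mul, ← mul_assoc,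
    (leg_commute (by decide) _ _ : Commute (leg 1 y : UT 𝔤 2) (leg 0 _)).eq, mul_assoc, ← map_mul]
  simp

theorem coassocC_leg_zero_mul (y : U 𝔤) (P : (UT 𝔤 3)⟦X⟧) :
    coassocC (PowerSeries.C (leg 0 y) * P) =
      coassocC P * PowerSeries.C (leg 0 (antipode 𝔤 y)) := by
  refine IsHLin.ext_tprod (f := fun P => coassocC (PowerSeries.C (leg 0 y) * P))
    (g := fun P => coassocC P * PowerSeries.C (leg 0 (antipode 𝔤 y))) (by fun_prop) (by fun_prop)
    (fun x => ?_) P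
  rw [← map_mul, leg_mul_tprod, coassocC_C_tprod, coassocC_C_tprod, ← map_mul, mul_assoc,
    (leg_commute (by decide) _ _ : Commute (leg 1 _ : UT 𝔤 2) (leg 0 (antipode 𝔤 y))).eq,
    ← mul_assoc, ← map_mul]
  simp [mul_assoc]

theorem coassocC_mul_leg_two (y : U 𝔤) (P : (UT 𝔤 3)⟦X⟧) :
    coassocC (P * PowerSeries.C (leg 2 y)) = coassocC P * PowerSeries.C (leg 1 y) := by
  refine IsHLin.ext_tprod (f := fun P => coassocC (P * PowerSeries.C (leg 2 y)))
    (g := fun P => coassocC P * PowerSeries.C (leg 1 y)) (by fun_prop) (by fun_prop)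
    (fun x => ?_) P
  rw [← map_mul, tprod_mul_leg, coassocC_C_tprod, coassocC_C_tprod, ← map_mul, mul_assoc,
    ← map_mul]
  simp

theorem coassocC_mul_primitive (P : (UT 𝔤 3)⟦X⟧) (x : 𝔤) :
    coassocC (P * (PowerSeries.C (leg 0 (UniversalEnvelopingAlgebra.ι ℂ x)) +
      PowerSeries.C (leg 1 (UniversalEnvelopingAlgebra.ι ℂ x)))) = 0 := by
  refine (IsHLin.ext_tprod (f := fun P => coassocC (P * (PowerSeries.C (leg 0 _) +
      PowerSeries.C (leg 1 _)))) (g := fun P => 0 * coassocC P) (by fun_prop) (by fun_prop)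
    (fun y => ?_) P).trans (zero_mul _)
  rw [← map_add, ← map_mul, mul_add, tprod_mul_leg, tprod_mul_leg, zero_mul, map_add,
    (by fun_prop : IsHLin fun P : (UT 𝔤 3)⟦X⟧ => coassocC P).add, coassocC_C_tprod, coassocC_C_tprod,
    ← map_add]
  simp only [ne_eq, Fin.reduceEq, not_false_eq_true, Function.update_of_ne, Function.update_self,
    antipode_mul, antipode_ι, ← add_mul, ← map_add]
  simp [mul_assoc]

/-- `x₍₂₎ S(x₍₁₎) = ε(x)`, which holds by cocommutativity, in the factors `1, 2` that `coassocC`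
contracts. -/
theorem coassocC_mul_copOn (P : (UT 𝔤 3)⟦X⟧) (y : U 𝔤) :
    coassocC (P * PowerSeries.C (copOn {0, 1} y)) = counit 𝔤 y • coassocC P := by
  refine IsHLin.mul_copOn (f := fun P => coassocC P) (by fun_prop) (fun P x => ?_) P y
  have := coassocC_mul_primitive P x
  rw [copOn_ι, Finset.sum_pair (by decide), map_add, this]

theorem coassocC_legs_mul (Z : (UT 𝔤 2)⟦X⟧) (P : (UT 𝔤 3)⟦X⟧) :
    coassocC (legs ![{1}, {2}] Z * P) = Z * coassocC P := by
  refine IsHLin.ext_tprod (f := fun Z => coassocC (legs ![{1}, {2}] Z * P))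
    (g := fun Z => Z * coassocC P) (by fun_prop) (by fun_prop) (fun x => ?_) Z
  rw [legs_two_C_tprod, copOn_singleton, copOn_singleton, mul_assoc, coassocC_leg_one_mul,
    coassocC_leg_two_mul, tprod_two, map_mul, mul_assoc]

theorem coassocC_mul_legs (Z : (UT 𝔤 2)⟦X⟧) (P : (UT 𝔤 3)⟦X⟧) :
    coassocC (P * legs ![{0, 1}, {2}] Z) = coassocC P * legs ![∅, {1}] Z := by
  refine IsHLin.ext_tprod (f := fun Z => coassocC (P * legs ![{0, 1}, {2}] Z))
    (g := fun Z => coassocC P * legs ![∅, {1}] Z) (by fun_prop) (by fun_prop) (fun x => ?_) Z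
  rw [legs_two_C_tprod, legs_two_C_tprod, copOn_singleton, ← mul_assoc, coassocC_mul_leg_two,
    coassocC_mul_copOn, copOn_empty, copOn_singleton, Algebra.algebraMap_eq_smul_one, C_smul,
    map_one, smul_mul_assoc, smul_mul_assoc, one_mul, mul_smul_comm]

/-- The contraction `coassocC` of an invariant element is invariant. -/
theorem coassocC_commute {ψ : (UT 𝔤 3)⟦X⟧}
    (hψ : ∀ y : U 𝔤, Commute ψ (PowerSeries.C (copOn Finset.univ y))) (y : U 𝔤) :
    Commute (coassocC ψ) (PowerSeries.C (copOn Finset.univ y)) := by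
  refine commute_copOn_of_ι (fun x => ?_) y
  have h := congrArg coassocC (hψ (UniversalEnvelopingAlgebra.ι ℂ x)).eq
  have hadd := (by fun_prop : IsHLin fun P : (UT 𝔤 3)⟦X⟧ => coassocC P).add
  rw [C_copOn_three, add_mul, add_mul, hadd, hadd, coassocC_leg_zero_mul, coassocC_leg_one_mul,
    coassocC_leg_two_mul, mul_add, hadd, coassocC_mul_primitive, coassocC_mul_leg_two,
    antipode_ι, map_neg, map_neg, mul_neg, zero_add] at h
  rw [Commute, SemiconjBy, copOn_two, map_add, mul_add, add_mul, h]
  abel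

theorem coassocC_legs_zero_one (Z : (UT 𝔤 2)⟦X⟧) :
    coassocC (legs ![{0}, {1}] Z) =
      hLeg 0 (hAntipode (hMap (evalLegs ![LinearMap.id, antipode 𝔤]) Z)) := by
  refine IsHLin.ext_tprod (f := fun Z => coassocC (legs ![{0}, {1}] Z))
    (g := fun Z => hLeg 0 (hAntipode (hMap (evalLegs ![LinearMap.id, antipode 𝔤]) Z)))
    (by fun_prop) (by fun_prop) (fun x => ?_) Z
  have h : (leg 0 (x 0) * leg 1 (x 1) : UT 𝔤 3) = PiTensorProduct.tprod ℂ ![x 0, x 1, 1] := by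
    rw [tprod_eq_prod_leg]; simp [List.ofFn_succ]
  rw [legs_two_C_tprod, copOn_singleton, copOn_singleton, ← map_mul, h, coassocC_C_tprod, hMap_C,
    hAntipode_C, hLeg_C, evalLegs_tprod]
  simp [List.ofFn_succ]

/-- The contraction `Z⁽²⁾₍₁₎ S(Z⁽¹⁾) ⊗ Z⁽²⁾₍₂₎` of `Z_{1,23}`. -/
def contractC (Z : (UT 𝔤 2)⟦X⟧) : (UT 𝔤 2)⟦X⟧ :=
  hMap (evalLegs ![(copOn Finset.univ).toLinearMap, (leg 0).toLinearMap ∘ₗ antipode 𝔤])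
    (legs ![{1}, {0}] Z)

@[fun_prop] theorem IsHLin.contractC_comp {B : Type*} [Ring B] [Algebra ℂ B]
    {g : B⟦X⟧ → (UT 𝔤 2)⟦X⟧} (hg : IsHLin g) : IsHLin fun q => contractC (g q) := by
  unfold contractC; fun_prop

theorem contractC_C_tprod (x : Fin 2 → U 𝔤) :
    contractC (PowerSeries.C (PiTensorProduct.tprod ℂ x)) =
      PowerSeries.C (copOn Finset.univ (x 1)) * PowerSeries.C (leg 0 (antipode 𝔤 (x 0))) := by
  rw [contractC, legs_swap_C_tprod, hMap_C, evalLegs_tprod, ← map_mul]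
  simp [List.ofFn_succ]

/-- As `coassocC ψ` is invariant, it moves past `Δ(Z⁽²⁾)`. -/
theorem coassocC_mul_contractC {ψ : (UT 𝔤 3)⟦X⟧}
    (hψ : ∀ y : U 𝔤, Commute ψ (PowerSeries.C (copOn Finset.univ y))) (Z : (UT 𝔤 2)⟦X⟧) :
    coassocC ψ * contractC Z = coassocC (legs ![{0}, {1, 2}] Z * ψ) := by
  refine IsHLin.ext_tprod (f := fun Z => coassocC ψ * contractC Z)
    (g := fun Z => coassocC (legs ![{0}, {1, 2}] Z * ψ)) (by fun_prop) (by fun_prop)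
    (fun x => ?_) Z
  rw [contractC_C_tprod, legs_two_C_tprod, C_copOn_one_two, copOn_singleton, mul_assoc,
    coassocC_leg_zero_mul, coassocC_legs_mul, ← mul_assoc, (coassocC_commute hψ _).eq]

end CoassocC

end Contractions

/-! ### Identities between the twist and its coassociator -/

section CoassociatorIdentities

variable {𝔤 : Type*} [LieRing 𝔤] [LieAlgebra ℂ 𝔤]

/-- The normalization `(id ⊗ ε)Z = 1`, placed in any factor of a tensor power. -/
theorem legs_zero_empty {n : ℕ} (i : Fin n) {Z : (UT 𝔤 2)⟦X⟧}
    (hZ : legs ![{0}, ∅] Z = (1 : (UT 𝔤 1)⟦X⟧)) : legs ![{i}, ∅] Z = (1 : (UT 𝔤 n)⟦X⟧) := by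
  have h := congrArg (legs (fun _ : Fin 1 => ({i} : Finset (Fin n)))) hZ
  rw [legs_one, legs_legs _ (fun a b hab => absurd (Subsingleton.elim a b) hab)] at h
  rw [← h]
  congr 2
  funext j
  fin_cases j <;> simp

/-- The normalization `(ε ⊗ id)Z = 1`, placed in any factor of a tensor power. -/
theorem legs_empty_zero {n : ℕ} (i : Fin n) {Z : (UT 𝔤 2)⟦X⟧}
    (hZ : legs ![∅, {0}] Z = (1 : (UT 𝔤 1)⟦X⟧)) : legs ![∅, {i}] Z = (1 : (UT 𝔤 n)⟦X⟧) := by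
  have h := congrArg (legs (fun _ : Fin 1 => ({i} : Finset (Fin n)))) hZ
  rw [legs_one, legs_legs _ (fun a b hab => absurd (Subsingleton.elim a b) hab)] at h
  rw [← h]
  congr 2
  funext j
  fin_cases j <;> simp

theorem legs_inv_eq_one {F : ((UT 𝔤 2)⟦X⟧)ˣ} {n : ℕ} {s t : Finset (Fin n)} (h : Disjoint s t)
    (hF : legs ![s, t] (F : (UT 𝔤 2)⟦X⟧) = 1) : legs ![s, t] (↑F⁻¹ : (UT 𝔤 2)⟦X⟧) = 1 := by
  have := legs_mul_legs_inv F h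
  rwa [hF, one_mul] at this

/-- The contraction `X⁽¹⁾ ⊗ X⁽²⁾ ↦ S(X⁽¹⁾) X⁽²⁾`. -/
def antipodeMul (X : (UT 𝔤 2)⟦X⟧) : (U 𝔤)⟦X⟧ :=
  hMap (evalLegs ![antipode 𝔤, LinearMap.id]) X

@[fun_prop] theorem IsHLin.antipodeMul_comp {B : Type*} [Ring B] [Algebra ℂ B]
    {g : B⟦X⟧ → (UT 𝔤 2)⟦X⟧} (hg : IsHLin g) : IsHLin fun q => antipodeMul (g q) := by
  unfold antipodeMul; fun_prop

theorem antipodeMul_C_tprod (x : Fin 2 → U 𝔤) :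
    antipodeMul (PowerSeries.C (PiTensorProduct.tprod ℂ x)) =
      PowerSeries.C (antipode 𝔤 (x 0) * x 1) := by
  rw [antipodeMul, hMap_C, evalLegs_tprod]
  simp [List.ofFn_succ]

theorem antipodeMul_mul_hLeg_one (P : (UT 𝔤 2)⟦X⟧) (y : (U 𝔤)⟦X⟧) :
    antipodeMul (P * hLeg 1 y) = antipodeMul P * y := by
  refine IsHLin.ext (f := fun y => antipodeMul (P * hLeg 1 y)) (g := fun y => antipodeMul P * y)
    (by fun_prop) (by fun_prop) (fun y => ?_) y
  refine IsHLin.ext_tprod (f := fun P => antipodeMul (P * hLeg 1 (PowerSeries.C y)))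
    (g := fun P => antipodeMul P * PowerSeries.C y) (by fun_prop) (by fun_prop) (fun x => ?_) P
  rw [hLeg_C, ← map_mul, tprod_mul_leg, antipodeMul_C_tprod, antipodeMul_C_tprod, ← map_mul]
  simp [mul_assoc]

theorem antipodeMul_mul_leg_zero (P : (UT 𝔤 2)⟦X⟧) (y : U 𝔤) :
    antipodeMul (P * PowerSeries.C (leg 0 y)) =
      PowerSeries.C (antipode 𝔤 y) * antipodeMul P := by
  refine IsHLin.ext_tprod (f := fun P => antipodeMul (P * PowerSeries.C (leg 0 y)))
    (g := fun P => PowerSeries.C (antipode 𝔤 y) * antipodeMul P) (by fun_prop) (by fun_prop)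
    (fun x => ?_) P
  rw [← map_mul, tprod_mul_leg, antipodeMul_C_tprod, antipodeMul_C_tprod, ← map_mul]
  simp [mul_assoc]

/-- `S(x₍₁₎) x₍₂₎ = ε(x)`. -/
theorem antipodeMul_copOn_mul (P : (UT 𝔤 2)⟦X⟧) (y : U 𝔤) :
    antipodeMul (PowerSeries.C (copOn Finset.univ y) * P) = counit 𝔤 y • antipodeMul P := by
  refine IsHLin.copOn_mul (f := fun P => antipodeMul P) (by fun_prop) (fun P x => ?_) P y
  refine (IsHLin.ext_tprod (f := fun P => antipodeMul (PowerSeries.C (copOn Finset.univ _) * P))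
    (g := fun P => 0 * antipodeMul P) (by fun_prop) (by fun_prop) (fun y => ?_) P).trans (zero_mul _)
  rw [copOn_two, ← map_mul, add_mul, leg_mul_tprod, leg_mul_tprod, zero_mul, map_add,
    (by fun_prop : IsHLin fun P : (UT 𝔤 2)⟦X⟧ => antipodeMul P).add, antipodeMul_C_tprod,
    antipodeMul_C_tprod, ← map_add]
  simp only [ne_eq, zero_ne_one, one_ne_zero, not_false_eq_true, Function.update_of_ne,
    Function.update_self, antipode_mul, antipode_ι]
  simp [mul_assoc, -map_mul]

theorem coassocZ_eq (φ : (UT 𝔤 3)⟦X⟧) : coassocZ φ = antipodeMul (coassocA φ) := by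
  refine IsHLin.ext_tprod (f := fun φ => coassocZ φ) (g := fun φ => antipodeMul (coassocA φ))
    (by unfold coassocZ; fun_prop) (by fun_prop) (fun x => ?_) φ
  rw [coassocA_C_tprod, leg_mul_leg, antipodeMul_C_tprod, coassocZ, hMap_C, evalLegs_tprod]
  simp [List.ofFn_succ]

/-- In `S(φ⁽¹⁾) φ⁽²⁾ S(φ⁽³⁾)` a left factor `Z_{12,3}` of `φ` only leaves `S((ε ⊗ id)Z)`. -/
theorem coassocZ_legs_mul (Z : (UT 𝔤 2)⟦X⟧) (P : (UT 𝔤 3)⟦X⟧) :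
    coassocZ (legs ![{0, 1}, {2}] Z * P) = coassocZ P * hAntipode (hMap (evalLegs
      ![Algebra.linearMap ℂ (U 𝔤) ∘ₗ (counit 𝔤).toLinearMap, LinearMap.id]) Z) := by
  simp only [coassocZ_eq]
  refine IsHLin.ext_tprod (f := fun Z => antipodeMul (coassocA (legs ![{0, 1}, {2}] Z * P)))
    (g := fun Z => antipodeMul (coassocA P) * hAntipode (hMap (evalLegs
      ![Algebra.linearMap ℂ (U 𝔤) ∘ₗ (counit 𝔤).toLinearMap, LinearMap.id]) Z))
    (by fun_prop) (by fun_prop) (fun x => ?_) Z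
  rw [coassocA_C_legs_mul, mul_assoc, antipodeMul_copOn_mul, ← hLeg_C, antipodeMul_mul_hLeg_one,
    hMap_C, evalLegs_tprod]
  simp [List.ofFn_succ, ← Algebra.smul_def, C_smul, hAntipode_C]

/-- `z = S(φ⁽¹⁾) φ⁽²⁾ S(φ⁽³⁾)` is central for invariant `φ`: applying `S(·)·` to the invariance of
`T = φ⁽¹⁾ ⊗ φ⁽²⁾ S(φ⁽³⁾)` gives `z x = x z` for `x ∈ 𝔤`. -/
theorem commute_coassocZ {φ : (UT 𝔤 3)⟦X⟧}
    (hφ : ∀ y : U 𝔤, Commute φ (PowerSeries.C (copOn Finset.univ y))) (x : (U 𝔤)⟦X⟧) :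
    Commute (coassocZ φ) x := by
  refine IsHLin.ext (f := fun x => coassocZ φ * x) (g := fun x => x * coassocZ φ) (by fun_prop)
    (by fun_prop) (fun x => ?_) x
  change Commute _ _
  induction x using U_induction with
  | hι x =>
    have h := congrArg antipodeMul (coassocA_commute hφ (UniversalEnvelopingAlgebra.ι ℂ x)).eq
    rw [antipodeMul_copOn_mul, counit_ι, zero_smul, copOn_two, map_add, mul_add,
      (by fun_prop : IsHLin fun P : (UT 𝔤 2)⟦X⟧ => antipodeMul P).add, antipodeMul_mul_leg_zero,
      ← hLeg_C, antipodeMul_mul_hLeg_one, antipode_ι, map_neg, neg_mul, neg_add_eq_zero] at h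
    rw [coassocZ_eq]
    exact h.symm
  | hC c => rw [← hScalar_C]; exact (hScalar_commute _ _).symm
  | hadd x y hx hy => rw [map_add]; exact hx.add_right hy
  | hmul x y hx hy => rw [map_mul]; exact hx.mul_right hy

/-- The antipode maps central elements to central elements. -/
theorem commute_hAntipode {z : (U 𝔤)⟦X⟧} (hz : ∀ x, Commute z x) (x : (U 𝔤)⟦X⟧) :
    Commute (hAntipode z) x := by
  have := congrArg hAntipode (hz (hAntipode x)).eq
  rw [hAntipode_mul, hAntipode_mul, hAntipode_hAntipode] at this
  exact this.symm

theorem commute_hLeg_of_central {n : ℕ} (i : Fin n) {z : (U 𝔤)⟦X⟧} (hz : ∀ x, Commute z x)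
    (P : (UT 𝔤 n)⟦X⟧) : Commute (hLeg i z) P := by
  refine IsHLin.ext_tprod (f := fun P => hLeg i z * P) (g := fun P => P * hLeg i z) (by fun_prop)
    (by fun_prop) (fun x => ?_) P
  change Commute _ _
  rw [tprod_eq_prod_leg, map_list_prod]
  refine Commute.list_prod_right _ _ fun y hy => ?_
  simp only [List.map_ofFn, List.mem_ofFn, Function.comp_def] at hy
  obtain ⟨j, rfl⟩ := hy
  rw [← hLeg_C]
  by_cases hij : i = j
  · subst hij
    rw [Commute, SemiconjBy, ← hLeg_mul, ← hLeg_mul, (hz _).eq]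
  · exact commute_hLeg hij _ _

section Twist

variable {F : ((UT 𝔤 2)⟦X⟧)ˣ}

/-- `𝓕⁽¹⁾ S(𝓕⁽²⁾)`. -/
def twistQ (F : ((UT 𝔤 2)⟦X⟧)ˣ) : (U 𝔤)⟦X⟧ :=
  hMap (evalLegs ![LinearMap.id, antipode 𝔤]) (F : (UT 𝔤 2)⟦X⟧)

theorem coassociator_commute (hF : IsTwist F) (x : U 𝔤) :
    Commute (coassociator F) (PowerSeries.C (copOn Finset.univ x)) :=
  coassocUnit_commute hF x

theorem commute_inverse_left {M : Type*} [MonoidWithZero M] {a b : M} (ha : IsUnit a)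
    (h : Commute a b) : Commute (Ring.inverse a) b := by
  obtain ⟨a, rfl⟩ := ha
  rw [Ring.inverse_unit]
  exact h.units_inv_left

theorem inverse_coassociator_commute (hF : IsTwist F) (x : U 𝔤) :
    Commute (Ring.inverse (coassociator F)) (PowerSeries.C (copOn Finset.univ x)) :=
  commute_inverse_left (coassocUnit F).isUnit (coassocUnit_commute hF x)

/-- The contraction `φ⁽¹⁾ ⊗ φ⁽²⁾ S(φ⁽³⁾)` of `𝓕_{12,3} φ = 𝓕_{12}⁻¹ 𝓕_{23} 𝓕_{1,23}`: the last factor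
contracts to `(id ⊗ ε)𝓕 = 1`, and `𝓕_{23}` to `𝓕⁽¹⁾ S(𝓕⁽²⁾)` in the second factor. -/
theorem coassocA_legs_mul_coassociator (hF : IsTwist F) :
    coassocA (legs ![{0}, {1}] (↑F⁻¹ : (UT 𝔤 2)⟦X⟧) * legs ![{1}, {2}] (F : (UT 𝔤 2)⟦X⟧) *
      legs ![{0}, {1, 2}] (F : (UT 𝔤 2)⟦X⟧)) = (↑F⁻¹ : (UT 𝔤 2)⟦X⟧) * hLeg 1 (twistQ F) := by
  rw [coassocA_mul_legs, coassocA_legs_mul, coassocA_legs_one_two,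
    legs_zero_empty 0 hF.counit_right, mul_one]
  rfl

/-- `z = γ 𝓕⁽¹⁾ S(𝓕⁽²⁾)`. -/
theorem coassocZ_coassociator (hF : IsTwist F) :
    coassocZ (coassociator F) = gam F * twistQ F := by
  rw [coassociator, mul_assoc, mul_assoc, coassocZ_legs_mul, ← mul_assoc, coassocZ_eq,
    coassocA_legs_mul_coassociator hF, antipodeMul_mul_hLeg_one,
    counit_left_apply (legs_inv_eq_one (by simp) hF.counit_left), hAntipode_one, mul_one]
  rfl

theorem twistQ_mul_gam (hF : IsTwist F) : twistQ F * gam F = coassocZ (coassociator F) := by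
  have h : gam F * (twistQ F * gam F) = gam F * coassocZ (coassociator F) := by
    rw [← mul_assoc, ← coassocZ_coassociator hF, (commute_coassocZ (coassociator_commute hF) _).eq]
  exact (isUnit_gam hF).mul_left_cancel h

theorem constantCoeff_legs {m n : ℕ} (p : Fin m → Finset (Fin n)) {Z : (UT 𝔤 m)⟦X⟧}
    (hZ : PowerSeries.constantCoeff Z = 1) : PowerSeries.constantCoeff (legs p Z) = 1 := by
  have := legs_one (𝔤 := 𝔤) p
  rw [legs, constantCoeff_hMap, hZ, ← PowerSeries.constantCoeff_one (R := UT 𝔤 m),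
    ← constantCoeff_hMap]
  rw [legs] at this
  rw [this, map_one]

theorem constantCoeff_coassociator (hF : IsTwist F) :
    PowerSeries.constantCoeff (coassociator F) = 1 := by
  simp only [coassociator, map_mul, constantCoeff_legs _ hF.const,
    constantCoeff_legs _ (constantCoeff_inv hF), mul_one]

theorem constantCoeff_inverse_coassociator (hF : IsTwist F) :
    PowerSeries.constantCoeff (Ring.inverse (coassociator F)) = 1 := by
  simp only [inverse_coassociator, coe_coassocUnit_inv, map_mul, constantCoeff_legs _ hF.const,
    constantCoeff_legs _ (constantCoeff_inv hF), mul_one]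

theorem isUnit_coassocA {φ : (UT 𝔤 3)⟦X⟧} (h : PowerSeries.constantCoeff φ = 1) :
    IsUnit (coassocA φ) := by
  refine isUnit_of_constantCoeff_eq_one ?_
  rw [coassocA, constantCoeff_hMap, h, PiTensorProduct.one_def, evalLegs_tprod]
  simp [List.ofFn_succ]

theorem isUnit_coassocB {ψ : (UT 𝔤 3)⟦X⟧} (h : PowerSeries.constantCoeff ψ = 1) :
    IsUnit (coassocB ψ) := by
  refine isUnit_of_constantCoeff_eq_one ?_
  rw [coassocB, constantCoeff_hMap, constantCoeff_legs _ h, PiTensorProduct.one_def, evalLegs_tprod]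
  simp [List.ofFn_succ]

theorem isUnit_coassocC {ψ : (UT 𝔤 3)⟦X⟧} (h : PowerSeries.constantCoeff ψ = 1) :
    IsUnit (coassocC ψ) := by
  refine isUnit_of_constantCoeff_eq_one ?_
  rw [coassocC, constantCoeff_hMap, constantCoeff_legs _ h, PiTensorProduct.one_def, evalLegs_tprod]
  simp [List.ofFn_succ]

/-- With `T = φ⁽¹⁾ ⊗ φ⁽²⁾ S(φ⁽³⁾)`, the element `𝓕⁽¹⁾₍₁₎ ⊗ 𝓕⁽¹⁾₍₂₎ S(𝓕⁽²⁾) γ`, which governs the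
adjoint form of the creators, is `T⁻¹ (1 ⊗ z) 𝓕⁻¹`. -/
theorem contractA_eq (hF : IsTwist F) :
    contractA (F : (UT 𝔤 2)⟦X⟧) * hLeg 1 (gam F) =
      Ring.inverse (coassocA (coassociator F)) * hLeg 1 (coassocZ (coassociator F)) *
        (↑F⁻¹ : (UT 𝔤 2)⟦X⟧) := by
  have hz := commute_hLeg_of_central 1 (commute_coassocZ (coassociator_commute hF))
    (↑F⁻¹ : (UT 𝔤 2)⟦X⟧)
  have hu := isUnit_coassocA (constantCoeff_coassociator hF)
  have hm : legs ![{0, 1}, {2}] (F : (UT 𝔤 2)⟦X⟧) * coassociator F =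
      legs ![{0}, {1}] (↑F⁻¹ : (UT 𝔤 2)⟦X⟧) * legs ![{1}, {2}] (F : (UT 𝔤 2)⟦X⟧) *
        legs ![{0}, {1, 2}] (F : (UT 𝔤 2)⟦X⟧) := by
    have := legs_mul_legs_inv F (by decide : Disjoint ({0, 1} : Finset (Fin 3)) {2})
    simp only [coassociator, ← mul_assoc]
    rw [this, one_mul]
  have h := coassocA_mul_contractA (coassociator_commute hF) (F : (UT 𝔤 2)⟦X⟧)
  rw [hm, coassocA_legs_mul_coassociator hF] at h
  rw [mul_assoc, hz.eq, ← twistQ_mul_gam hF, hLeg_mul, ← mul_assoc _ (hLeg 1 (twistQ F)), ← h,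
    ← mul_assoc, ← mul_assoc, Ring.inverse_mul_cancel _ hu, one_mul]

/-- With `G = 𝓕⁻¹` and `T' = ψ⁽¹⁾ ⊗ S(ψ⁽³⁾) ψ⁽²⁾`, `ψ = φ⁻¹`, the element
`G⁽¹⁾₍₁₎ ⊗ γ' S(G⁽²⁾) G⁽¹⁾₍₂₎`, which governs the adjoint form of the annihilators, is `𝓕 T'⁻¹`. -/
theorem contractB_eq (hF : IsTwist F) :
    hLeg 1 (gam' F) * contractB (↑F⁻¹ : (UT 𝔤 2)⟦X⟧) =
      (F : (UT 𝔤 2)⟦X⟧) * Ring.inverse (coassocB (Ring.inverse (coassociator F))) := by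
  have hu := isUnit_coassocB (constantCoeff_inverse_coassociator hF)
  have hm : Ring.inverse (coassociator F) * legs ![{0, 1}, {2}] (↑F⁻¹ : (UT 𝔤 2)⟦X⟧) =
      legs ![{0}, {1, 2}] (↑F⁻¹ : (UT 𝔤 2)⟦X⟧) * (legs ![{1}, {2}] (↑F⁻¹ : (UT 𝔤 2)⟦X⟧) *
      legs ![{0}, {1}] (F : (UT 𝔤 2)⟦X⟧)) := by
    have := legs_mul_legs_inv F (by decide : Disjoint ({0, 1} : Finset (Fin 3)) {2})
    rw [inverse_coassociator, coe_coassocUnit_inv, mul_assoc, this, mul_one, mul_assoc]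
  have h := contractB_mul_coassocB (inverse_coassociator_commute hF) (↑F⁻¹ : (UT 𝔤 2)⟦X⟧)
  rw [hm, coassocB_legs_mul, legs_zero_empty 0 (legs_inv_eq_one (by simp) hF.counit_right), one_mul,
    coassocB_mul_legs, coassocB_legs_one_two] at h
  have hg : hLeg 1 (gam' F) * hLeg 1 (hAntipode (hMap (evalLegs ![antipode 𝔤, LinearMap.id])
      (↑F⁻¹ : (UT 𝔤 2)⟦X⟧))) = (1 : (UT 𝔤 2)⟦X⟧) := by
    rw [← hLeg_mul, ← hLeg_one (𝔤 := 𝔤) 1, ← gam'_mul_gamInv' hF]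
    rfl
  have h2 := congrArg (hLeg 1 (gam' F) * ·) h
  simp only [← mul_assoc] at h2
  rw [hg, one_mul] at h2
  rw [← h2, mul_assoc, mul_assoc, Ring.mul_inverse_cancel _ hu, mul_one]

/-- With `T'' = ψ⁽²⁾ S(ψ⁽¹⁾) ⊗ ψ⁽³⁾`, `ψ = φ⁻¹`, the element `𝓕⁽²⁾₍₁₎ S(𝓕⁽¹⁾) ⊗ 𝓕⁽²⁾₍₂₎`, which arises when
matrix elements of `𝓕` in `ρ` move to the right of the annihilators, is
`T''⁻¹ (S(z) ⊗ 1) 𝓕⁻¹ (γ' ⊗ 1)`. -/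
theorem contractC_eq (hF : IsTwist F) :
    contractC (F : (UT 𝔤 2)⟦X⟧) =
      Ring.inverse (coassocC (Ring.inverse (coassociator F))) *
        hLeg 0 (hAntipode (coassocZ (coassociator F))) *
          ((↑F⁻¹ : (UT 𝔤 2)⟦X⟧) * hLeg 0 (gam' F)) := by
  have hu := isUnit_coassocC (constantCoeff_inverse_coassociator hF)
  have hzc := commute_coassocZ (coassociator_commute hF)
  have hz : Commute (hLeg 0 (hAntipode (coassocZ (coassociator F)))) (↑F⁻¹ : (UT 𝔤 2)⟦X⟧) :=
    commute_hLeg_of_central 0 (commute_hAntipode hzc) _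
  have hm : legs ![{0}, {1, 2}] (F : (UT 𝔤 2)⟦X⟧) * Ring.inverse (coassociator F) =
      legs ![{1}, {2}] (↑F⁻¹ : (UT 𝔤 2)⟦X⟧) * (legs ![{0}, {1}] (F : (UT 𝔤 2)⟦X⟧) *
        legs ![{0, 1}, {2}] (F : (UT 𝔤 2)⟦X⟧)) := by
    have := legs_mul_legs_inv F (by decide : Disjoint ({0} : Finset (Fin 3)) {1, 2})
    rw [inverse_coassociator, coe_coassocUnit_inv]
    simp only [← mul_assoc]
    rw [this, one_mul]
  have hq : hAntipode (coassocZ (coassociator F)) * gam' F = hAntipode (twistQ F) := by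
    rw [coassocZ_coassociator hF, hAntipode_mul, mul_assoc]
    change _ * (gamInv' F * gam' F) = _
    rw [gamInv'_mul_gam' hF, mul_one]
  have h := coassocC_mul_contractC (inverse_coassociator_commute hF) (F : (UT 𝔤 2)⟦X⟧)
  rw [hm, coassocC_legs_mul, coassocC_mul_legs, legs_empty_zero 1 hF.counit_left, mul_one,
    coassocC_legs_zero_one] at h
  change _ = _ * hLeg 0 (hAntipode (twistQ F)) at h
  rw [mul_assoc, ← mul_assoc (hLeg 0 _), hz.eq, mul_assoc _ (hLeg 0 _), ← hLeg_mul, hq, ← h,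
    ← mul_assoc, Ring.inverse_mul_cancel _ hu, one_mul]

end Twist

end CoassociatorIdentities

/-! ### The adjoint form of the generators -/

section AdjointGenerators

variable {𝔤 : Type*} [LieRing 𝔤] [LieAlgebra ℂ 𝔤] {ι : Type*} [Fintype ι] [DecidableEq ι]
  {s : ℤˣ} {ρ : 𝔤 →ₗ⁅ℂ⁆ Matrix ι ι ℂ}

theorem pairEntry_mul_leg_one (R : U 𝔤 →ₐ[ℂ] Matrix ι ι ℂ) (X : (UT 𝔤 2)⟦X⟧) (y : (U 𝔤)⟦X⟧)
    (l i : ι) : pairEntry ρ s R.toLinearMap (X * hLeg 1 y) l i =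
      pairEntry ρ s R.toLinearMap X l i * hSig ρ s y := by
  simp [pairEntry_mul, pairEntry_hLeg_one]

theorem pairEntry_leg_one_mul (R : U 𝔤 →ₐ[ℂ] Matrix ι ι ℂ) (X : (UT 𝔤 2)⟦X⟧) (y : (U 𝔤)⟦X⟧)
    (l i : ι) : pairEntry ρ s R.toLinearMap (hLeg 1 y * X) l i =
      hSig ρ s y * pairEntry ρ s R.toLinearMap X l i := by
  simp [pairEntry_mul, pairEntry_hLeg_one]

theorem sum_mul_pairEntry_mul (R : U 𝔤 →ₐ[ℂ] Matrix ι ι ℂ) (α : ι → (Heis ι s)⟦X⟧)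
    (X Y : (UT 𝔤 2)⟦X⟧) (i : ι) :
    ∑ j, α j * pairEntry ρ s R.toLinearMap (X * Y) j i =
      ∑ l, (∑ j, α j * pairEntry ρ s R.toLinearMap X j l) * pairEntry ρ s R.toLinearMap Y l i := by
  simp only [pairEntry_mul, Finset.sum_mul, Finset.mul_sum, mul_assoc]
  rw [Finset.sum_comm]

theorem sum_pairEntry_mul_mul (R : U 𝔤 →ₐ[ℂ] Matrix ι ι ℂ) (α : ι → (Heis ι s)⟦X⟧)
    (X Y : (UT 𝔤 2)⟦X⟧) (i : ι) :
    ∑ j, pairEntry ρ s R.toLinearMap (X * Y) i j * α j =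
      ∑ l, pairEntry ρ s R.toLinearMap X i l * ∑ j, pairEntry ρ s R.toLinearMap Y l j * α j := by
  simp only [pairEntry_mul, Finset.sum_mul, Finset.mul_sum, mul_assoc]
  rw [Finset.sum_comm]

theorem hSig_C (y : U 𝔤) : hSig ρ s (PowerSeries.C y) = PowerSeries.C (sig ρ s y) := hMap_C _ _

/-- Moving `α_i` to the left through `σ(Z⁽¹⁾)`. -/
theorem IsCovariant.sandwich_eq {α : ι → (Heis ι s)⟦X⟧} (h : IsCovariant ρ (repHom ρ) α)
    (Z : (UT 𝔤 2)⟦X⟧) (i : ι) : sandwich ρ Z (α i) =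
      ∑ j, α j * pairEntry ρ s (repHom ρ).toLinearMap (contractA Z) j i := by
  refine IsHLin.ext_tprod (f := fun Z => sandwich ρ Z (α i))
    (g := fun Z => ∑ j, α j * pairEntry ρ s (repHom ρ).toLinearMap (contractA Z) j i)
    (by unfold sandwich; fun_prop) (by fun_prop) (fun x => ?_) Z
  simp only [contractA_C_tprod, ← hLeg_C, pairEntry_mul_leg_one, ← mul_assoc, ← Finset.sum_mul]
  rw [← h, sandwich, hLift_C, evalLegs_tprod, hSig_C]
  simp [List.ofFn_succ]

/-- The adjoint form of the creators is the original form for redressed generators. -/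
theorem IsCovariant.adjCr_eq {F : ((UT 𝔤 2)⟦X⟧)ˣ} (hF : IsTwist F) {α : ι → (Heis ι s)⟦X⟧}
    (h : IsCovariant ρ (repHom ρ) α) :
    adjCr ρ F α = defCr ρ F (redressCr ρ (coassociator F) α) := by
  funext i
  simp only [adjCr, h.sandwich_eq, Finset.sum_mul, mul_assoc (α _), ← pairEntry_mul_leg_one,
    contractA_eq hF]
  exact sum_mul_pairEntry_mul (repHom ρ) α _ _ i

theorem IsCovariant.redressCr {F : ((UT 𝔤 2)⟦X⟧)ˣ} (hF : IsTwist F) {α : ι → (Heis ι s)⟦X⟧}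
    (h : IsCovariant ρ (repHom ρ) α) :
    IsCovariant ρ (repHom ρ) (redressCr ρ (coassociator F) α) := by
  refine h.contract fun x => Commute.mul_left ?_
    (commute_hLeg_of_central 1 (commute_coassocZ (coassociator_commute hF)) _)
  exact commute_inverse_left (isUnit_coassocA (constantCoeff_coassociator hF))
    (coassocA_commute (coassociator_commute hF) x)

/-- The left-handed form of covariance, `α_i σ(x) = [(ρ ⊗ σ)(Δ x)]^i_j α_j`. It is equivalent to
covariance in the representation `ρ^∨`. -/
def IsLeftCovariant (ρ : 𝔤 →ₗ⁅ℂ⁆ Matrix ι ι ℂ) (α : ι → (Heis ι s)⟦X⟧) : Prop :=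
  ∀ (x : U 𝔤) (i : ι), α i * PowerSeries.C (sig ρ s x) =
    ∑ j, pairEntry ρ s (repHom ρ).toLinearMap (PowerSeries.C (copOn Finset.univ x)) i j * α j

theorem isLeftCovariant_iff {α : ι → (Heis ι s)⟦X⟧} :
    IsLeftCovariant ρ α ↔ IsCovariant ρ (repDualHom ρ) α := by
  constructor
  · intro h
    refine IsCovariant.of_ι fun x i => ?_
    have := h (UniversalEnvelopingAlgebra.ι ℂ x) i
    rw [sum_pairEntry_copOn_ι_mul] at this
    rw [this]
    simp [rep_ι, repDual_ι, -UniversalEnvelopingAlgebra.ι_apply]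
  · intro h
    refine left_covariant_of_ι fun x i => ?_
    rw [h.ι_mul]
    simp [rep_ι, repDual_ι, -UniversalEnvelopingAlgebra.ι_apply]

/-- `σ(S Z⁽²⁾) α_i σ(Z⁽¹⁾)`, with `α_i` moved to the right through `σ(Z⁽¹⁾)`. -/
theorem IsLeftCovariant.sandwich_eq {α : ι → (Heis ι s)⟦X⟧} (h : IsLeftCovariant ρ α)
    (Z : (UT 𝔤 2)⟦X⟧) (i : ι) :
    hLift (evalLegs
      ![LinearMap.mulRight ℂ (α i) ∘ₗ hConst (Heis ι s) ∘ₗ (sig ρ s).toLinearMap ∘ₗ antipode 𝔤,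
        hConst (Heis ι s) ∘ₗ (sig ρ s).toLinearMap]) (legs ![{1}, {0}] Z : (UT 𝔤 2)⟦X⟧) =
      ∑ j, pairEntry ρ s (repHom ρ).toLinearMap (contractB Z) i j * α j := by
  refine IsHLin.ext_tprod (f := fun Z => hLift _ (legs ![{1}, {0}] Z : (UT 𝔤 2)⟦X⟧))
    (g := fun Z => ∑ j, pairEntry ρ s (repHom ρ).toLinearMap (contractB Z) i j * α j)
    (by fun_prop) (by fun_prop) (fun x => ?_) Z
  simp only [contractB_C_tprod, ← hLeg_C, pairEntry_leg_one_mul, mul_assoc, ← Finset.mul_sum]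
  rw [← h, legs_swap_C_tprod, hLift_C, evalLegs_tprod, hSig_C]
  simp [List.ofFn_succ, mul_assoc]

/-- Moving matrix elements in `ρ` from the left of a covariant tuple to the right turns them into
matrix elements in `ρ^∨`. -/
theorem IsLeftCovariant.sum_pairEntry_mul {α : ι → (Heis ι s)⟦X⟧} (h : IsLeftCovariant ρ α)
    (Z : (UT 𝔤 2)⟦X⟧) (i : ι) :
    ∑ m, pairEntry ρ s (repHom ρ).toLinearMap Z i m * α m =
      ∑ m, α m * pairEntry ρ s (repDualHom ρ).toLinearMap (contractC Z) m i := by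
  refine IsHLin.ext_tprod
    (f := fun Z => ∑ m, pairEntry ρ s (repHom ρ).toLinearMap Z i m * α m)
    (g := fun Z => ∑ m, α m * pairEntry ρ s (repDualHom ρ).toLinearMap (contractC Z) m i)
    (by fun_prop) (by fun_prop) (fun x => ?_) Z
  have hd : ∀ j, repDualHom ρ (antipode 𝔤 (x 0)) j i = repHom ρ (x 0) i j := fun j => by
    change repDual ρ _ j i = _
    rw [repDual_apply, antipode_antipode, rep_apply]
  simp only [contractC_C_tprod, pairEntry_mul, pairEntry_leg_zero, hd, Finset.mul_sum, ← mul_assoc]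
  rw [Finset.sum_comm]
  simp only [← Finset.sum_mul, ← (isLeftCovariant_iff.1 h) (x 1)]
  refine Finset.sum_congr rfl fun j _ => ?_
  rw [pairEntry_C_tprod, map_mul, mul_assoc, ← hScalar_C, (hScalar_commute _ _).eq]

theorem IsLeftCovariant.contract {α : ι → (Heis ι s)⟦X⟧} (h : IsLeftCovariant ρ α)
    {Y : (UT 𝔤 2)⟦X⟧} (hY : ∀ x : U 𝔤, Commute Y (PowerSeries.C (copOn Finset.univ x))) :
    IsLeftCovariant ρ fun i => ∑ l, pairEntry ρ s (repHom ρ).toLinearMap Y i l * α l := by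
  intro x i
  rw [Finset.sum_mul]
  simp only [mul_assoc, h x, Finset.mul_sum]
  rw [Finset.sum_comm, Finset.sum_comm (s := (Finset.univ : Finset ι)) (t := Finset.univ)
    (f := fun j l => _ * (pairEntry ρ s (repHom ρ).toLinearMap Y j l * α l))]
  refine Finset.sum_congr rfl fun l _ => ?_
  simp only [← mul_assoc, ← Finset.sum_mul]
  rw [← pairEntry_mul, ← pairEntry_mul, (hY x).eq]

theorem inverse_coassocB_commute {F : ((UT 𝔤 2)⟦X⟧)ˣ} (hF : IsTwist F) (x : U 𝔤) :
    Commute (Ring.inverse (coassocB (Ring.inverse (coassociator F))))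
      (PowerSeries.C (copOn Finset.univ x)) :=
  commute_inverse_left (isUnit_coassocB (constantCoeff_inverse_coassociator hF))
    (coassocB_commute (inverse_coassociator_commute hF) x)

/-- The adjoint form of the annihilators is the original form for redressed generators. -/
theorem IsCovariant.adjAn_eq {F : ((UT 𝔤 2)⟦X⟧)ˣ} (hF : IsTwist F) {α : ι → (Heis ι s)⟦X⟧}
    (h : IsCovariant ρ (repDualHom ρ) α) :
    adjAn ρ F α = defAn ρ F (redressAn ρ (coassociator F) α) := by
  have h := isLeftCovariant_iff.2 h
  -- The tuple `β = [(ρ ⊗ σ)(T'⁻¹)] α` is covariant, so that the remaining factor `𝓕` can be moved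
  -- to its right.
  have hβ := h.contract (inverse_coassocB_commute hF)
  funext i
  rw [adjAn, h.sandwich_eq, Finset.mul_sum]
  simp only [← mul_assoc, ← pairEntry_leg_one_mul, contractB_eq hF]
  rw [sum_pairEntry_mul_mul, hβ.sum_pairEntry_mul, contractC_eq hF, sum_mul_pairEntry_mul, defAn_eq]
  rfl

theorem IsCovariant.redressAn {F : ((UT 𝔤 2)⟦X⟧)ˣ} (hF : IsTwist F) {α : ι → (Heis ι s)⟦X⟧}
    (h : IsCovariant ρ (repDualHom ρ) α) :
    IsCovariant ρ (repDualHom ρ) (redressAn ρ (coassociator F) α) := by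
  have hβ := isLeftCovariant_iff.1 ((isLeftCovariant_iff.2 h).contract (inverse_coassocB_commute hF))
  refine hβ.contract fun x => Commute.mul_left ?_
    (commute_hLeg_of_central 0 (commute_hAntipode (commute_coassocZ (coassociator_commute hF))) _)
  exact commute_inverse_left (isUnit_coassocC (constantCoeff_inverse_coassociator hF))
    (coassocC_commute (inverse_coassociator_commute hF) x)

end AdjointGenerators

end TwistedHeisenberg

end

open TwistedHeisenberg in
theorem mainTheorem4 {𝔤 ι : Type*} [LieRing 𝔤] [LieAlgebra ℂ 𝔤] [Fintype ι] [DecidableEq ι]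
    (ρ : 𝔤 →ₗ⁅ℂ⁆ Matrix ι ι ℂ) (s : ℤˣ)
    (F : ((UT 𝔤 2)⟦X⟧)ˣ) (hF : IsTwist F)
    (u u' v v' : (Heis ι s)⟦X⟧) (hu : IsInvariantUnit ρ u) (hu' : IsInvariantUnit ρ u')
    (hv : IsInvariantUnit ρ v) (hv' : IsInvariantUnit ρ v') (k h : ℕ) :
    Set.BijOn (twTensor ρ F k h) {d | IsIsotropic ρ k h d} {D | IsTwIsotropic ρ F k h D} ∧
    ∀ d D, IsIsotropic ρ k h d → IsTwIsotropic ρ F k h D → D = twTensor ρ F k h d →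
      defInvariant k h (defCr ρ F (dressCr v v')) (defAn ρ F (dressAn u u')) D
        = dressedContraction ρ k h (dressCr v v') (dressAn u u')
            (Ring.inverse (coassociator F)) d ∧
      defInvariant k h (adjCr ρ F (dressCr v v')) (adjAn ρ F (dressAn u u')) D
        = dressedContraction ρ k h (redressCr ρ (coassociator F) (dressCr v v'))
            (redressAn ρ (coassociator F) (dressAn u u'))
            (Ring.inverse (coassociator F)) d := by
  have hcr := dressCr_covariant hv hv'
  have han := dressAn_covariant hu hu'
  refine ⟨bijOn_twTensor ρ hF k h, ?_⟩
  rintro d _ hd - rfl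
  refine ⟨defInvariant_eq ρ hF k h hcr han hd, ?_⟩
  rw [hcr.adjCr_eq hF, han.adjAn_eq hF]
  exact defInvariant_eq ρ hF k h (hcr.redressCr hF) (han.redressAn hF) hd
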